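/- Let $A$ be a unital $C^*$-algebra. A quasitrace on $A$ is a function $\tau:A\to\mathbb C$ such that (i) $\tau(x^*x)=\tau(xx^*)\ge 0$ for all $x\in A$; (ii) $\tau(a+ib)=\tau(a)+i\tau(b)$ for self-adjoint $a,b\in A$; (iii) $\tau$ is linear on every abelian $C^*$-subalgebra of $A$; (iv) there is a function $\tau_2:M_2(A)\to\mathbb C$ satisfying (i), (ii), (iii) with $\tau(x)=\tau_2(x\otimes e_{11})$ for all $x\in A$. Let $QT(A)$ be the set of quasitraces with $\tau(1)=1$, and call $\tau$ faithful if $\tau(x^*x)=0$ implies $x=0$. For a faithful quasitrace $\tau$ put $\|x\|_2=\tau(x^*x)^{1/2}$ and $d_\tau(x,y)=\|x-y\|_2^{2/3}$. Let $\ell^\infty(A)$ be the $C^*$-algebra of norm-bounded sequences in $A$, let $\tilde A\subseteq\ell^\infty(A)$ be the set of norm-bounded sequences that are Cauchy for $d_\tau$, and let $\tilde I\subseteq\tilde A$ be the set of norm-bounded sequences that converge to $0$ for $d_\tau$. The $AW^*$-completion of $(A,\tau)$ is the quotient $C^*$-algebra $\tilde A/\tilde I$. **Proposition 4.6.** Let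 $\tau$ be a faithful normalized quasitrace on a unital $C^*$-algebra $A$. If $\tau$ is an extreme point of $QT(A)$, then the $AW^*$-completion of $(A,\tau)$ is a finite $AW^*$-factor. In detail: $\tilde A$ is a norm-closed $*$-subalgebra of $\ell^\infty(A)$, $\tilde I$ is a norm-closed two-sided ideal of $\tilde A$, and $B=\tilde A/\tilde I$ is a non-zero $C^*$-algebra such that the right annihilator of every subset of $B$ is $eB$ for some projection $e\in B$ (that is, $B$ is an $AW^*$-algebra), $v^*v=1$ implies $vv^*=1$ for $v\in B$ (finiteness), and the center of $B$ is $\mathbb C1$ (factor). -/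

import Mathlib

open scoped BoundedContinuousFunction Topology

noncomputable section

/-! ### Quasitraces -/

/-- The first three axioms of a quasitrace, for a function `τ` on a unital topological `*`-algebra:
`τ (x* x) = τ (x x*) ≥ 0`, `τ (a + i b) = τ a + i τ b` for self-adjoint `a`, `b`, and linearity of
`τ` on every abelian `C*`-subalgebra (closed commutative `*`-subalgebra, unital or not). -/
structure IsOneQuasitrace {A : Type*} [Ring A] [StarRing A] [Algebra ℂ A] [TopologicalSpace A]
    (τ : A → ℂ) : Prop where
  tracial : ∀ x : A, τ (star x * x) = τ (x * star x)
  nonneg : ∀ x : A, 0 ≤ (τ (star x * x)).re ∧ (τ (star x * x)).im = 0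
  add_I_smul : ∀ a b : A, IsSelfAdjoint a → IsSelfAdjoint b →
    τ (a + Complex.I • b) = τ a + Complex.I * τ b
  add_of_abelian : ∀ B : NonUnitalStarSubalgebra ℂ A, IsClosed (B : Set A) →
    (∀ x ∈ B, ∀ y ∈ B, x * y = y * x) → ∀ x ∈ B, ∀ y ∈ B, τ (x + y) = τ x + τ y
  smul_of_abelian : ∀ B : NonUnitalStarSubalgebra ℂ A, IsClosed (B : Set A) →
    (∀ x ∈ B, ∀ y ∈ B, x * y = y * x) → ∀ (c : ℂ), ∀ x ∈ B, τ (c • x) = c * τ x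

/-- A quasitrace on a unital `C*`-algebra `A`: a function satisfying the three axioms above which is
of the form `x ↦ τ₂ (x ⊗ e₁₁)` for a function `τ₂` on `M₂(A)` satisfying the same three axioms. -/
structure IsQuasitrace {A : Type*} [CStarAlgebra A] (τ : A → ℂ) : Prop
    extends IsOneQuasitrace τ where
  exists_matrix : ∃ τ₂ : CStarMatrix (Fin 2) (Fin 2) A → ℂ, IsOneQuasitrace τ₂ ∧
    ∀ x : A, τ x = τ₂ (CStarMatrix.ofMatrix (Matrix.single 0 0 x))

/-- The set `QT(A)` of normalized quasitraces, inside the vector space of functions `A → ℂ`. -/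
def normalizedQuasitraces (A : Type*) [CStarAlgebra A] : Set (A → ℂ) :=
  {τ | IsQuasitrace τ ∧ τ 1 = 1}

/-- Faithfulness: `τ (x* x) = 0` only for `x = 0`. -/
def IsFaithful {A : Type*} [CStarAlgebra A] (τ : A → ℂ) : Prop :=
  ∀ x : A, τ (star x * x) = 0 → x = 0

/-- `‖x‖₂ = τ (x* x) ^ (1/2)`. -/
def twoNorm {A : Type*} [CStarAlgebra A] (τ : A → ℂ) (x : A) : ℝ :=
  (τ (star x * x)).re ^ (1 / 2 : ℝ)

/-- `d_τ (x, y) = ‖x - y‖₂ ^ (2/3)`. -/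
def quasiDist {A : Type*} [CStarAlgebra A] (τ : A → ℂ) (x y : A) : ℝ :=
  twoNorm τ (x - y) ^ (2 / 3 : ℝ)

/-! ### Finite `AW*`-factors -/

/-- An `AW*`-algebra: a `C*`-algebra in which the right annihilator of every subset is `e B` for some
projection `e` (here `x ∈ e B` is written `e * x = x`). -/
def IsAWStarAlgebra (B : Type*) [CStarAlgebra B] : Prop :=
  ∀ S : Set B, ∃ e : B, IsStarProjection e ∧ ∀ x : B, (∀ s ∈ S, s * x = 0) ↔ e * x = x

/-- A finite `AW*`-factor: a non-zero `AW*`-algebra in which every isometry is unitary and whose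
center consists of the scalars. -/
structure IsFiniteAWStarFactor (B : Type*) [CStarAlgebra B] : Prop where
  nontrivial : Nontrivial B
  awStar : IsAWStarAlgebra B
  finite : ∀ v : B, star v * v = 1 → v * star v = 1
  factor : ∀ z ∈ Subalgebra.center ℂ B, ∃ c : ℂ, z = algebraMap ℂ B c

/-! ### The quotient of a `C*`-algebra by a closed two-sided `*`-ideal -/

namespace CStarQuotient

variable {C : Type*} [CStarAlgebra C]

/-- A closed two-sided `*`-invariant ideal. -/
structure IsClosedStarIdeal (I : Ideal C) : Prop where
  twoSided : I.IsTwoSided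
  isClosed : IsClosed (I : Set C)
  star_mem : ∀ x ∈ I, star x ∈ I

theorem exists_norm_add_sq_le {I : Ideal C} (hI : IsClosedStarIdeal I) (x i : C) (hi : i ∈ I)
    {δ : ℝ} (hδ : 0 < δ) : ∃ j ∈ I, ‖x + j‖ ^ 2 ≤ ‖star x * x + i‖ + δ := by
  have := hI.twoSided
  -- replace `i` by a self-adjoint element
  obtain ⟨k, hk, hksa, hki⟩ : ∃ k ∈ I, IsSelfAdjoint k ∧
      ‖star x * x + k‖ ≤ ‖star x * x + i‖ := by
    refine ⟨(1 / 2 : ℝ) • (i + star i), ?_, ?_, ?_⟩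
    · rw [← smul_one_mul]
      exact I.mul_mem_left _ (I.add_mem hi (hI.star_mem i hi))
    · rw [isSelfAdjoint_iff]
      simp [add_comm]
    · have : star x * x + (1 / 2 : ℝ) • (i + star i)
          = (1 / 2 : ℝ) • ((star x * x + i) + star (star x * x + i)) := by
        simp only [star_add, star_mul, star_star, smul_add]
        module
      rw [this, norm_smul]
      have h2 := norm_add_le (star x * x + i) (star (star x * x + i))
      rw [norm_star] at h2
      rw [Real.norm_of_nonneg (by norm_num)]
      linarith
  have hne : ∀ t : ℝ, t ^ 2 + δ ^ 2 ≠ 0 := fun t => by positivity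
  have hcont : Continuous fun t : ℝ => (t ^ 2 + δ ^ 2)⁻¹ :=
    Continuous.inv₀ (by fun_prop) hne
  let f : ℝ → ℝ := fun t => δ ^ 2 * (t ^ 2 + δ ^ 2)⁻¹
  let h : ℝ → ℝ := fun t => (t ^ 2 + δ ^ 2)⁻¹
  have hf : Continuous f := by fun_prop
  have hh : Continuous h := by fun_prop
  set g := cfc f k with hg
  have hgsa : IsSelfAdjoint g := cfc_predicate f k
  have hg1 : ‖g‖ ≤ 1 := by
    refine norm_cfc_le zero_le_one fun t _ => ?_
    rw [Real.norm_of_nonneg (by positivity)]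
    simp only [f]
    rw [← div_eq_mul_inv, div_le_one (by positivity)]
    nlinarith [sq_nonneg t]
  have hkg : ‖k * g‖ ≤ δ := by
    have : k * g = cfc (fun t => t * f t) k := by
      rw [cfc_mul (fun t => t) f k (by fun_prop) hf.continuousOn, cfc_id' ℝ k]
    rw [this]
    refine norm_cfc_le hδ.le fun t _ => ?_
    simp only [f]
    rw [Real.norm_eq_abs, ← mul_assoc, ← div_eq_mul_inv, abs_div,
      abs_of_pos (show 0 < t ^ 2 + δ ^ 2 by positivity), div_le_iff₀ (by positivity), abs_mul,
      abs_of_pos (show 0 < δ ^ 2 by positivity)]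
    nlinarith [sq_nonneg (|t| - δ), sq_abs t, abs_nonneg t, mul_pos hδ hδ]
  have hgI : 1 - g ∈ I := by
    have : 1 - g = cfc h k * k * k := by
      have h1 : cfc (fun t => h t * t * t) k = cfc h k * k * k := by
        rw [cfc_mul (fun t => h t * t) (fun t => t) k (by fun_prop) (by fun_prop),
          cfc_mul h (fun t => t) k hh.continuousOn (by fun_prop), cfc_id' ℝ k]
      have h2 : f = fun t => 1 - h t * t * t := by
        funext t
        have := hne t
        simp only [f, h]
        field_simp
        ring
      rw [hg, h2, cfc_sub (fun _ => (1 : ℝ)) (fun t => h t * t * t) k (by fun_prop) (by fun_prop),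
        cfc_const_one ℝ k, h1]
      noncomm_ring
    rw [this]
    exact I.mul_mem_left _ hk
  refine ⟨-(x * (1 - g)), I.neg_mem (I.mul_mem_left _ hgI), ?_⟩
  have e1 : x + -(x * (1 - g)) = x * g := by noncomm_ring
  have e2 : star (x * g) * (x * g) = g * (star x * x + k) * g - g * (k * g) := by
    rw [star_mul, hgsa.star_eq]; noncomm_ring
  rw [e1, sq, ← CStarRing.norm_star_mul_self, e2]
  calc ‖g * (star x * x + k) * g - g * (k * g)‖
      ≤ ‖g * (star x * x + k) * g‖ + ‖g * (k * g)‖ := norm_sub_le _ _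
    _ ≤ 1 * ‖star x * x + k‖ * 1 + 1 * δ := by
        gcongr
        · refine (norm_mul_le _ _).trans ?_
          gcongr
          refine (norm_mul_le _ _).trans ?_
          gcongr
        · refine (norm_mul_le _ _).trans ?_
          gcongr
    _ ≤ _ := by linarith

/-- The quotient of a `C*`-algebra by a closed two-sided `*`-ideal, with the quotient norm
`‖x + I‖ = inf {‖x + j‖ | j ∈ I}`, is a `C*`-algebra. -/
@[reducible] def cstarAlgebra {I : Ideal C} (hI : IsClosedStarIdeal I) : CStarAlgebra (C ⧸ I) :=
  haveI : I.IsTwoSided := hI.twoSided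
  haveI : IsClosed (I : Set C) := hI.isClosed
  { (inferInstance : NormedAddCommGroup (C ⧸ I)), Ideal.Quotient.ring I,
    Ideal.Quotient.algebra ℂ (I := I) with
    norm_mul_le := by
      intro x y
      refine le_of_tendsto_of_tendsto (f := fun _ : ℝ => ‖x * y‖) (b := 𝓝[>] (0 : ℝ))
        (g := fun ε => (‖x‖ + ε) * (‖y‖ + ε)) tendsto_const_nhds ?_ ?_
      · have : Continuous fun ε : ℝ => (‖x‖ + ε) * (‖y‖ + ε) := by fun_prop
        simpa using (this.tendsto 0).mono_left nhdsWithin_le_nhds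
      · filter_upwards [self_mem_nhdsWithin] with ε hε
        obtain ⟨a, rfl, ha⟩ := Submodule.Quotient.norm_mk_lt x hε
        obtain ⟨b, rfl, hb⟩ := Submodule.Quotient.norm_mk_lt y hε
        calc _ ≤ ‖a * b‖ := Submodule.Quotient.norm_mk_le I (a * b)
          _ ≤ ‖a‖ * ‖b‖ := norm_mul_le a b
          _ ≤ _ := mul_le_mul ha.le hb.le (norm_nonneg _) ((norm_nonneg _).trans ha.le)
    star := Quotient.map' star (by
      intro a b hab
      rw [Submodule.quotientRel_def] at hab ⊢
      rw [← star_sub]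
      exact hI.star_mem _ hab)
    star_involutive := by
      rintro ⟨a⟩
      exact congrArg (Submodule.Quotient.mk (p := I)) (star_star a)
    star_mul := by
      rintro ⟨a⟩ ⟨b⟩
      exact congrArg (Submodule.Quotient.mk (p := I)) (star_mul a b)
    star_add := by
      rintro ⟨a⟩ ⟨b⟩
      exact congrArg (Submodule.Quotient.mk (p := I)) (star_add a b)
    complete := fun h => CompleteSpace.complete h
    norm_mul_self_le := by
      rintro ⟨x⟩
      refine le_of_forall_pos_le_add fun ε hε => ?_
      obtain ⟨z, hz, hzn⟩ := Submodule.Quotient.norm_mk_lt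
        (Submodule.Quotient.mk (p := I) (star x * x)) (half_pos hε)
      obtain ⟨j, hj, hjn⟩ := exists_norm_add_sq_le hI x (z - star x * x)
        ((Submodule.Quotient.eq I).1 hz) (half_pos hε)
      have hx : Submodule.Quotient.mk (p := I) (x + j) = Submodule.Quotient.mk x :=
        (Submodule.Quotient.eq I).2 (by simpa using hj)
      have hle := Submodule.Quotient.norm_mk_le I (x + j)
      rw [hx] at hle
      rw [add_sub_cancel] at hjn
      calc _ = ‖Submodule.Quotient.mk (p := I) x‖ ^ 2 := (sq _).symm
        _ ≤ ‖x + j‖ ^ 2 := by gcongr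
        _ ≤ ‖Submodule.Quotient.mk (p := I) (star x * x)‖ + ε := by linarith
    norm_smul_le := fun c x => norm_smul_le c x
    star_smul := by
      rintro c ⟨a⟩
      exact congrArg (Submodule.Quotient.mk (p := I)) (star_smul c a) }

end CStarQuotient

/-! ### The `AW*`-completion -/

section Completion

variable {A : Type*} [CStarAlgebra A]

/-- The bounded sequences in `A` (functions `ℕ → A` bounded in norm, as elements of `ℓ^∞(A)`) that
are Cauchy sequences with respect to `d_τ`. -/
def cauchySequences (τ : A → ℂ) : Set (ℕ →ᵇ A) :=
  {x | ∀ ε : ℝ, 0 < ε → ∃ N : ℕ, ∀ m ≥ N, ∀ n ≥ N, quasiDist τ (x m) (x n) < ε}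

/-- The bounded sequences in `A` that converge to `0` with respect to `d_τ`. -/
def nullSequences (τ : A → ℂ) : Set (ℕ →ᵇ A) :=
  {x | Filter.Tendsto (fun n => quasiDist τ (x n) 0) Filter.atTop (𝓝 0)}

/-- The `C*`-algebra of bounded `d_τ`-Cauchy sequences. So that the definition makes sense for every
function `τ`, it is written as the closed `*`-subalgebra of `ℓ^∞(A)` generated by these sequences;
for a faithful quasitrace they form a closed `*`-subalgebra already. -/
def cauchyAlgebra (τ : A → ℂ) : StarSubalgebra ℂ (ℕ →ᵇ A) :=
  (StarAlgebra.adjoin ℂ (cauchySequences τ)).topologicalClosure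

instance (τ : A → ℂ) : CStarAlgebra (cauchyAlgebra τ) :=
  StarSubalgebra.cstarAlgebra (cauchyAlgebra τ)
    (h_closed := StarSubalgebra.isClosed_topologicalClosure _)

/-- The ideal of bounded `d_τ`-null sequences. So that the definition makes sense for every function
`τ`, it is written as the smallest closed two-sided `*`-ideal of `cauchyAlgebra τ` which contains
these sequences; for a faithful quasitrace they form a closed two-sided ideal already. -/
def nullIdeal (τ : A → ℂ) : Ideal (cauchyAlgebra τ) :=
  sInf {J | CStarQuotient.IsClosedStarIdeal J ∧ ∀ x : cauchyAlgebra τ,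
    (x : ℕ →ᵇ A) ∈ nullSequences τ → x ∈ J}

theorem isClosedStarIdeal_nullIdeal (τ : A → ℂ) :
    CStarQuotient.IsClosedStarIdeal (nullIdeal τ) where
  twoSided := ⟨fun {a} b ha => by
    simp only [nullIdeal, Submodule.mem_sInf] at ha ⊢
    intro J hJ
    have := hJ.1.twoSided
    exact Ideal.IsTwoSided.mul_mem_of_left b (ha J hJ)⟩
  isClosed := by
    rw [nullIdeal, Submodule.coe_sInf]
    exact isClosed_biInter fun J hJ => hJ.1.isClosed
  star_mem x hx := by
    simp only [nullIdeal, Submodule.mem_sInf] at hx ⊢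
    exact fun J hJ => hJ.1.star_mem x (hx J hJ)

/-- The `AW*`-completion of `(A, τ)`: bounded `d_τ`-Cauchy sequences modulo bounded `d_τ`-null
sequences. -/
def AWStarCompletion (τ : A → ℂ) : Type _ := cauchyAlgebra τ ⧸ nullIdeal τ

instance (τ : A → ℂ) : CStarAlgebra (AWStarCompletion τ) :=
  CStarQuotient.cstarAlgebra (isClosedStarIdeal_nullIdeal τ)

end Completion

end

/-! The completion `B` carries a faithful quasitrace `T` induced by `τ`, with an extension to the `2
× 2` matrices, and bounded sequences that are Cauchy for its seminorm converge. The three assertions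
about `B` are read off from `T`. An increasing or decreasing family of projections converges as soon
as its values under `T` do, which produces annihilator projections. If `v* v = 1`, then `T (1 - v
v*) = 0`, so `v v* = 1`. If `c` is a small self-adjoint central element with `l = T (c²) > 0`, then
`l⁻¹ T (c · c)` and `(1 - l)⁻¹ (T - T (c · c))` restrict to normalized quasitraces on `A` of which
`τ` is a convex combination. Extremality gives `T (c a c) = l T a` on `A`; density allows `a = c²`
up to an inequality, so `T (c⁴) ≤ l²` and `T ((c² - l)²) ≤ 0`. Hence `c²` is a scalar, and then so
is every central element.

The work lies in the missing additivity of `τ`. Three facts replace it. Quasitraces are monotone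
(`IsRealQuasitrace.mono`), by cutting elements into layers and comparing layers through `t (Z* Z) =
t (Z Z*)`. The value of `t` depends only on the class modulo the null ideal
(`IsCompleteQuotient.eq_of_map_eq`), which cannot be deduced from `t (a - b) = 0`. The induced
functional is additive on commuting elements (`IsCompleteQuotient.quotientTrace_add`), although
commuting elements need not lift to commuting ones. The last two rest on spectral projections in the
quotient, so annihilators of single elements (`IsCompleteQuotient.exists_annihilator`) are built
before the quotient has a trace.

The matrix extension supplies the inequality `IsMatrixExtension.sqNorm_add_le` that replaces the
triangle inequality. On Cauchy sequences the trace is a limit along a free ultrafilter; a diagonal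
argument gives completeness, and the constant sequences are dense. -/

open scoped CStarAlgebra

noncomputable section

/-! ### Real quasitraces and the comparison of positive elements -/

/-- A function on a `C*`-algebra whose restriction to the self-adjoint elements is a positive,
real-homogeneous, tracial functional which is additive on commuting elements. -/
structure IsRealQuasitrace {L : Type*} [CStarAlgebra L] (t : L → ℝ) : Prop where
  tracial : ∀ x : L, t (star x * x) = t (x * star x)
  nonneg : ∀ x : L, 0 ≤ t (star x * x)
  add : ∀ a b : L, IsSelfAdjoint a → IsSelfAdjoint b → Commute a b → t (a + b) = t a + t b
  smul : ∀ (r : ℝ) (a : L), IsSelfAdjoint a → t (r • a) = r * t a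

theorem cfc_mul_self_eq {L : Type*} [CStarAlgebra L] {a : L} (ha : IsSelfAdjoint a) {f : ℝ → ℝ}
    (hf : Continuous f) : cfc f a * a = cfc (fun x => f x * x) a := by
  rw [cfc_mul f (fun x => x) a (by fun_prop) (by fun_prop), cfc_id' ℝ a]

section Comparison

variable {L : Type*} [CStarAlgebra L] [PartialOrder L] [StarOrderedRing L]

/-- Conjugating `e² ≤ c⁻¹ y` by `D = d(y)` gives `D e² D ≤ c⁻¹ D y D`, and the right side is a
function of `y`. Bounds on the spectrum of `y` thereby become norm bounds for products with `e`,
even if `d` is large near `0`. -/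
theorem norm_cfc_mul_sq_le {e y : L} (he : IsSelfAdjoint e) (hy : IsSelfAdjoint y) {c β : ℝ}
    (hc : 0 < c) (hβ : 0 ≤ β) (h : c • (e * e) ≤ y) {d : ℝ → ℝ} (hd : Continuous d)
    (hb : ∀ x ∈ spectrum ℝ y, |x * d x ^ 2| ≤ β) : ‖cfc d y * e‖ ^ 2 ≤ c⁻¹ * β := by
  set D := cfc d y with hD
  have hDsa : IsSelfAdjoint D := cfc_predicate d y
  have h1 : D * (e * e) * D ≤ c⁻¹ • (D * y * D) := by
    have h2 : e * e ≤ c⁻¹ • y := by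
      have := smul_le_smul_of_nonneg_left h (inv_nonneg.2 hc.le)
      rwa [smul_smul, inv_mul_cancel₀ hc.ne', one_smul] at this
    have := hDsa.conjugate_le_conjugate h2
    simpa [mul_smul_comm, smul_mul_assoc] using this
  have h0 : 0 ≤ D * (e * e) * D := by
    have := mul_star_self_nonneg (D * e)
    rwa [star_mul, he.star_eq, hDsa.star_eq, show D * e * (e * D) = D * (e * e) * D by noncomm_ring]
      at this
  have h3 : ‖D * y * D‖ ≤ β := by
    have : D * y * D = cfc (fun x => x * d x ^ 2) y := by
      rw [hD, ← cfc_id' ℝ y, cfc_id' ℝ y, show (fun x => x * d x ^ 2) = fun x => d x * x * d x by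
        ext; ring, cfc_mul (fun x => d x * x) d y (by fun_prop) (by fun_prop),
        cfc_mul d (fun x => x) y (by fun_prop) (by fun_prop), cfc_id' ℝ y]
    rw [this]
    exact norm_cfc_le hβ fun x hx => by simpa using hb x hx
  have h4 : ‖D * e‖ ^ 2 = ‖D * (e * e) * D‖ := by
    rw [sq, ← CStarRing.norm_self_mul_star, star_mul, he.star_eq, hDsa.star_eq]
    congr 1; noncomm_ring
  rw [h4]
  refine (CStarAlgebra.norm_le_norm_of_nonneg_of_le h0 h1).trans ?_
  rw [norm_smul, Real.norm_of_nonneg (inv_nonneg.2 hc.le)]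
  gcongr

/-- If `e²` is dominated by a multiple of `(s e)* (s e)`, then `e² = Z* Z` for some `Z` whose
"range" is contained in that of `s`. -/
theorem exists_star_mul_self_eq_of_le {e s : L} (he : IsSelfAdjoint e) {c : ℝ} (hc : 0 < c)
    (h : c • (e * e) ≤ star (s * e) * (s * e)) :
    ∃ Z : L, star Z * Z = e * e ∧ ∀ g : L, g * s = s → g * Z = Z := by
  set Y := s * e with hY
  set y := star Y * Y with hy
  have hysa : IsSelfAdjoint y := .star_mul_self Y
  have hy0 : 0 ≤ y := star_mul_self_nonneg Y
  have hspec : ∀ x ∈ spectrum ℝ y, 0 ≤ x := fun x hx => spectrum_nonneg_of_nonneg hy0 hx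
  -- `Z` is the limit of `Y (y + 1/(n+1))^(-1/2) e`, formally the polar part of `Y` times `e`. The
  -- polar part may lie outside `L`, but the domination `c e² ≤ y` forces norm convergence once `e`
  -- is multiplied in.
  let φ : ℕ → ℝ → ℝ := fun n x => (√(|x| + 1 / ((n : ℝ) + 1)))⁻¹
  have hpos : ∀ (n : ℕ) (x : ℝ), 0 < |x| + 1 / ((n : ℝ) + 1) := fun n x => by positivity
  have hφ : ∀ n, Continuous (φ n) := fun n =>
    Continuous.inv₀ (by fun_prop) fun x => (Real.sqrt_pos.2 (hpos n x)).ne'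
  let Z : ℕ → L := fun n => Y * cfc (φ n) y * e
  -- `Y d(y)` and `√y d(y)` have the same modulus, so `Y` can be traded for a function of `y`.
  have hnorm : ∀ {d : ℝ → ℝ} (_ : Continuous d) {β : ℝ} (_ : 0 ≤ β)
      (_ : ∀ x ∈ spectrum ℝ y, |x * d x| ≤ β), ‖Y * cfc d y * e‖ ^ 2 ≤ c⁻¹ * β ^ 2 := by
    intro d hd β hβ hb
    have h1 : ‖Y * cfc d y * e‖ = ‖cfc (fun x => √|x| * d x) y * e‖ := by
      have hDsa : IsSelfAdjoint (cfc d y) := cfc_predicate d y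
      have hDsa' : IsSelfAdjoint (cfc (fun x => √|x| * d x) y) := cfc_predicate _ y
      have e1 : star (Y * cfc d y * e) * (Y * cfc d y * e)
          = star (cfc (fun x => √|x| * d x) y * e) * (cfc (fun x => √|x| * d x) y * e) := by
        have e2 : cfc (fun x => √|x| * d x) y * cfc (fun x => √|x| * d x) y
            = cfc d y * y * cfc d y := by
          rw [← cfc_mul _ _ y (by fun_prop) (by fun_prop)]
          rw [cfc_mul_self_eq hysa hd, ← cfc_mul _ _ y (by fun_prop) (by fun_prop)]
          refine cfc_congr fun x hx => ?_
          have hx0 := hspec x hx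
          have := Real.mul_self_sqrt hx0
          simp only [abs_of_nonneg hx0]
          linear_combination d x ^ 2 * this
        simp only [star_mul, he.star_eq, hDsa.star_eq, hDsa'.star_eq]
        calc e * (cfc d y * star Y) * (Y * cfc d y * e) = e * (cfc d y * (star Y * Y) * cfc d y) * e := by
              noncomm_ring
          _ = _ := by rw [← hy, ← e2]; noncomm_ring
      have := congrArg norm e1
      rw [CStarRing.norm_star_mul_self, CStarRing.norm_star_mul_self, ← sq, ← sq] at this
      exact (sq_eq_sq₀ (norm_nonneg _) (norm_nonneg _)).1 this
    rw [h1]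
    refine norm_cfc_mul_sq_le he hysa hc (by positivity) h (by fun_prop) fun x hx => ?_
    have hx0 := hspec x hx
    have h2 := hb x hx
    rw [mul_pow, abs_of_nonneg hx0, Real.sq_sqrt hx0,
      show x * (x * d x ^ 2) = (x * d x) ^ 2 by ring, abs_pow]
    gcongr
  have hbound : ∀ (n : ℕ) (x : ℝ), 0 ≤ x →
      √x - √(1 / ((n : ℝ) + 1)) ≤ x * φ n x ∧ x * φ n x ≤ √x := by
    intro n x hx
    simp only [φ, abs_of_nonneg hx]
    set δ : ℝ := 1 / ((n : ℝ) + 1) with hδ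
    have hδ0 : 0 < δ := by positivity
    have hs : 0 < √(x + δ) := Real.sqrt_pos.2 (by positivity)
    have h1 : √x ≤ √(x + δ) := Real.sqrt_le_sqrt (by linarith)
    have h2 : √(x + δ) ≤ √x + √δ := by
      rw [Real.sqrt_le_left (by positivity)]
      nlinarith [Real.mul_self_sqrt hx, Real.mul_self_sqrt hδ0.le, Real.sqrt_nonneg x,
        Real.sqrt_nonneg δ, mul_nonneg (Real.sqrt_nonneg x) (Real.sqrt_nonneg δ)]
    have hxx := Real.mul_self_sqrt hx
    have hd0 := Real.sqrt_nonneg δ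
    have hx0 := Real.sqrt_nonneg x
    rw [← div_eq_mul_inv]
    constructor
    · rw [le_div_iff₀ hs]
      by_cases hcase : √x ≤ √δ
      · nlinarith
      · push Not at hcase
        nlinarith [mul_nonneg hd0 hd0]
    · rw [div_le_iff₀ hs]
      nlinarith
  have hcauchy : CauchySeq Z := by
    refine cauchySeq_of_le_tendsto_0 (fun N => √(c⁻¹ * (√(1 / ((N : ℝ) + 1))) ^ 2)) ?_ ?_
    · intro n m N hn hm
      rw [dist_eq_norm]
      have e1 : Z n - Z m = Y * cfc (fun x => φ n x - φ m x) y * e := by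
        simp only [Z]
        rw [cfc_sub (φ n) (φ m) y (hφ n).continuousOn (hφ m).continuousOn]
        noncomm_ring
      rw [e1]
      refine Real.le_sqrt_of_sq_le (hnorm ((hφ n).sub (hφ m)) (Real.sqrt_nonneg _) fun x hx => ?_)
      have hx0 := hspec x hx
      have hmono : ∀ k : ℕ, N ≤ k → √(1 / ((k : ℝ) + 1)) ≤ √(1 / ((N : ℝ) + 1)) := fun k hk =>
        Real.sqrt_le_sqrt (one_div_le_one_div_of_le (by positivity) (by
          have : (N : ℝ) ≤ k := by exact_mod_cast hk
          linarith))
      have h1 := hbound n x hx0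
      have h2 := hbound m x hx0
      have h3 := hmono n hn
      have h4 := hmono m hm
      rw [Pi.sub_apply, mul_sub, abs_le]
      constructor <;> linarith
    · have h1 : Filter.Tendsto (fun N : ℕ => 1 / ((N : ℝ) + 1)) Filter.atTop (𝓝 0) :=
        tendsto_one_div_add_atTop_nhds_zero_nat
      have h2 : Continuous fun u : ℝ => √(c⁻¹ * (√u) ^ 2) := by fun_prop
      simpa [Function.comp_def] using (h2.tendsto 0).comp h1
  obtain ⟨W, hW⟩ := cauchySeq_tendsto_of_complete hcauchy
  refine ⟨W, ?_, fun g hg => ?_⟩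
  · have h1 : Filter.Tendsto (fun n => star (Z n) * Z n) Filter.atTop (𝓝 (star W * W)) :=
      (hW.star).mul hW
    refine tendsto_nhds_unique h1 ?_
    rw [tendsto_iff_norm_sub_tendsto_zero]
    refine squeeze_zero (fun _ => norm_nonneg _) (g := fun n : ℕ => c⁻¹ * (1 / ((n : ℝ) + 1)))
      (fun n => ?_) ?_
    · set δ : ℝ := 1 / ((n : ℝ) + 1) with hδ
      have hδ0 : 0 < δ := by positivity
      -- On the spectrum `ρ(x)² = 1 - x φ_n(x)²`, so `ρ(y) e` accounts exactly for the defect `e² -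
      -- Z_n* Z_n`; moreover `x ρ(x)² ≤ δ`.
      let ρ : ℝ → ℝ := fun x => √(δ / (|x| + δ))
      have hρ : Continuous ρ :=
        Real.continuous_sqrt.comp (continuous_const.div (by fun_prop) fun x => (hpos n x).ne')
      have hρsa : IsSelfAdjoint (cfc ρ y) := cfc_predicate ρ y
      have hsa : IsSelfAdjoint (cfc (φ n) y) := cfc_predicate _ y
      have e1 : e * e - star (Z n) * Z n = star (cfc ρ y * e) * (cfc ρ y * e) := by
        have e2 : cfc ρ y * cfc ρ y = 1 - cfc (φ n) y * y * cfc (φ n) y := by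
          have hc1 : Continuous (φ n) := hφ n
          rw [cfc_mul_self_eq hysa hc1, ← cfc_mul _ _ y (by fun_prop) (by fun_prop),
            ← cfc_mul _ _ y (by fun_prop) (by fun_prop), ← cfc_const_one ℝ y,
            ← cfc_sub _ _ y (by fun_prop) (by fun_prop)]
          refine cfc_congr fun x hx => ?_
          have hx0 := hspec x hx
          simp only [ρ, φ, abs_of_nonneg hx0]
          have hxδ : 0 < x + δ := by positivity
          rw [Real.mul_self_sqrt (by positivity), mul_right_comm, ← mul_inv,
            Real.mul_self_sqrt hxδ.le]
          field_simp
          ring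
        simp only [Z, star_mul, he.star_eq, hρsa.star_eq, hsa.star_eq]
        calc e * e - e * (cfc (φ n) y * star Y) * (Y * cfc (φ n) y * e)
            = e * (1 - cfc (φ n) y * (star Y * Y) * cfc (φ n) y) * e := by noncomm_ring
          _ = _ := by rw [← hy, ← e2]; noncomm_ring
      rw [norm_sub_rev, e1, CStarRing.norm_star_mul_self, ← sq]
      refine norm_cfc_mul_sq_le he hysa hc hδ0.le h hρ fun x hx => ?_
      have hx0 := hspec x hx
      simp only [ρ, abs_of_nonneg hx0]
      rw [Real.sq_sqrt (by positivity), abs_of_nonneg (by positivity), mul_div_assoc',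
        div_le_iff₀ (by positivity)]
      nlinarith
    · simpa using (tendsto_one_div_add_atTop_nhds_zero_nat (𝕜 := ℝ)).const_mul c⁻¹
  · refine tendsto_nhds_unique (hW.const_mul g) ?_
    convert hW using 2 with n
    simp only [Z, hY, ← mul_assoc, hg]

end Comparison

/-! ### Layer-cake sums and monotonicity -/

/-- The piecewise linear function which is `0` below `k / n - M` and `1` above `(k + 1) / n - M`. -/
def layer (n M : ℝ) (k : ℕ) (x : ℝ) : ℝ := max 0 (min 1 (n * (x + M) - k))

theorem continuous_layer (n M : ℝ) (k : ℕ) : Continuous (layer n M k) := by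
  unfold layer; fun_prop

theorem layer_nonneg (n M : ℝ) (k : ℕ) (x : ℝ) : 0 ≤ layer n M k x := le_max_left _ _

theorem layer_le_one (n M : ℝ) (k : ℕ) (x : ℝ) : layer n M k x ≤ 1 :=
  max_le zero_le_one (min_le_left _ _)

/-- Layer `k` is the part of `n (x + M)` between heights `k` and `k + 1`, so the layers stack up to
a truncation. -/
theorem sum_layer (n M x : ℝ) (K : ℕ) :
    ∑ k ∈ Finset.range K, layer n M k x = max 0 (min (n * (x + M)) K) := by
  induction K with
  | zero => simp
  | succ K ih =>
    rw [Finset.sum_range_succ, ih, layer]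
    push_cast
    have : (0 : ℝ) ≤ K := Nat.cast_nonneg K
    grind

theorem sum_cfc_layer {L : Type*} [CStarAlgebra L] {a : L} (ha : IsSelfAdjoint a) {M : ℕ}
    (hM : ‖a‖ ≤ M) (n : ℕ) :
    ∑ k ∈ Finset.range (n * (2 * M)), cfc (layer n M k) a
      = (n : ℝ) • (a + algebraMap ℝ L M) := by
  rw [← cfc_sum (fun k => layer n M k) a _ fun k _ => (continuous_layer _ _ _).continuousOn]
  conv_rhs => rw [← cfc_id' ℝ a, ← cfc_add_const (M : ℝ) (fun x => x) a (by fun_prop),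
    ← cfc_smul (n : ℝ) _ a (by fun_prop)]
  refine cfc_congr fun x hx => ?_
  have h1 : |x| ≤ M := by
    by_cases hL : Nontrivial L
    · exact (spectrum.norm_le_norm_of_mem hx).trans hM
    · rw [not_nontrivial_iff_subsingleton] at hL
      simp [spectrum.of_subsingleton] at hx
  rw [abs_le] at h1
  have hn : (0 : ℝ) ≤ n := Nat.cast_nonneg n
  simp only [Finset.sum_apply, sum_layer, smul_eq_mul]
  push_cast
  rw [min_eq_left, max_eq_right]
  · exact mul_nonneg hn (by linarith)
  · gcongr; linarith

namespace IsRealQuasitrace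

variable {L : Type*} [CStarAlgebra L] {t : L → ℝ} (ht : IsRealQuasitrace t)

include ht

theorem map_zero : t 0 = 0 := by simpa using ht.smul 0 0 (.zero L)

theorem map_neg {a : L} (ha : IsSelfAdjoint a) : t (-a) = -t a := by
  simpa using ht.smul (-1) a ha

theorem map_sub {a b : L} (ha : IsSelfAdjoint a) (hb : IsSelfAdjoint b) (h : Commute a b) :
    t (a - b) = t a - t b := by
  rw [sub_eq_add_neg, ht.add a (-b) ha hb.neg h.neg_right, ht.map_neg hb, sub_eq_add_neg]

theorem map_algebraMap (r : ℝ) : t (algebraMap ℝ L r) = r * t 1 := by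
  rw [Algebra.algebraMap_eq_smul_one, ht.smul r 1 (.one L)]

theorem map_add_algebraMap {a : L} (ha : IsSelfAdjoint a) (r : ℝ) :
    t (a + algebraMap ℝ L r) = t a + r * t 1 := by
  rw [ht.add _ _ ha (.algebraMap L (.all r)) (Algebra.commutes r a).symm, ht.map_algebraMap]

theorem map_cfc_add {a : L} (f g : ℝ → ℝ) : t (cfc f a + cfc g a) = t (cfc f a) + t (cfc g a) :=
  ht.add _ _ (cfc_predicate f a) (cfc_predicate g a) (cfc_commute_cfc f g a)

theorem map_cfc_sum {a : L} (f : ℕ → ℝ → ℝ) (s : Finset ℕ) :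
    t (∑ k ∈ s, cfc (f k) a) = ∑ k ∈ s, t (cfc (f k) a) := by
  classical
  induction s using Finset.induction_on with
  | empty => simpa using ht.map_zero
  | insert k s hk ih =>
    rw [Finset.sum_insert hk, Finset.sum_insert hk, ← ih]
    refine ht.add _ _ (cfc_predicate _ a) (isSelfAdjoint_sum _ fun i _ => cfc_predicate _ a)
      (Commute.sum_right _ _ _ fun i _ => cfc_commute_cfc _ _ a)

theorem map_one_nonneg : 0 ≤ t 1 := by simpa using ht.nonneg 1

section Order

variable [PartialOrder L] [StarOrderedRing L]

theorem map_nonneg {a : L} (ha : 0 ≤ a) : 0 ≤ t a := by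
  obtain ⟨x, rfl⟩ := CStarAlgebra.nonneg_iff_eq_star_mul_self.1 ha
  exact ht.nonneg x

theorem le_of_commute {a b : L} (ha : IsSelfAdjoint a) (hb : IsSelfAdjoint b) (h : Commute a b)
    (hab : a ≤ b) : t a ≤ t b := by
  have := ht.map_nonneg (sub_nonneg.2 hab)
  rw [ht.map_sub hb ha h.symm] at this
  linarith

theorem map_cfc_mono {a : L} {f g : ℝ → ℝ} (hf : Continuous f) (hg : Continuous g)
    (h : ∀ x ∈ spectrum ℝ a, f x ≤ g x) : t (cfc f a) ≤ t (cfc g a) :=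
  ht.le_of_commute (cfc_predicate f a) (cfc_predicate g a) (cfc_commute_cfc f g a)
    (cfc_mono h hf.continuousOn hg.continuousOn)

theorem map_cfc_le_one {a : L} {f : ℝ → ℝ} (h : ∀ x, f x ≤ 1) : t (cfc f a) ≤ t 1 :=
  ht.le_of_commute (cfc_predicate f a) (.one L) (.one_right _) (cfc_le_one f a fun x _ => h x)

/-- By traciality `Z* Z` may be replaced by `Z Z*`, which commutes with `g` because `g Z = Z`; then
`g - Z Z* = g (1 - Z Z*) ≥ 0`. Only additivity on commuting elements is involved. -/
theorem star_mul_self_le {Z g : L} (hg : 0 ≤ g) (hgZ : g * Z = Z) (hZ : ‖Z‖ ≤ 1) :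
    t (star Z * Z) ≤ t g := by
  have hgsa : IsSelfAdjoint g := .of_nonneg hg
  have h1 : Z * star Z ≤ 1 := by
    rw [← CStarAlgebra.norm_le_one_iff_of_nonneg _ (mul_star_self_nonneg Z),
      CStarRing.norm_self_mul_star]
    exact mul_le_one₀ hZ (norm_nonneg _) hZ
  have h2 : star Z * g = star Z := by
    have := congrArg star hgZ
    rwa [star_mul, hgsa.star_eq] at this
  have h3 : Commute g (Z * star Z) := by
    rw [Commute, SemiconjBy, ← mul_assoc, hgZ, mul_assoc, h2]
  have h4 : 0 ≤ g * (1 - Z * star Z) :=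
    Commute.mul_nonneg hg (sub_nonneg.2 h1) ((Commute.one_right g).sub_right h3)
  rw [mul_sub, mul_one, ← mul_assoc, hgZ, sub_nonneg] at h4
  rw [ht.tracial]
  exact ht.le_of_commute (.mul_star_self Z) hgsa h3.symm h4

/-- The layers of one element commute, so `t` adds over them. It therefore suffices to compare a
layer of `a` with a strictly lower layer of `b`: the shift costs at most `2 t(1)` in total, against
a factor `n` on `t a - t b`. -/
theorem le_of_layers {a b : L} (ha : IsSelfAdjoint a) (hb : IsSelfAdjoint b)
    (H : ∀ (f g : ℝ → ℝ) (u s : ℝ), Continuous f → Continuous g → (∀ x, 0 ≤ f x) →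
      (∀ x, f x ≤ 1) → (∀ x, 0 ≤ g x) → (∀ x, g x ≤ 1) → s < u → (∀ x ≤ u, f x = 0) →
      (∀ x, s ≤ x → g x = 1) → t (cfc f a) ≤ t (cfc g b)) : t a ≤ t b := by
  obtain ⟨M, hM⟩ := exists_nat_ge (max ‖a‖ ‖b‖)
  have hMa := (le_max_left _ _).trans hM
  have hMb := (le_max_right _ _).trans hM
  have key : ∀ n : ℕ, (n : ℝ) * (t a - t b) ≤ 2 * t 1 := by
    intro n
    rcases Nat.eq_zero_or_pos n with rfl | hn
    · simpa using ht.map_one_nonneg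
    have hn' : (0 : ℝ) < n := by exact_mod_cast hn
    have e : ∀ {c : L} (_ : IsSelfAdjoint c) (_ : ‖c‖ ≤ M),
        ∑ k ∈ Finset.range (n * (2 * M)), t (cfc (layer n M k) c) = n * (t c + M * t 1) := by
      intro c hc hcM
      rw [← ht.map_cfc_sum (fun k => layer n M k), sum_cfc_layer hc hcM, ht.smul, ht.map_add_algebraMap hc]
      exact hc.add (.algebraMap L (.all _))
    have h1 : ∀ K : ℕ, ∑ k ∈ Finset.range K, t (cfc (layer n M k) a)
        ≤ ∑ k ∈ Finset.range K, t (cfc (layer n M k) b) + 2 * t 1 := by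
      intro K
      have hpos : ∀ k : ℕ, ∀ c : L, 0 ≤ t (cfc (layer n M k) c) := fun k c =>
        ht.map_nonneg (cfc_nonneg fun x _ => layer_nonneg _ _ _ x)
      calc ∑ k ∈ Finset.range K, t (cfc (layer n M k) a)
          ≤ ∑ k ∈ Finset.range (K + 2), t (cfc (layer n M k) a) :=
            Finset.sum_le_sum_of_subset_of_nonneg (by simp) fun k _ _ => hpos k a
        _ = ∑ k ∈ Finset.range K, t (cfc (layer n M (k + 2 : ℕ)) a)
            + t (cfc (layer n M 1) a) + t (cfc (layer n M 0) a) := by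
            rw [Finset.sum_range_succ', Finset.sum_range_succ']
        -- The offset is two because a gap is required: layer `k + 2` vanishes below `(k+2)/n - M`,
        -- and layer `k` equals `1` from `(k+1)/n - M` on. An offset of one would give `s = u`.
        _ ≤ ∑ k ∈ Finset.range K, t (cfc (layer n M k) b) + t 1 + t 1 := by
            gcongr with k hk
            · refine H _ _ ((k + 2) / n - M) ((k + 1) / n - M) (continuous_layer _ _ _)
                (continuous_layer _ _ _) (layer_nonneg _ _ _) (layer_le_one _ _ _)
                (layer_nonneg _ _ _) (layer_le_one _ _ _) (by gcongr; norm_num)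
                (fun x hx => ?_) fun x hx => ?_
              · have : n * (x + M) ≤ k + 2 := by
                  rw [← le_div_iff₀' hn']; linarith
                simp only [layer]
                rw [max_eq_left]
                refine (min_le_right _ _).trans ?_
                push_cast; linarith
              · have : k + 1 ≤ n * (x + M) := by
                  rw [← div_le_iff₀' hn']; linarith
                simp only [layer]
                rw [min_eq_left (by linarith), max_eq_right zero_le_one]
            · exact ht.map_cfc_le_one (layer_le_one _ _ _)
            · exact ht.map_cfc_le_one (layer_le_one _ _ _)
        _ = _ := by ring
    have h2 := h1 (n * (2 * M))
    rw [e ha hMa, e hb hMb] at h2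
    nlinarith
  by_contra! hlt
  obtain ⟨n, hn⟩ := exists_nat_gt (2 * t 1 / (t a - t b))
  rw [div_lt_iff₀ (by linarith)] at hn
  linarith [key n]

/-- With `e² = f(a)` and `r² = (b - s)₊`, the support of `f` gives `(u - s) e² ≤ e (a - s) e ≤ e r²
e`. Hence `f(a) = Z* Z` with the range of `Z` inside that of `r`, on which `g(b)` acts as the
identity. -/
theorem mono {a b : L} (ha : IsSelfAdjoint a) (hb : IsSelfAdjoint b) (hab : a ≤ b) :
    t a ≤ t b := by
  refine ht.le_of_layers ha hb fun f g u s hf hg hf0 hf1 hg0 hg1 hsu hfu hgs => ?_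
  let e := cfc (fun x => √(f x)) a
  let r := cfc (fun x => √(max (x - s) 0)) b
  have he : IsSelfAdjoint e := cfc_predicate _ a
  have hr : IsSelfAdjoint r := cfc_predicate _ b
  have hee : e * e = cfc f a := by
    rw [← cfc_mul _ _ a (by fun_prop) (by fun_prop)]
    exact cfc_congr fun x _ => Real.mul_self_sqrt (hf0 x)
  have hrr : r * r = cfc (fun x => max (x - s) 0) b := by
    rw [← cfc_mul _ _ b (by fun_prop) (by fun_prop)]
    exact cfc_congr fun x _ => Real.mul_self_sqrt (le_max_right _ _)
  have h1 : a - algebraMap ℝ L s ≤ r * r := by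
    refine (sub_le_sub_right hab _).trans ?_
    rw [hrr]
    conv_lhs => rw [← cfc_id' ℝ b, ← cfc_const s b, ← cfc_sub _ _ b (by fun_prop) (by fun_prop)]
    exact cfc_mono (fun x _ => le_max_left _ _) (by fun_prop) (by fun_prop)
  have h2 : (u - s) • (e * e) ≤ star (r * e) * (r * e) := by
    have h3 := he.conjugate_le_conjugate h1
    rw [star_mul, he.star_eq, hr.star_eq, show e * r * (r * e) = e * (r * r) * e by noncomm_ring]
    refine le_trans ?_ h3
    have : e * (a - algebraMap ℝ L s) * e = cfc (fun x => (x - s) * f x) a := by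
      have hc : a - algebraMap ℝ L s = cfc (fun x => x - s) a := by
        rw [cfc_sub (fun x => x) (fun _ => s) a (by fun_prop) (by fun_prop), cfc_id' ℝ a,
          cfc_const s a]
      rw [hc, ← cfc_mul _ _ a (by fun_prop) (by fun_prop),
        ← cfc_mul _ _ a (by fun_prop) (by fun_prop)]
      refine cfc_congr fun x _ => ?_
      linear_combination (x - s) * Real.mul_self_sqrt (hf0 x)
    rw [this, hee, ← cfc_smul (u - s) f a (by fun_prop)]
    refine cfc_mono (fun x _ => ?_) (by fun_prop) (by fun_prop)
    rcases le_total x u with hx | hx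
    · simp [hfu x hx]
    · exact mul_le_mul_of_nonneg_right (by linarith) (hf0 x)
  obtain ⟨Z, hZ, hgZ⟩ := exists_star_mul_self_eq_of_le he (sub_pos.2 hsu) h2
  rw [← hee, ← hZ]
  refine ht.star_mul_self_le (cfc_nonneg fun x _ => hg0 x) (hgZ _ ?_) ?_
  · rw [← cfc_mul _ _ b (by fun_prop) (by fun_prop)]
    refine cfc_congr fun x _ => ?_
    rcases le_total s x with hx | hx
    · simp [hgs x hx]
    · simp [max_eq_right (sub_nonpos.2 hx)]
  · have h4 : ‖star Z * Z‖ ≤ 1 := by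
      rw [hZ, hee]
      exact norm_cfc_le zero_le_one fun x _ => by
        rw [Real.norm_of_nonneg (hf0 x)]; exact hf1 x
    rw [CStarRing.norm_star_mul_self] at h4
    nlinarith [norm_nonneg Z]

end Order

/-! ### Norm estimates and the seminorm of a quasitrace -/

theorem abs_sub_le {a b : L} (ha : IsSelfAdjoint a) (hb : IsSelfAdjoint b) :
    |t a - t b| ≤ ‖a - b‖ * t 1 := by
  let _ := CStarAlgebra.spectralOrder L
  have := CStarAlgebra.spectralOrderedRing L
  have key : ∀ {a b : L} (_ : IsSelfAdjoint a) (_ : IsSelfAdjoint b),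
      t a - t b ≤ ‖a - b‖ * t 1 := by
    intro a b ha hb
    have h1 : a ≤ b + algebraMap ℝ L ‖a - b‖ := by
      rw [← sub_le_iff_le_add']
      exact (ha.sub hb).le_algebraMap_norm_self
    have := ht.mono ha (hb.add (.algebraMap L (.all _))) h1
    rw [ht.map_add_algebraMap hb] at this
    linarith
  rw [abs_sub_le_iff]
  exact ⟨key ha hb, norm_sub_rev a b ▸ key hb ha⟩

theorem abs_le {a : L} (ha : IsSelfAdjoint a) : |t a| ≤ ‖a‖ * t 1 := by
  simpa [ht.map_zero] using ht.abs_sub_le ha (.zero L)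

theorem map_star_sub_mul_sub_algebraMap {a : L} (ha : IsSelfAdjoint a) (r : ℝ) :
    t (star (a - algebraMap ℝ L r) * (a - algebraMap ℝ L r))
      = t (a * a) - 2 * r * t a + r ^ 2 * t 1 := by
  have hr : IsSelfAdjoint (algebraMap ℝ L r) := .algebraMap L (.all r)
  have hra : a * algebraMap ℝ L r = r • a := by
    rw [Algebra.smul_def, Algebra.commutes]
  have e : star (a - algebraMap ℝ L r) * (a - algebraMap ℝ L r)
      = (a * a + (-(2 * r)) • a) + algebraMap ℝ L (r ^ 2) := by
    rw [(ha.sub hr).star_eq, sub_mul, mul_sub, mul_sub, hra, ← Algebra.smul_def,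
      ← map_mul, sq]
    module
  have haa : IsSelfAdjoint (a * a) := by
    simpa [ha.star_eq] using IsSelfAdjoint.star_mul_self a
  have hsa : IsSelfAdjoint ((-(2 * r)) • a) := (IsSelfAdjoint.all _).smul ha
  rw [e, ht.map_add_algebraMap (haa.add hsa), ht.add _ _ haa hsa, ht.smul _ _ ha]
  · ring
  · exact (((Commute.refl a).mul_left (Commute.refl a))).smul_right _

/-- Cauchy–Schwarz against `1`: everything takes place among polynomials in `a`, where `t` is
additive. The quadratic `r ↦ t ((a - r)²)` is nonnegative, and `r = t a / t 1` minimizes it. -/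
theorem sq_le {a : L} (ha : IsSelfAdjoint a) : t a ^ 2 ≤ t (a * a) * t 1 := by
  have h : ∀ r : ℝ, 0 ≤ t (a * a) - 2 * r * t a + r ^ 2 * t 1 := fun r => by
    rw [← ht.map_star_sub_mul_sub_algebraMap ha]
    exact ht.nonneg _
  rcases ht.map_one_nonneg.eq_or_lt with h1 | h1
  · have h2 := ht.abs_le ha
    rw [← h1, mul_zero, abs_nonpos_iff] at h2
    simp [h2, ← h1]
  · have h2 := h (t a / t 1)
    have : t (a * a) - 2 * (t a / t 1) * t a + (t a / t 1) ^ 2 * t 1 = t (a * a) - t a ^ 2 / t 1 := by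
      field_simp; ring
    rw [this, sub_nonneg, div_le_iff₀ h1] at h2
    exact h2

theorem map_star_mul_self_star (x : L) : t (star (star x) * star x) = t (star x * x) := by
  rw [star_star, ht.tracial]

theorem map_mul_le_left (x y : L) :
    t (star (x * y) * (x * y)) ≤ ‖x‖ ^ 2 * t (star y * y) := by
  let _ := CStarAlgebra.spectralOrder L
  have := CStarAlgebra.spectralOrderedRing L
  rw [← ht.smul _ _ (.star_mul_self y)]
  refine ht.mono (.star_mul_self _) ((IsSelfAdjoint.all _).smul (.star_mul_self y)) ?_
  have h1 := star_left_conjugate_le_conjugate (CStarAlgebra.star_mul_le_algebraMap_norm_sq (a := x)) y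
  rw [star_mul, show star y * star x * (x * y) = star y * (star x * x) * y by noncomm_ring]
  refine h1.trans (le_of_eq ?_)
  rw [← Algebra.commutes, mul_assoc, Algebra.smul_def]

theorem map_mul_le_right (x y : L) :
    t (star (x * y) * (x * y)) ≤ ‖y‖ ^ 2 * t (star x * x) := by
  have := ht.map_mul_le_left (star y) (star x)
  rwa [← star_mul, ht.map_star_mul_self_star, ht.map_star_mul_self_star, norm_star] at this

theorem map_star_mul_self_smul (r : ℝ) (x : L) :
    t (star (r • x) * (r • x)) = r ^ 2 * t (star x * x) := by
  rw [star_smul, star_trivial, smul_mul_smul_comm, ht.smul _ _ (.star_mul_self x), sq]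

theorem map_star_mul_self_le (x : L) : t (star x * x) ≤ ‖x‖ ^ 2 * t 1 := by
  simpa using ht.map_mul_le_left x 1

end IsRealQuasitrace

/-- The square `t (x* x)` of the seminorm attached to `t`. -/
def sqNorm {L : Type*} [CStarAlgebra L] (t : L → ℝ) (x : L) : ℝ := t (star x * x)

namespace IsRealQuasitrace

variable {L : Type*} [CStarAlgebra L] {t : L → ℝ} (ht : IsRealQuasitrace t)

include ht

theorem sqNorm_nonneg (x : L) : 0 ≤ sqNorm t x := ht.nonneg x

theorem sqNorm_zero : sqNorm t 0 = 0 := by simp [sqNorm, ht.map_zero]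

theorem sqNorm_star (x : L) : sqNorm t (star x) = sqNorm t x := by
  rw [sqNorm, star_star, ← ht.tracial]; rfl

theorem sqNorm_mul_le_left (x y : L) : sqNorm t (x * y) ≤ ‖x‖ ^ 2 * sqNorm t y :=
  ht.map_mul_le_left x y

theorem sqNorm_mul_le_right (x y : L) : sqNorm t (x * y) ≤ ‖y‖ ^ 2 * sqNorm t x :=
  ht.map_mul_le_right x y

theorem sqNorm_le (x : L) : sqNorm t x ≤ ‖x‖ ^ 2 * t 1 := ht.map_star_mul_self_le x

theorem sqNorm_smul (r : ℝ) (x : L) : sqNorm t (r • x) = r ^ 2 * sqNorm t x :=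
  ht.map_star_mul_self_smul r x

end IsRealQuasitrace

theorem sqNorm_sub_comm {L : Type*} [CStarAlgebra L] (t : L → ℝ) (x y : L) :
    sqNorm t (x - y) = sqNorm t (y - x) := by
  rw [sqNorm, sqNorm, ← neg_sub y x, star_neg, neg_mul_neg]

/-! ### Annihilators and spectral projections in a complete quotient -/

/-- `π : L → Q` is the quotient of `L` by the elements of zero `t`-seminorm, and the unit ball of
`L` is complete for this seminorm. -/
structure IsCompleteQuotient {L Q : Type*} [CStarAlgebra L] [CStarAlgebra Q] (t : L → ℝ)
    (π : L →⋆ₐ[ℂ] Q) : Prop where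
  quasitrace : IsRealQuasitrace t
  surjective : Function.Surjective π
  map_eq_zero_iff : ∀ x, π x = 0 ↔ sqNorm t x = 0
  exists_add_le : ∃ C : ℝ, ∀ x y, sqNorm t (x + y) ≤ C * (sqNorm t x + sqNorm t y)
  complete : ∀ x : ℕ → L, (∀ n, ‖x n‖ ≤ 1) →
    (∀ ε > 0, ∃ N, ∀ m ≥ N, ∀ n ≥ N, sqNorm t (x m - x n) < ε) →
    ∃ y, Filter.Tendsto (fun n => sqNorm t (x n - y)) Filter.atTop (𝓝 0)

/-- The functional induced by `t` on a quotient of `L`. -/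
def quotientTrace {L Q : Type*} [CStarAlgebra L] [CStarAlgebra Q] (t : L → ℝ)
    (π : L →⋆ₐ[ℂ] Q) (x : Q) : ℝ :=
  t ((1 / 2 : ℝ) • (Function.invFun π x + star (Function.invFun π x)))

namespace IsCompleteQuotient

variable {L Q : Type*} [CStarAlgebra L] [CStarAlgebra Q] {t : L → ℝ} {π : L →⋆ₐ[ℂ] Q}
  (h : IsCompleteQuotient t π)

include h

theorem exists_isSelfAdjoint {x : Q} (hx : IsSelfAdjoint x) :
    ∃ a : L, IsSelfAdjoint a ∧ π a = x := by
  obtain ⟨y, rfl⟩ := h.surjective x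
  refine ⟨(1 / 2 : ℝ) • (y + star y), ?_, ?_⟩
  · exact (IsSelfAdjoint.all _).smul (.add_star_self y)
  · have h1 : π ((1 / 2 : ℝ) • (y + star y)) = (1 / 2 : ℝ) • π (y + star y) :=
      map_real_smul π (map_continuous π) _ _
    rw [h1, map_add, map_star, hx.star_eq]
    module

omit h in
theorem map_cfc {a : L} (ha : IsSelfAdjoint a) {f : ℝ → ℝ} (hf : Continuous f) :
    π (cfc f a) = cfc f (π a) :=
  StarAlgHomClass.map_cfc π f a hf.continuousOn (map_continuous π) ha (ha.map π)

theorem exists_mem_Icc [PartialOrder L] [StarOrderedRing L] [PartialOrder Q] [StarOrderedRing Q]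
    {x : Q} (hx0 : 0 ≤ x) (hx1 : x ≤ 1) : ∃ a : L, 0 ≤ a ∧ a ≤ 1 ∧ π a = x := by
  have hx : IsSelfAdjoint x := .of_nonneg hx0
  obtain ⟨a, ha, rfl⟩ := h.exists_isSelfAdjoint hx
  let f : ℝ → ℝ := fun r => max 0 (min 1 r)
  have hf : Continuous f := by fun_prop
  refine ⟨cfc f a, cfc_nonneg fun r _ => le_max_left _ _,
    cfc_le_one f a fun r _ => max_le zero_le_one (min_le_left _ _), ?_⟩
  rw [map_cfc ha hf]
  conv_rhs => rw [← cfc_id' ℝ (π a)]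
  refine cfc_congr fun r hr => ?_
  have h0 := spectrum_nonneg_of_nonneg hx0 hr
  have h1 : r ≤ 1 := by
    rw [← cfc_id' ℝ (π a), cfc_le_one_iff (fun x => x) (π a)] at hx1
    exact hx1 r hr
  simp only [f]
  rw [min_eq_right h1, max_eq_right h0]

theorem map_eq_zero_of_isSelfAdjoint {a : L} (ha : IsSelfAdjoint a) (h0 : π a = 0) : t a = 0 := by
  have h1 := (h.map_eq_zero_iff a).1 h0
  have h2 := h.quasitrace.sq_le ha
  rw [sqNorm, ha.star_eq] at h1
  rw [h1, zero_mul] at h2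
  exact pow_eq_zero_iff two_ne_zero |>.1 (le_antisymm h2 (sq_nonneg _))

/-- The right annihilator of an element of `Q` is generated by a projection. -/
theorem exists_annihilator (x : Q) :
    ∃ p : Q, IsStarProjection p ∧ ∀ z, x * z = 0 ↔ p * z = z := by
  let _ := CStarAlgebra.spectralOrder L
  have := CStarAlgebra.spectralOrderedRing L
  have ht := h.quasitrace
  obtain ⟨C, hC⟩ := h.exists_add_le
  obtain ⟨w, rfl⟩ := h.surjective x
  set b := star w * w with hb
  have hbsa : IsSelfAdjoint b := .star_mul_self w
  have hspec : ∀ r ∈ spectrum ℝ b, 0 ≤ r := fun r hr =>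
    spectrum_nonneg_of_nonneg (star_mul_self_nonneg w) hr
  -- The elements `u_n = (1 + (n+1) b)⁻¹` decrease towards the projection onto the kernel of `b`,
  -- with `‖b u_n‖ ≤ 1/(n+1)`.
  let φ : ℕ → ℝ → ℝ := fun n r => (1 + ((n : ℝ) + 1) * |r|)⁻¹
  have hpos : ∀ (n : ℕ) (r : ℝ), 0 < 1 + ((n : ℝ) + 1) * |r| := fun n r => by positivity
  have hφ : ∀ n, Continuous (φ n) := fun n =>
    Continuous.inv₀ (by fun_prop) fun r => (hpos n r).ne'
  have hφ0 : ∀ n r, 0 ≤ φ n r := fun n r => inv_nonneg.2 (hpos n r).le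
  have hφ1 : ∀ n r, φ n r ≤ 1 := fun n r => by
    refine inv_le_one_of_one_le₀ ?_
    have : 0 ≤ ((n : ℝ) + 1) * |r| := by positivity
    linarith
  have hanti : ∀ {n m : ℕ}, n ≤ m → ∀ r, φ m r ≤ φ n r := fun {n m} hnm r => by
    refine inv_anti₀ (hpos n r) ?_
    gcongr
  let u : ℕ → L := fun n => cfc (φ n) b
  have husa : ∀ n, IsSelfAdjoint (u n) := fun n => cfc_predicate _ b
  -- A difference with values in `[0, 1]` dominates its square, so convergence of the monotone
  -- numbers `t (u_n)` makes `u_n` Cauchy for the seminorm.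
  have hdiff : ∀ {n m : ℕ}, n ≤ m → sqNorm t (u m - u n) ≤ t (u n) - t (u m) := by
    intro n m hnm
    rw [sqNorm, ((husa m).sub (husa n)).star_eq,
      ← ht.map_sub (husa n) (husa m) (cfc_commute_cfc _ _ b)]
    have hn := hφ n
    have hm := hφ m
    simp only [u]
    rw [← cfc_sub _ _ b (by fun_prop) (by fun_prop), ← cfc_sub _ _ b (by fun_prop) (by fun_prop),
      ← cfc_mul _ _ b (by fun_prop) (by fun_prop)]
    refine ht.map_cfc_mono (by fun_prop) (by fun_prop) fun r _ => ?_
    have h1 := hanti hnm r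
    have h2 := hφ0 m r
    have h3 := hφ1 n r
    nlinarith
  have htanti : Antitone fun n => t (u n) := fun n m hnm =>
    ht.map_cfc_mono (hφ m) (hφ n) fun r _ => hanti hnm r
  have hbdd : BddBelow (Set.range fun n => t (u n)) :=
    ⟨0, by rintro _ ⟨n, rfl⟩; exact ht.map_nonneg (cfc_nonneg fun r _ => hφ0 n r)⟩
  have hcau := (tendsto_atTop_ciInf htanti hbdd).cauchySeq
  obtain ⟨y, hy⟩ := h.complete u (fun n => norm_cfc_le zero_le_one fun r _ => by
      rw [Real.norm_of_nonneg (hφ0 n r)]; exact hφ1 n r) (by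
    intro ε hε
    obtain ⟨N, hN⟩ := Metric.cauchySeq_iff.1 hcau ε hε
    refine ⟨N, fun m hm n hn => ?_⟩
    rcases le_total n m with hnm | hnm
    · have := hN n hn m hm
      exact (hdiff hnm).trans_lt ((le_abs_self _).trans_lt this)
    · have := hN m hm n hn
      rw [sqNorm_sub_comm]
      exact (hdiff hnm).trans_lt ((le_abs_self _).trans_lt this))
  have hlim : ∀ v : L, (∃ K : ℝ, ∀ n, sqNorm t v ≤ K * (sqNorm t (u n - y) + 1 / ((n : ℝ) + 1) ^ 2)) →
      π v = 0 := by
    rintro v ⟨K, hK⟩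
    rw [h.map_eq_zero_iff]
    refine le_antisymm ?_ (ht.sqNorm_nonneg v)
    refine ge_of_tendsto' (x := Filter.atTop) (b := sqNorm t v) ?_ hK
    have := (hy.add ((tendsto_one_div_add_atTop_nhds_zero_nat (𝕜 := ℝ)).pow 2)).const_mul K
    simpa using this
  have hC0 : 0 ≤ |C| := abs_nonneg C
  have hCabs : ∀ x y, sqNorm t (x + y) ≤ |C| * (sqNorm t x + sqNorm t y) := fun x y =>
    (hC x y).trans (by
      have := ht.sqNorm_nonneg x
      have := ht.sqNorm_nonneg y
      gcongr
      exact le_abs_self C)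
  have hby : π (b * y) = 0 := by
    refine hlim _ ⟨|C| * (‖b‖ ^ 2 + t 1), fun n => ?_⟩
    have h1 : sqNorm t (b * (y - u n)) ≤ ‖b‖ ^ 2 * sqNorm t (u n - y) := by
      rw [sqNorm_sub_comm t (u n)]
      exact ht.sqNorm_mul_le_left _ _
    have h2 : sqNorm t (b * u n) ≤ (1 / ((n : ℝ) + 1) ^ 2) * t 1 := by
      refine (ht.sqNorm_le _).trans ?_
      have h3 : ‖b * u n‖ ≤ 1 / ((n : ℝ) + 1) := by
        have hn := hφ n
        have h4 : b * u n = cfc (fun r => φ n r * r) b := by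
          rw [← cfc_mul_self_eq hbsa hn]
          exact ((Commute.refl b).cfc_real _).eq.symm
        rw [h4]
        refine norm_cfc_le (by positivity) fun r hr => ?_
        have hr0 := hspec r hr
        have := hφ0 n r
        rw [Real.norm_of_nonneg (by positivity)]
        simp only [φ, abs_of_nonneg hr0]
        rw [inv_mul_eq_div, div_le_div_iff₀ (by positivity) (by positivity)]
        nlinarith
      have h5 := ht.map_one_nonneg
      have h6 : ‖b * u n‖ ^ 2 ≤ (1 / ((n : ℝ) + 1)) ^ 2 := by gcongr
      rw [one_div_pow] at h6
      gcongr
    have h3 := hCabs (b * (y - u n)) (b * u n)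
    rw [← mul_add, sub_add_cancel] at h3
    refine h3.trans ?_
    rw [mul_assoc |C|]
    have h4 := ht.sqNorm_nonneg (u n - y)
    have h5 := ht.map_one_nonneg
    have h6 : 0 ≤ 1 / ((n : ℝ) + 1) ^ 2 := by positivity
    refine mul_le_mul_of_nonneg_left ?_ hC0
    nlinarith [mul_nonneg h5 h4, mul_nonneg (sq_nonneg ‖b‖) h6]
  have hright : ∀ z : L, π (b * z) = 0 → π (y * z - z) = 0 := by
    intro z hz
    refine hlim _ ⟨|C| * ‖z‖ ^ 2, fun n => ?_⟩
    have h1 : sqNorm t (u n * z - z) = 0 := by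
      rw [← h.map_eq_zero_iff]
      -- Since `u_n - 1 = -(n+1) u_n b`, every `z` with `π (b z) = 0` is fixed by all `u_n` modulo
      -- the kernel, hence by their limit.
      let ψ : ℝ → ℝ := fun r => -(((n : ℝ) + 1) * φ n r)
      have hn := hφ n
      have hψ : Continuous ψ := by fun_prop
      have h2 : u n - 1 = cfc ψ b * b := by
        rw [cfc_mul_self_eq hbsa hψ, ← cfc_const_one ℝ b, ← cfc_sub _ _ b (by fun_prop) (by fun_prop)]
        refine cfc_congr fun r hr => ?_
        have hr0 := hspec r hr
        have h3 := (hpos n r).ne'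
        simp only [φ, ψ, abs_of_nonneg hr0] at h3 ⊢
        field_simp
        ring
      have h3 : u n * z - z = cfc ψ b * (b * z) := by
        rw [← mul_assoc, ← h2, sub_mul, one_mul]
      rw [h3, map_mul, hz, mul_zero]
    have h2 := hCabs ((y - u n) * z) (u n * z - z)
    rw [h1, add_zero, sub_mul, sub_add_sub_cancel, ← sub_mul] at h2
    refine h2.trans ?_
    have h3 := ht.sqNorm_mul_le_right (y - u n) z
    rw [sqNorm_sub_comm t y] at h3
    have h6 : 0 ≤ 1 / ((n : ℝ) + 1) ^ 2 := by positivity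
    rw [mul_assoc]
    gcongr
    refine h3.trans ?_
    gcongr
    linarith
  have hystar : π (star y - y) = 0 := by
    refine hlim _ ⟨|C| * 2, fun n => ?_⟩
    have h2 := hCabs (star (y - u n)) (u n - y)
    rw [ht.sqNorm_star, sqNorm_sub_comm t y, star_sub, (husa n).star_eq, sub_add_sub_cancel] at h2
    refine h2.trans ?_
    have h6 : 0 ≤ 1 / ((n : ℝ) + 1) ^ 2 := by positivity
    rw [mul_assoc]
    gcongr
    linarith
  rw [map_sub, sub_eq_zero] at hystar
  have hyy : π y * π y = π y := by
    have := hright y hby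
    rwa [map_sub, map_mul, sub_eq_zero] at this
  have hbx : ∀ z, π w * z = 0 ↔ π b * z = 0 := by
    intro z
    rw [hb, map_mul, map_star]
    refine ⟨fun hz => by rw [mul_assoc, hz, mul_zero], fun hz => ?_⟩
    rw [← CStarRing.star_mul_self_eq_zero_iff, star_mul, mul_assoc, ← mul_assoc _ (π w), hz, mul_zero]
  refine ⟨π y, ⟨hyy, by rw [IsSelfAdjoint, ← map_star, hystar]⟩, fun z => ?_⟩
  rw [hbx]
  constructor
  · obtain ⟨z, rfl⟩ := h.surjective z
    intro hz
    rw [← map_mul] at hz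
    have := hright z hz
    rwa [map_sub, map_mul, sub_eq_zero] at this
  · intro hz
    rw [← hz, ← mul_assoc, ← map_mul, hby, zero_mul]

-- As `y` commutes with `x`, left multiplication by `y` preserves the right annihilator of `x`. Thus
-- `p y p = y p`, and the adjoint of this identity gives `p y p = p y`.
omit [CStarAlgebra L] h in
theorem commute_annihilator {x p y : Q} (hp : IsStarProjection p)
    (hxp : ∀ z, x * z = 0 ↔ p * z = z) (hy : IsSelfAdjoint y) (hxy : Commute x y) :
    Commute p y := by
  have h1 : x * p = 0 := (hxp p).2 hp.isIdempotentElem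
  have h2 : p * (y * p) = y * p := by
    rw [← hxp, ← mul_assoc, hxy.eq, mul_assoc, h1, mul_zero]
  have h3 := congrArg star h2
  simp only [star_mul, hp.isSelfAdjoint.star_eq, hy.star_eq] at h3
  rw [Commute, SemiconjBy, ← h2, ← h3, mul_assoc]

/-- Spectral projections: `p` plays the role of the indicator function of `(s, ∞)` at `x`. -/
theorem exists_spectralProjection {x : Q} (hx : IsSelfAdjoint x) (s : ℝ) :
    ∃ p : Q, IsStarProjection p ∧ (∀ y, IsSelfAdjoint y → Commute x y → Commute p y) ∧
      (∀ f ψ : ℝ → ℝ, Continuous ψ → (∀ r, f r = ψ r * max (r - s) 0) →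
        cfc f x * p = cfc f x) ∧
      ∀ g : ℝ → ℝ, Continuous g → (∀ r, s ≤ r → g r = 1) → cfc g x * p = p := by
  -- The projection is `1 - e`, where `e` generates the right annihilator of `(x - s)₊`. The
  -- factorization assumed for `f` writes `f(x)` as a multiple of `(x - s)₊`, and `1 - g(x)` is
  -- annihilated by it.
  set k := cfc (fun r => max (r - s) 0) x with hk
  have hksa : IsSelfAdjoint k := cfc_predicate _ x
  obtain ⟨e, he, hke⟩ := h.exists_annihilator k
  have hke0 : k * e = 0 := (hke e).2 he.isIdempotentElem
  refine ⟨1 - e, he.one_sub, fun y hy hxy => ?_, fun f ψ hψ hf => ?_, fun g hg hgs => ?_⟩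
  · exact (Commute.one_left y).sub_left
      (commute_annihilator he hke hy (hxy.cfc_real _))
  · have : cfc f x = cfc ψ x * k := by
      rw [hk, ← cfc_mul _ _ x (by fun_prop) (by fun_prop)]
      exact cfc_congr fun r _ => hf r
    rw [this, mul_sub, mul_one, mul_assoc, hke0, mul_zero, sub_zero]
  · have h1 : k * (1 - cfc g x) = 0 := by
      rw [hk, ← cfc_const_one ℝ x, ← cfc_sub _ _ x (by fun_prop) (by fun_prop),
        ← cfc_mul _ _ x (by fun_prop) (by fun_prop), ← cfc_zero ℝ x]
      refine cfc_congr fun r _ => ?_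
      rcases le_total s r with hr | hr
      · simp [hgs r hr]
      · simp [max_eq_right (sub_nonpos.2 hr)]
    have h2 := congrArg star ((hke _).1 h1)
    have hgsa : IsSelfAdjoint (cfc g x) := cfc_predicate g x
    simp only [star_mul, star_sub, star_one, hgsa.star_eq, he.isSelfAdjoint.star_eq] at h2
    rw [sub_mul, one_mul, sub_eq_sub_iff_add_eq_add] at h2
    rw [mul_sub, mul_one, sub_eq_sub_iff_add_eq_add, add_comm, ← h2, add_comm]

end IsCompleteQuotient

/-! ### Descent of the quasitrace to the quotient -/

namespace IsCompleteQuotient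

variable {L Q : Type*} [CStarAlgebra L] [CStarAlgebra Q] {t : L → ℝ} {π : L →⋆ₐ[ℂ] Q}
  (h : IsCompleteQuotient t π)

include h

/-- Let `p` be the common image. The functions `f`, `g` fix `0` and `1`, so `f(a)` and `g(a)` still
lie over `p`, and `g f = f`. Then `c = f(a) b f(a)` lies over `p` and commutes with `g(a)`, so their
difference may be discarded. The chain is `t a ≤ t (g(a)) = t c ≤ t b`. -/
theorem le_of_map_eq_projection [PartialOrder L] [StarOrderedRing L] {a b : L} (ha0 : 0 ≤ a)
    (ha1 : a ≤ 1) (hb0 : 0 ≤ b) (hab : π a = π b) (hp : IsIdempotentElem (π a)) : t a ≤ t b := by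
  have ht := h.quasitrace
  have hasa : IsSelfAdjoint a := .of_nonneg ha0
  have hbsa : IsSelfAdjoint b := .of_nonneg hb0
  have hspec : ∀ r ∈ spectrum ℝ a, 0 ≤ r ∧ r ≤ 1 := fun r hr => by
    refine ⟨spectrum_nonneg_of_nonneg ha0 hr, ?_⟩
    rw [← cfc_id' ℝ a, cfc_le_one_iff (fun x => x) a] at ha1
    exact ha1 r hr
  have hpspec : ∀ r ∈ spectrum ℝ (π a), r = 0 ∨ r = 1 := fun r hr => by
    have := hp.spectrum_subset ℝ hr
    simpa using this
  let f : ℝ → ℝ := fun r => max (2 * r - 1) 0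
  let g : ℝ → ℝ := fun r => min (2 * r) 1
  have hf : Continuous f := by fun_prop
  have hg : Continuous g := by fun_prop
  have hfsa : IsSelfAdjoint (cfc f a) := cfc_predicate f a
  have hgsa : IsSelfAdjoint (cfc g a) := cfc_predicate g a
  have hπ : ∀ k : ℝ → ℝ, Continuous k → k 0 = 0 → k 1 = 1 → π (cfc k a) = π a := by
    intro k hk h0 h1
    rw [map_cfc hasa hk]
    conv_rhs => rw [← cfc_id' ℝ (π a) (hasa.map π)]
    refine cfc_congr fun r hr => ?_
    rcases hpspec r hr with rfl | rfl <;> simpa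
  have hπf : π (cfc f a) = π a := hπ f hf (by simp [f]) (by norm_num [f])
  have hπg : π (cfc g a) = π a := hπ g hg (by simp [g]) (by norm_num [g])
  set c := cfc f a * b * cfc f a with hc
  have hcsa : IsSelfAdjoint c := hbsa.conjugate_self hfsa
  have hgf : cfc g a * cfc f a = cfc f a := by
    rw [← cfc_mul _ _ a (by fun_prop) (by fun_prop)]
    refine cfc_congr fun r _ => ?_
    simp only [f, g]
    rcases le_total (2 * r) 1 with hr | hr
    · rw [max_eq_right (by linarith), mul_zero]
    · rw [min_eq_right hr, one_mul]
  have hgc : cfc g a * c = c := by rw [hc, ← mul_assoc, ← mul_assoc, hgf]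
  have hcg : c * cfc g a = c := by
    have := congrArg star hgc
    rwa [star_mul, hcsa.star_eq, hgsa.star_eq] at this
  have hcomm : Commute c (cfc g a - c) :=
    (show Commute c (cfc g a) by rw [Commute, SemiconjBy, hgc, hcg]).sub_right (Commute.refl c)
  have h1 : t (cfc g a) = t c := by
    have h2 : t (cfc g a - c) = 0 := by
      refine h.map_eq_zero_of_isSelfAdjoint (hgsa.sub hcsa) ?_
      rw [map_sub, hc, map_mul, map_mul, hπf, hπg, ← hab, hp.eq, hp.eq, sub_self]
    have h3 := ht.add c (cfc g a - c) hcsa (hgsa.sub hcsa) hcomm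
    rw [add_sub_cancel, h2, add_zero] at h3
    exact h3
  have h2 : t c ≤ t b := by
    set s := cfc Real.sqrt b with hs
    have hssa : IsSelfAdjoint s := cfc_predicate _ b
    have hss : s * s = b := by
      rw [hs, ← cfc_mul _ _ b (by fun_prop) (by fun_prop)]
      conv_rhs => rw [← cfc_id' ℝ b]
      exact cfc_congr fun r hr => Real.mul_self_sqrt (spectrum_nonneg_of_nonneg hb0 hr)
    have e1 : c = star (s * cfc f a) * (s * cfc f a) := by
      rw [star_mul, hssa.star_eq, hfsa.star_eq, hc, ← hss]; noncomm_ring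
    have h3 := ht.map_mul_le_right s (cfc f a)
    rw [← e1, hssa.star_eq, hss] at h3
    refine h3.trans (mul_le_of_le_one_left (ht.map_nonneg hb0) (pow_le_one₀ (norm_nonneg _) ?_))
    refine norm_cfc_le zero_le_one fun r hr => ?_
    have := hspec r hr
    rw [Real.norm_of_nonneg (le_max_right _ _)]
    exact max_le (by linarith) zero_le_one
  have h3 : t a ≤ t (cfc g a) := by
    conv_lhs => rw [← cfc_id' ℝ a]
    refine ht.map_cfc_mono (by fun_prop) hg fun r hr => ?_
    have := hspec r hr
    exact le_min (by linarith) this.2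
  linarith

theorem eq_of_map_eq_projection [PartialOrder L] [StarOrderedRing L] {a b : L} (ha0 : 0 ≤ a)
    (ha1 : a ≤ 1) (hb0 : 0 ≤ b) (hb1 : b ≤ 1) (hab : π a = π b) (hp : IsIdempotentElem (π a)) :
    t a = t b :=
  le_antisymm (h.le_of_map_eq_projection ha0 ha1 hb0 hab hp)
    (h.le_of_map_eq_projection hb0 hb1 ha0 hab.symm (hab ▸ hp))

/-- Compare layers through a spectral projection `p` of the common image, lifted to `d`. Compressing
`d` by `g(b)` gives `w ≤ g(b)` over `p`; compressing `1 - d` by `1 - f(a)` gives `w' ≤ 1 - f(a)`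
over `1 - p`. The projection case yields `t w = t d` and `t w' = t 1 - t d`, whence `t (f(a)) ≤ t d
≤ t (g(b))`. -/
theorem le_of_map_eq {a b : L} (ha : IsSelfAdjoint a) (hb : IsSelfAdjoint b) (hab : π a = π b) :
    t a ≤ t b := by
  let _ := CStarAlgebra.spectralOrder L
  have := CStarAlgebra.spectralOrderedRing L
  let _ := CStarAlgebra.spectralOrder Q
  have := CStarAlgebra.spectralOrderedRing Q
  have ht := h.quasitrace
  refine ht.le_of_layers ha hb fun f g u s hf hg hf0 hf1 hg0 hg1 hsu hfu hgs => ?_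
  obtain ⟨p, hp, -, hpf, hpg⟩ := h.exists_spectralProjection (ha.map π) s
  have h1 : cfc f (π a) * p = cfc f (π a) := by
    refine hpf f (fun r => f r / max (r - s) (u - s)) (hf.div (by fun_prop) fun r => ?_) fun r => ?_
    · exact (lt_max_of_lt_right (by linarith)).ne'
    · rcases le_total r u with hr | hr
      · simp [hfu r hr]
      · rw [max_eq_left (by linarith), max_eq_left (by linarith), div_mul_cancel₀]
        linarith
  have h2 := hpg g hg hgs
  obtain ⟨d, hd0, hd1, hd⟩ := h.exists_mem_Icc hp.nonneg hp.le_one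
  have hgsa : IsSelfAdjoint (cfc g b) := cfc_predicate g b
  have hfsa : IsSelfAdjoint (1 - cfc f a) := (IsSelfAdjoint.one L).sub (cfc_predicate f a)
  have hfpsa : IsSelfAdjoint (cfc f (π a)) := cfc_predicate f _
  have hgpsa : IsSelfAdjoint (cfc g (π a)) := cfc_predicate g _
  have h1' : p * cfc f (π a) = cfc f (π a) := by
    have := congrArg star h1
    rwa [star_mul, hfpsa.star_eq, hp.isSelfAdjoint.star_eq] at this
  have h2' : p * cfc g (π a) = p := by
    have := congrArg star h2
    rwa [star_mul, hgpsa.star_eq, hp.isSelfAdjoint.star_eq] at this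
  have hsq : ∀ (k : ℝ → ℝ), Continuous k → (∀ x, 0 ≤ k x) → (∀ x, k x ≤ 1) → ∀ (c v : L),
      v ≤ 1 → cfc k c * v * cfc k c ≤ cfc k c := by
    intro k hk hk0 hk1 c v hv
    have hksa : IsSelfAdjoint (cfc k c) := cfc_predicate k c
    have h3 := hksa.conjugate_le_conjugate hv
    refine h3.trans ?_
    rw [mul_one, ← cfc_mul _ _ c (by fun_prop) (by fun_prop)]
    exact cfc_mono (fun x _ => mul_le_of_le_one_left (hk0 x) (hk1 x)) (by fun_prop) (by fun_prop)
  have hone : (1 : L) - cfc f a = cfc (fun x => 1 - f x) a := by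
    rw [cfc_sub (fun _ => (1 : ℝ)) f a (by fun_prop) (by fun_prop), cfc_const_one ℝ a]
  have hdsa : IsSelfAdjoint d := .of_nonneg hd0
  set w := cfc g b * d * cfc g b with hw
  set w' := (1 - cfc f a) * (1 - d) * (1 - cfc f a) with hw'
  have hw0 : 0 ≤ w := hgsa.conjugate_nonneg hd0
  have hw'0 : 0 ≤ w' := hfsa.conjugate_nonneg (sub_nonneg.2 hd1)
  have hwg : w ≤ cfc g b := hsq g hg hg0 hg1 b d hd1
  have hw'f : w' ≤ 1 - cfc f a := by
    rw [hw', hone]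
    exact hsq (fun x => 1 - f x) (by fun_prop) (fun x => by linarith [hf1 x])
      (fun x => by linarith [hf0 x]) a (1 - d) (by simpa using hd0)
  have hπw : π w = p := by
    rw [hw, map_mul, map_mul, map_cfc hb hg, ← hab, hd, h2, h2']
  have hπw' : π w' = 1 - p := by
    rw [hw', map_mul, map_mul, map_sub, map_sub, map_one, map_cfc ha hf, hd]
    have : (1 - cfc f (π a)) * (1 - p) = 1 - p := by
      rw [sub_mul, one_mul, mul_sub, mul_one, h1, sub_self, sub_zero]
    rw [this, mul_sub, mul_one, sub_mul, one_mul, h1', sub_self, sub_zero]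
  have e1 : t w = t d :=
    h.eq_of_map_eq_projection hw0 (hwg.trans (cfc_le_one g b fun x _ => hg1 x)) hd0 hd1
      (hπw.trans hd.symm) (by rw [hπw]; exact hp.isIdempotentElem)
  have e2 : t w' = t (1 - d) :=
    h.eq_of_map_eq_projection hw'0 (hw'f.trans (by
        rw [sub_le_self_iff]; exact cfc_nonneg fun x _ => hf0 x))
      (sub_nonneg.2 hd1) (by simpa using hd0) (by rw [hπw', map_sub, map_one, hd])
      (by rw [hπw']; exact hp.one_sub.isIdempotentElem)
  have e3 : t (1 - d) = t 1 - t d := ht.map_sub (.one L) hdsa (.one_left d)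
  have e4 : t (1 - cfc f a) = t 1 - t (cfc f a) :=
    ht.map_sub (.one L) (cfc_predicate f a) (.one_left _)
  have i1 := ht.mono (.of_nonneg hw0) hgsa hwg
  have i2 := ht.mono (.of_nonneg hw'0) hfsa hw'f
  linarith

theorem eq_of_map_eq {a b : L} (ha : IsSelfAdjoint a) (hb : IsSelfAdjoint b) (hab : π a = π b) :
    t a = t b :=
  le_antisymm (h.le_of_map_eq ha hb hab) (h.le_of_map_eq hb ha hab.symm)

theorem quotientTrace_map {a : L} (ha : IsSelfAdjoint a) : quotientTrace t π (π a) = t a := by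
  set y := Function.invFun π (π a) with hy
  have h1 : π y = π a := Function.invFun_eq ⟨a, rfl⟩
  refine h.eq_of_map_eq ((IsSelfAdjoint.all _).smul (.add_star_self y)) ha ?_
  have h2 : π ((1 / 2 : ℝ) • (y + star y)) = (1 / 2 : ℝ) • π (y + star y) :=
    map_real_smul π (map_continuous π) _ _
  rw [h2, map_add, map_star, h1, ← map_star, ha.star_eq]
  module

theorem sqNorm_quotientTrace_map (a : L) :
    sqNorm (quotientTrace t π) (π a) = sqNorm t a := by
  rw [sqNorm, ← map_star, ← map_mul, h.quotientTrace_map (.star_mul_self a), sqNorm]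

theorem quotientTrace_one : quotientTrace t π 1 = t 1 := by
  rw [← map_one π, h.quotientTrace_map (.one L)]

theorem quotientTrace_smul (r : ℝ) {x : Q} (hx : IsSelfAdjoint x) :
    quotientTrace t π (r • x) = r * quotientTrace t π x := by
  obtain ⟨a, ha, rfl⟩ := h.exists_isSelfAdjoint hx
  have h1 : π (r • a) = r • π a := map_real_smul π (map_continuous π) _ _
  rw [← h1, h.quotientTrace_map ((IsSelfAdjoint.all _).smul ha), h.quotientTrace_map ha,
    h.quasitrace.smul _ _ ha]

theorem quotientTrace_add_algebraMap {x : Q} (hx : IsSelfAdjoint x) (r : ℝ) :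
    quotientTrace t π (x + algebraMap ℝ Q r) = quotientTrace t π x + r * t 1 := by
  obtain ⟨a, ha, rfl⟩ := h.exists_isSelfAdjoint hx
  have h1 : π (a + algebraMap ℝ L r) = π a + algebraMap ℝ Q r := by
    rw [map_add, Algebra.algebraMap_eq_smul_one, Algebra.algebraMap_eq_smul_one,
      map_real_smul π (map_continuous π), map_one]
  rw [← h1, h.quotientTrace_map (ha.add (.algebraMap L (.all r))), h.quotientTrace_map ha,
    h.quasitrace.map_add_algebraMap ha]

section Order

variable [PartialOrder Q] [StarOrderedRing Q]

theorem quotientTrace_mono {x y : Q} (hx : IsSelfAdjoint x) (hxy : x ≤ y) :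
    quotientTrace t π x ≤ quotientTrace t π y := by
  let _ := CStarAlgebra.spectralOrder L
  have := CStarAlgebra.spectralOrderedRing L
  obtain ⟨a, ha, rfl⟩ := h.exists_isSelfAdjoint hx
  obtain ⟨w, hw⟩ := CStarAlgebra.nonneg_iff_eq_star_mul_self.1 (sub_nonneg.2 hxy)
  obtain ⟨z, rfl⟩ := h.surjective w
  have h1 : y = π (a + star z * z) := by
    rw [map_add, map_mul, map_star, ← hw, add_sub_cancel]
  rw [h1, h.quotientTrace_map ha, h.quotientTrace_map (ha.add (.star_mul_self z))]
  exact h.quasitrace.mono ha (ha.add (.star_mul_self z))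
    (le_add_of_nonneg_right (star_mul_self_nonneg z))

/-- Orthogonal positive elements, unlike general commuting ones, do have commuting lifts: they are
the positive and negative parts of `x - y`, so both lift to functions of one lift of `x - y`. -/
theorem quotientTrace_add_of_mul_eq_zero {x y : Q} (hx : 0 ≤ x) (hy : 0 ≤ y) (hxy : x * y = 0) :
    quotientTrace t π (x + y) = quotientTrace t π x + quotientTrace t π y := by
  have hxsa : IsSelfAdjoint x := .of_nonneg hx
  have hysa : IsSelfAdjoint y := .of_nonneg hy
  obtain ⟨a, ha, hxa⟩ := h.exists_isSelfAdjoint (hxsa.sub hysa)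
  obtain ⟨h1, h2⟩ := CFC.posPart_negPart_unique (a := x - y) rfl hxy hx hy
  have e1 : π (cfc (fun r : ℝ => max r 0) a) = x := by
    rw [map_cfc ha (by fun_prop), hxa]
    refine Eq.trans ?_ h1
    rw [CFC.posPart_def, cfcₙ_eq_cfc]
    rfl
  have e2 : π (cfc (fun r : ℝ => max (-r) 0) a) = y := by
    rw [map_cfc ha (by fun_prop), hxa]
    refine Eq.trans ?_ h2
    rw [CFC.negPart_def, cfcₙ_eq_cfc]
    rfl
  rw [← e1, ← e2, ← map_add, h.quotientTrace_map (cfc_predicate _ a),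
    h.quotientTrace_map (cfc_predicate _ a), h.quotientTrace_map
      ((cfc_predicate _ a : IsSelfAdjoint _).add (cfc_predicate _ a)), h.quasitrace.map_cfc_add]

/-- After a shift making `x` positive, the corners of `p` and `1 - p` are orthogonal. Only the sum
`X p + r p` inside the first corner is unclear; completing it by `r (1 - p)` turns `r p` into a
scalar, which can be split off. -/
theorem quotientTrace_add_smul_projection {x p : Q} (hx : IsSelfAdjoint x) (hp : IsStarProjection p)
    (hxp : Commute x p) {r : ℝ} (hr : 0 ≤ r) :
    quotientTrace t π (x + r • p) = quotientTrace t π x + r * quotientTrace t π p := by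
  set T := quotientTrace t π with hT
  set X := x + algebraMap ℝ Q ‖x‖ with hX
  have hX0 : 0 ≤ X := by
    have := hx.neg_algebraMap_norm_le_self
    rw [neg_le_iff_add_nonneg] at this
    exact this
  have hXp : Commute X p := hxp.add_left (Algebra.commutes _ _)
  have hpp := hp.isIdempotentElem.eq
  have h1 : 0 ≤ X * p := Commute.mul_nonneg hX0 hp.nonneg hXp
  have h2 : 0 ≤ X * (1 - p) := Commute.mul_nonneg hX0 hp.one_sub.nonneg
    ((Commute.one_right X).sub_right hXp)
  have h3 : 0 ≤ r • p := smul_nonneg hr hp.nonneg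
  have h4 : 0 ≤ r • (1 - p) := smul_nonneg hr hp.one_sub.nonneg
  have z1 : p * (1 - p) = 0 := by rw [mul_sub, mul_one, hpp, sub_self]
  have z2 : p * (X * (1 - p)) = 0 := by rw [← mul_assoc, ← hXp.eq, mul_assoc, z1, mul_zero]
  have e1 : T (X * p + r • p + X * (1 - p)) = T (X * p + r • p) + T (X * (1 - p)) := by
    refine h.quotientTrace_add_of_mul_eq_zero (add_nonneg h1 h3) h2 ?_
    rw [add_mul, mul_assoc, z2, smul_mul_assoc, z2, mul_zero, smul_zero, add_zero]
  have e2 : T (X * p + r • p + r • (1 - p)) = T (X * p + r • p) + T (r • (1 - p)) := by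
    refine h.quotientTrace_add_of_mul_eq_zero (add_nonneg h1 h3) h4 ?_
    rw [add_mul, mul_smul_comm, mul_smul_comm, mul_assoc, z1, smul_mul_assoc, z1]
    simp
  have e3 : T (X * p + X * (1 - p)) = T (X * p) + T (X * (1 - p)) := by
    refine h.quotientTrace_add_of_mul_eq_zero h1 h2 ?_
    rw [mul_assoc, z2, mul_zero]
  have e4 : T (p + (1 - p)) = T p + T (1 - p) :=
    h.quotientTrace_add_of_mul_eq_zero hp.nonneg hp.one_sub.nonneg z1
  have e5 : T (r • (1 - p)) = r * T (1 - p) := h.quotientTrace_smul r hp.one_sub.isSelfAdjoint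
  have e6 : T (X * p + algebraMap ℝ Q r) = T (X * p) + r * t 1 :=
    h.quotientTrace_add_algebraMap (.of_nonneg h1) r
  have e7 : T X = T x + ‖x‖ * t 1 := h.quotientTrace_add_algebraMap hx _
  have e8 : T (x + r • p + algebraMap ℝ Q ‖x‖) = T (x + r • p) + ‖x‖ * t 1 :=
    h.quotientTrace_add_algebraMap (hx.add ((IsSelfAdjoint.all r).smul hp.isSelfAdjoint)) _
  have e9 : T 1 = t 1 := h.quotientTrace_one
  rw [add_sub_cancel, e9] at e4
  rw [← mul_add, add_sub_cancel, mul_one, e7] at e3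
  rw [add_assoc, ← smul_add, add_sub_cancel, ← Algebra.algebraMap_eq_smul_one, e6, e5] at e2
  rw [show X * p + r • p + X * (1 - p) = x + r • p + algebraMap ℝ Q ‖x‖ by
    rw [hX]; noncomm_ring, e8] at e1
  linear_combination e1 - e2 - e3 + r * e4

theorem quotientTrace_add_sum_projection {x : Q} (hx : IsSelfAdjoint x) {p : ℕ → Q}
    (hp : ∀ k, IsStarProjection (p k)) (hxp : ∀ k, Commute x (p k))
    (hpp : ∀ k l, Commute (p k) (p l)) (K : ℕ) :
    quotientTrace t π (x + ∑ k ∈ Finset.range K, p k)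
      = quotientTrace t π x + ∑ k ∈ Finset.range K, quotientTrace t π (p k) := by
  induction K with
  | zero => simp
  | succ K ih =>
    rw [Finset.sum_range_succ, Finset.sum_range_succ, ← add_assoc, ← add_assoc, ← ih]
    have := h.quotientTrace_add_smul_projection (x := x + ∑ k ∈ Finset.range K, p k)
      (hx.add (isSelfAdjoint_sum _ fun k _ => (hp k).isSelfAdjoint)) (hp K)
      ((hxp K).add_left (Commute.sum_left _ _ _ fun k _ => hpp k K)) zero_le_one
    rwa [one_smul, one_mul] at this

/-- The layer-cake sum of `y` is sandwiched by a sum of spectral projections. -/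
theorem exists_sum_projection {y : Q} (hy : IsSelfAdjoint y) {M : ℕ} (hM : ‖y‖ ≤ M) (n : ℕ) :
    ∃ p : ℕ → Q, (∀ k, IsStarProjection (p k)) ∧
      (∀ k z, IsSelfAdjoint z → Commute y z → Commute (p k) z) ∧
      (n : ℝ) • (y + algebraMap ℝ Q M) ≤ ∑ k ∈ Finset.range (n * (2 * M)), p k ∧
      ∑ k ∈ Finset.range (n * (2 * M)), p k ≤ (n : ℝ) • (y + algebraMap ℝ Q M) + 1 := by
  rcases Nat.eq_zero_or_pos n with rfl | hn
  · refine ⟨fun _ => 0, fun _ => .zero Q, fun _ z _ _ => .zero_left z, ?_, ?_⟩ <;> simp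
  have hn' : (0 : ℝ) < n := by exact_mod_cast hn
  choose p hp hpc hpf hpg using fun k : ℕ => h.exists_spectralProjection hy (k / n - M)
  rw [← sum_cfc_layer hy hM]
  have hlsa : ∀ k, IsSelfAdjoint (cfc (layer n M k) y) := fun k => cfc_predicate _ y
  have hl1 : ∀ k, cfc (layer n M k) y ≤ 1 := fun k => cfc_le_one _ y fun x _ => layer_le_one _ _ _ x
  have hl0 : ∀ k, 0 ≤ cfc (layer n M k) y := fun k => cfc_nonneg fun x _ => layer_nonneg _ _ _ x
  -- As `p k` is the indicator of `(k/n - M, ∞)`, layer `k` is supported under `p k` and equals `1`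
  -- on `p (k + 1)`. Summing `p (k + 1) ≤ layer k ≤ p k` leaves an error of one projection, whatever
  -- `n` is.
  have h1 : ∀ k, cfc (layer n M k) y ≤ p k := by
    intro k
    have e1 : cfc (layer n M k) y * p k = cfc (layer n M k) y := by
      refine hpf k _ (fun r => n / max 1 (n * (r + M) - k)) ?_ fun r => ?_
      · exact continuous_const.div (by fun_prop) fun r => (lt_max_of_lt_left one_pos).ne'
      · have e2 : r - (k / n - M) = (n * (r + M) - k) / n := by field_simp; ring
        rw [e2, layer]
        set v := (n : ℝ) * (r + M) - k
        rcases le_total v 0 with hv | hv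
        · rw [min_eq_right (by linarith), max_eq_left hv,
            max_eq_right (div_nonpos_of_nonpos_of_nonneg hv hn'.le), mul_zero]
        · rw [max_eq_left (div_nonneg hv hn'.le)]
          rcases le_total v 1 with hv1 | hv1
          · rw [min_eq_right hv1, max_eq_right hv, max_eq_left hv1]; field_simp
          · rw [min_eq_left hv1, max_eq_right hv1, max_eq_right zero_le_one]
            have : v ≠ 0 := by linarith
            field_simp
    have e2 : p k * cfc (layer n M k) y = cfc (layer n M k) y := by
      have := congrArg star e1
      rwa [star_mul, (hlsa k).star_eq, (hp k).isSelfAdjoint.star_eq] at this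
    have := (hp k).isSelfAdjoint.conjugate_le_conjugate (hl1 k)
    rwa [e2, e1, mul_one, (hp k).isIdempotentElem.eq] at this
  have h2 : ∀ k, p (k + 1) ≤ cfc (layer n M k) y := by
    intro k
    have e1 : cfc (layer n M k) y * p (k + 1) = p (k + 1) := by
      refine hpg (k + 1) _ (continuous_layer _ _ _) fun r hr => ?_
      rw [layer, min_eq_left, max_eq_right zero_le_one]
      push_cast at hr
      have : (k + 1 : ℝ) ≤ n * (r + M) := by
        rw [← div_le_iff₀' hn']; linarith
      linarith
    have e2 : p (k + 1) * cfc (layer n M k) y = p (k + 1) := by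
      have := congrArg star e1
      rwa [star_mul, (hlsa k).star_eq, (hp _).isSelfAdjoint.star_eq] at this
    have := (hp (k + 1)).one_sub.isSelfAdjoint.conjugate_nonneg (hl0 k)
    rwa [sub_mul, one_mul, e2, sub_mul, mul_sub, mul_sub, mul_one, mul_one, e1,
      (hp _).isIdempotentElem.eq, sub_self, sub_zero, sub_nonneg] at this
  refine ⟨p, hp, fun k z hz hyz => hpc k z hz hyz, Finset.sum_le_sum fun k _ => h1 k, ?_⟩
  calc ∑ k ∈ Finset.range (n * (2 * M)), p k
      ≤ ∑ k ∈ Finset.range (n * (2 * M) + 1), p k :=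
        Finset.sum_le_sum_of_subset_of_nonneg (by simp) fun k _ _ => (hp k).nonneg
    _ ≤ _ := by
        rw [Finset.sum_range_succ']
        exact add_le_add (Finset.sum_le_sum fun k _ => h2 k) (hp 0).le_one

end Order

/-- The shifted multiple `n (y + M)` is within `1` of a sum of projections that commute with `x` and
with each other, over which additivity is known. Monotonicity bounds the error by `t 1`, and
division by `n` removes it. -/
theorem quotientTrace_add {x y : Q} (hx : IsSelfAdjoint x) (hy : IsSelfAdjoint y)
    (hxy : Commute x y) :
    quotientTrace t π (x + y) = quotientTrace t π x + quotientTrace t π y := by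
  let _ := CStarAlgebra.spectralOrder Q
  have := CStarAlgebra.spectralOrderedRing Q
  obtain ⟨M, hM⟩ := exists_nat_ge ‖y‖
  set T := quotientTrace t π with hT
  have key : ∀ n : ℕ, n * |T (x + y) - T x - T y| ≤ t 1 := by
    intro n
    obtain ⟨p, hp, hpc, hle, hge⟩ := h.exists_sum_projection hy hM n
    set S := ∑ k ∈ Finset.range (n * (2 * M)), p k with hS
    set F := (n : ℝ) • (y + algebraMap ℝ Q M) with hF
    have hpp : ∀ k l, Commute (p k) (p l) := fun k l =>
      hpc k _ (hp l).isSelfAdjoint (hpc l y hy (.refl y)).symm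
    have hxp : ∀ k, Commute ((n : ℝ) • x) (p k) := fun k =>
      ((hpc k x hx hxy.symm).symm).smul_left _
    have hnx : IsSelfAdjoint ((n : ℝ) • x) := (IsSelfAdjoint.all _).smul hx
    have hyM : IsSelfAdjoint (y + algebraMap ℝ Q M) := hy.add (.algebraMap Q (.all _))
    have hFsa : IsSelfAdjoint F := (IsSelfAdjoint.all _).smul hyM
    have hSsa : IsSelfAdjoint S := isSelfAdjoint_sum _ fun k _ => (hp k).isSelfAdjoint
    have e1 : T ((n : ℝ) • x + S) = T ((n : ℝ) • x) + ∑ k ∈ Finset.range (n * (2 * M)), T (p k) :=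
      h.quotientTrace_add_sum_projection hnx hp hxp hpp _
    have e2 : T (0 + S) = T 0 + ∑ k ∈ Finset.range (n * (2 * M)), T (p k) :=
      h.quotientTrace_add_sum_projection (.zero Q) hp (fun k => .zero_left _) hpp _
    have e0 : T 0 = 0 := by simpa using h.quotientTrace_smul 0 (.zero Q)
    have e3 : T ((n : ℝ) • x) = n * T x := h.quotientTrace_smul _ hx
    have e4 : T F = n * (T y + M * t 1) := by
      rw [hF, hT, h.quotientTrace_smul _ hyM, h.quotientTrace_add_algebraMap hy]
    have e5 : T ((n : ℝ) • x + F) = n * (T (x + y) + M * t 1) := by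
      rw [hF, ← smul_add, ← add_assoc, hT,
        h.quotientTrace_smul _ ((hx.add hy).add (.algebraMap Q (.all _))),
        h.quotientTrace_add_algebraMap (hx.add hy)]
    have hone : ∀ z : Q, IsSelfAdjoint z → T (z + 1) = T z + t 1 := fun z hz => by
      have := h.quotientTrace_add_algebraMap hz 1
      rwa [map_one, one_mul] at this
    have i1 : T F ≤ T S := h.quotientTrace_mono hFsa hle
    have i2 : T S ≤ T (F + 1) := h.quotientTrace_mono hSsa hge
    have i3 : T ((n : ℝ) • x + F) ≤ T ((n : ℝ) • x + S) :=
      h.quotientTrace_mono (hnx.add hFsa) (by gcongr)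
    have i4 : T ((n : ℝ) • x + S) ≤ T ((n : ℝ) • x + F + 1) :=
      h.quotientTrace_mono (hnx.add hSsa) (by rw [add_assoc]; gcongr)
    rw [hone _ hFsa] at i2
    rw [hone _ (hnx.add hFsa)] at i4
    rw [zero_add, e0, zero_add] at e2
    rw [← abs_of_nonneg (Nat.cast_nonneg (α := ℝ) n), ← abs_mul, abs_le]
    constructor <;> nlinarith
  by_contra hne
  have hpos : 0 < |T (x + y) - T x - T y| := abs_pos.2 fun h0 => hne (by linarith)
  obtain ⟨n, hn⟩ := exists_nat_gt (t 1 / |T (x + y) - T x - T y|)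
  rw [div_lt_iff₀ hpos] at hn
  linarith [key n]

theorem isRealQuasitrace_quotientTrace : IsRealQuasitrace (quotientTrace t π) where
  tracial x := by
    obtain ⟨z, rfl⟩ := h.surjective x
    rw [← map_star, ← map_mul, ← map_mul, h.quotientTrace_map (.star_mul_self z),
      h.quotientTrace_map (.mul_star_self z), h.quasitrace.tracial]
  nonneg x := by
    obtain ⟨z, rfl⟩ := h.surjective x
    rw [← map_star, ← map_mul, h.quotientTrace_map (.star_mul_self z)]
    exact h.quasitrace.nonneg z
  add x y hx hy hxy := h.quotientTrace_add hx hy hxy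
  smul r x hx := h.quotientTrace_smul r hx

end IsCompleteQuotient

/-! ### The quotient is a finite `AW*`-algebra -/

namespace IsCompleteQuotient

variable {L Q : Type*} [CStarAlgebra L] [CStarAlgebra Q] {t : L → ℝ} {π : L →⋆ₐ[ℂ] Q}
  (h : IsCompleteQuotient t π)

include h

theorem sqNorm_eq_zero_iff (x : Q) : sqNorm (quotientTrace t π) x = 0 ↔ x = 0 := by
  obtain ⟨z, rfl⟩ := h.surjective x
  rw [h.sqNorm_quotientTrace_map, h.map_eq_zero_iff]

theorem exists_sqNorm_quotientTrace_add_le : ∃ C : ℝ, 0 ≤ C ∧ ∀ x y : Q,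
    sqNorm (quotientTrace t π) (x + y)
      ≤ C * (sqNorm (quotientTrace t π) x + sqNorm (quotientTrace t π) y) := by
  obtain ⟨C, hC⟩ := h.exists_add_le
  refine ⟨|C|, abs_nonneg C, fun x y => ?_⟩
  obtain ⟨x, rfl⟩ := h.surjective x
  obtain ⟨y, rfl⟩ := h.surjective y
  rw [← map_add, h.sqNorm_quotientTrace_map, h.sqNorm_quotientTrace_map,
    h.sqNorm_quotientTrace_map]
  have h1 := h.quasitrace.sqNorm_nonneg x
  have h2 := h.quasitrace.sqNorm_nonneg y
  exact (hC x y).trans (mul_le_mul_of_nonneg_right (le_abs_self C) (add_nonneg h1 h2))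

/-- The annihilator is that of `∑ s* s`: if the sum kills `z`, then the positive elements `(s z)* (s
z)` add up to zero. -/
theorem exists_finset_annihilator (F : Finset Q) :
    ∃ p : Q, IsStarProjection p ∧ ∀ z, (∀ s ∈ F, s * z = 0) ↔ p * z = z := by
  let _ := CStarAlgebra.spectralOrder Q
  have := CStarAlgebra.spectralOrderedRing Q
  obtain ⟨p, hp, hpz⟩ := h.exists_annihilator (∑ s ∈ F, star s * s)
  refine ⟨p, hp, fun z => ?_⟩
  rw [← hpz]
  constructor
  · intro hz
    rw [Finset.sum_mul]
    exact Finset.sum_eq_zero fun s hs => by rw [mul_assoc, hz s hs, mul_zero]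
  · intro hz
    have h1 : ∑ s ∈ F, star (s * z) * (s * z) = 0 := by
      have h2 : star z * ((∑ s ∈ F, star s * s) * z) = 0 := by rw [hz, mul_zero]
      rw [Finset.sum_mul, Finset.mul_sum] at h2
      rw [← h2]
      exact Finset.sum_congr rfl fun s _ => by rw [star_mul]; noncomm_ring
    rw [Finset.sum_eq_zero_iff_of_nonneg fun s _ => star_mul_self_nonneg (s * z)] at h1
    exact fun s hs => (CStarRing.star_mul_self_eq_zero_iff _).1 (h1 s hs)

/-- The projections for finite subsets of `S` decrease as the subset grows, and `T` measures their
squared distances. An increasing sequence of finite subsets along which `T` approaches its infimum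
gives a Cauchy sequence, whose limit serves all of `S`. -/
theorem isAWStarAlgebra : IsAWStarAlgebra Q := by
  classical
  let _ := CStarAlgebra.spectralOrder L
  have := CStarAlgebra.spectralOrderedRing L
  let _ := CStarAlgebra.spectralOrder Q
  have := CStarAlgebra.spectralOrderedRing Q
  intro S
  have hT := h.isRealQuasitrace_quotientTrace
  set T := quotientTrace t π with hTdef
  obtain ⟨C, hC0, hC⟩ := h.exists_sqNorm_quotientTrace_add_le
  choose e he hez using h.exists_finset_annihilator
  have hanti : ∀ {F G : Finset Q}, F ⊆ G →
      sqNorm T (e F - e G) = T (e F) - T (e G) := by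
    intro F G hFG
    have h1 : e F * e G = e G :=
      (hez F _).1 fun s hs => (hez G _).2 (he G).isIdempotentElem s (hFG hs)
    have h2 : e G * e F = e G := by
      have := congrArg star h1
      rwa [star_mul, (he F).isSelfAdjoint.star_eq, (he G).isSelfAdjoint.star_eq] at this
    rw [sqNorm, ((he F).isSelfAdjoint.sub (he G).isSelfAdjoint).star_eq, sub_mul, mul_sub, mul_sub,
      h1, h2, (he F).isIdempotentElem.eq, (he G).isIdempotentElem.eq, sub_self, sub_zero]
    exact hT.map_sub (he F).isSelfAdjoint (he G).isSelfAdjoint (by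
      rw [Commute, SemiconjBy, h1, h2])
  have hmono : ∀ {F G : Finset Q}, F ⊆ G → T (e G) ≤ T (e F) := fun {F G} hFG => by
    have := hT.sqNorm_nonneg (e F - e G)
    rw [hanti hFG] at this
    linarith
  let V : Set ℝ := {r | ∃ F : Finset Q, (F : Set Q) ⊆ S ∧ T (e F) = r}
  have hVne : V.Nonempty := ⟨_, ∅, by simp, rfl⟩
  have hVbdd : BddBelow V := ⟨0, by
    rintro _ ⟨F, -, rfl⟩
    exact hT.map_nonneg (he F).nonneg⟩
  set m := sInf V with hm
  have hchoose : ∀ n : ℕ, ∃ F : Finset Q, (F : Set Q) ⊆ S ∧ T (e F) < m + 1 / ((n : ℝ) + 1) := by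
    intro n
    obtain ⟨_, ⟨F, hF, rfl⟩, hlt⟩ := exists_lt_of_csInf_lt hVne
      (show sInf V < m + 1 / ((n : ℝ) + 1) by
        have : 0 < 1 / ((n : ℝ) + 1) := by positivity
        linarith)
    exact ⟨F, hF, hlt⟩
  choose F hFS hFm using hchoose
  let G : ℕ → Finset Q := fun n => (Finset.range (n + 1)).biUnion F
  have hGmono : Monotone G := fun n k hnk =>
    Finset.biUnion_subset_biUnion_of_subset_left _ (by simpa using hnk)
  have hGS : ∀ n, (G n : Set Q) ⊆ S := by
    intro n x hx
    simp only [G, Finset.coe_biUnion, Set.mem_iUnion] at hx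
    obtain ⟨i, _, hi⟩ := hx
    exact hFS i hi
  have hGm : ∀ n, T (e (G n)) < m + 1 / ((n : ℝ) + 1) := fun n =>
    (hmono (Finset.subset_biUnion_of_mem F (by simp))).trans_lt (hFm n)
  have hle : ∀ E : Finset Q, (E : Set Q) ⊆ S → m ≤ T (e E) := fun E hE =>
    csInf_le hVbdd ⟨E, hE, rfl⟩
  choose d hd0 hd1 hd using fun n => h.exists_mem_Icc (he (G n)).nonneg (he (G n)).le_one
  have hdiff : ∀ N k l : ℕ, N ≤ k → k ≤ l →
      sqNorm T (e (G k) - e (G l)) < 1 / ((N : ℝ) + 1) := by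
    intro N k l hNk hkl
    rw [hanti (hGmono hkl)]
    have h1 := hGm N
    have h2 := hle _ (hGS l)
    have h3 := hmono (hGmono hNk)
    linarith
  obtain ⟨y, hy⟩ := h.complete d
    (fun n => (CStarAlgebra.norm_le_one_iff_of_nonneg _ (hd0 n)).2 (hd1 n)) (by
      intro ε hε
      obtain ⟨N, hN⟩ := exists_nat_one_div_lt hε
      refine ⟨N, fun k hk l hl => ?_⟩
      rw [← h.sqNorm_quotientTrace_map, map_sub, hd, hd]
      rcases le_total k l with hkl | hkl
      · exact (hdiff N k l hk hkl).trans hN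
      · rw [sqNorm_sub_comm]
        exact (hdiff N l k hl hkl).trans hN)
  set p := π y with hp
  have hy' : Filter.Tendsto (fun n => sqNorm T (e (G n) - p)) Filter.atTop (𝓝 0) := by
    refine hy.congr fun n => ?_
    rw [← h.sqNorm_quotientTrace_map, map_sub, hd]
  have hlim : ∀ v : Q, (∃ K : ℝ, ∀ n : ℕ,
      sqNorm T v ≤ K * (sqNorm T (e (G n) - p) + 1 / ((n : ℝ) + 1))) → v = 0 := by
    rintro v ⟨K, hK⟩
    rw [← h.sqNorm_eq_zero_iff]
    refine le_antisymm ?_ (hT.sqNorm_nonneg v)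
    refine ge_of_tendsto' (x := Filter.atTop) (b := sqNorm T v) ?_ hK
    have := (hy'.add (tendsto_one_div_add_atTop_nhds_zero_nat (𝕜 := ℝ))).const_mul K
    simpa using this
  have hSp : ∀ s ∈ S, s * p = 0 := by
    intro s hs
    refine hlim _ ⟨C * ‖s‖ ^ 2, fun n => ?_⟩
    -- `T (e (G n))` is within `1/(n+1)` of the infimum, so adjoining `s` moves the projection by no
    -- more than that, and `s` kills the new one.
    set E := insert s (G n) with hE
    have hES : (E : Set Q) ⊆ S := by
      rw [hE, Finset.coe_insert]
      exact Set.insert_subset hs (hGS n)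
    have h1 : s * e E = 0 := (hez E _).2 (he E).isIdempotentElem s (Finset.mem_insert_self _ _)
    have h2 : s * p = s * (p - e (G n)) + s * (e (G n) - e E) := by
      rw [mul_sub, mul_sub, h1]; abel
    have h3 : sqNorm T (e (G n) - e E) ≤ 1 / ((n : ℝ) + 1) := by
      rw [hanti (Finset.subset_insert s (G n))]
      have h1 := hGm n
      have h2 := hle _ hES
      linarith
    rw [h2]
    refine (hC _ _).trans ?_
    rw [mul_assoc C]
    refine mul_le_mul_of_nonneg_left ?_ hC0
    rw [mul_add, sqNorm_sub_comm T (e (G n)) p]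
    refine add_le_add (hT.sqNorm_mul_le_left _ _) ((hT.sqNorm_mul_le_left _ _).trans ?_)
    gcongr
  have hright : ∀ x, (∀ s ∈ S, s * x = 0) → p * x = x := by
    intro x hx
    rw [← sub_eq_zero]
    refine hlim _ ⟨‖x‖ ^ 2, fun n => ?_⟩
    have h1 : e (G n) * x = x := (hez _ x).1 fun s hs => hx s (hGS n hs)
    have h2 : p * x - x = (p - e (G n)) * x := by rw [sub_mul, h1]
    rw [h2]
    refine (hT.sqNorm_mul_le_right _ _).trans ?_
    rw [sqNorm_sub_comm T p]
    gcongr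
    have : 0 ≤ 1 / ((n : ℝ) + 1) := by positivity
    linarith
  have hpsa : star p - p = 0 := by
    refine hlim _ ⟨C * 2, fun n => ?_⟩
    have h2 := hC (star (p - e (G n))) (e (G n) - p)
    rw [hT.sqNorm_star, sqNorm_sub_comm T p, star_sub, (he _).isSelfAdjoint.star_eq,
      sub_add_sub_cancel] at h2
    refine h2.trans ?_
    have h6 : 0 ≤ 1 / ((n : ℝ) + 1) := by positivity
    rw [mul_assoc]
    refine mul_le_mul_of_nonneg_left ?_ hC0
    linarith
  refine ⟨p, ⟨hright p hSp, sub_eq_zero.1 hpsa⟩, fun x => ⟨hright x, fun hx s hs => ?_⟩⟩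
  rw [← hx, ← mul_assoc, hSp s hs, zero_mul]

/-- The trace of the projection `1 - v v*` is `T 1 - T (v* v) = 0`, and the induced seminorm
vanishes only at `0`. -/
theorem mul_star_self_eq_one {v : Q} (hv : star v * v = 1) : v * star v = 1 := by
  have hT := h.isRealQuasitrace_quotientTrace
  set q := 1 - v * star v with hq
  have hqsa : IsSelfAdjoint q := (IsSelfAdjoint.one Q).sub (.mul_star_self v)
  have hqq : q * q = q := by
    have : v * star v * (v * star v) = v * star v := by
      rw [mul_assoc, ← mul_assoc (star v), hv, one_mul]
    rw [hq, sub_mul, one_mul, mul_sub, mul_one, this, sub_self, sub_zero]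
  have h1 : sqNorm (quotientTrace t π) q = 0 := by
    rw [sqNorm, hqsa.star_eq, hqq, hq, hT.map_sub (.one Q) (.mul_star_self v) (.one_left _),
      ← hT.tracial, hv, sub_self]
  exact (sub_eq_zero.1 ((h.sqNorm_eq_zero_iff q).1 h1)).symm

end IsCompleteQuotient

/-! ### Two-by-two matrices and the quasi-triangle inequality -/

/-- The matrix over `A` with `x` in position `(i, j)` and zeros elsewhere. -/
def matrixUnit {A : Type*} [Zero A] (i j : Fin 2) (x : A) : CStarMatrix (Fin 2) (Fin 2) A :=
  CStarMatrix.ofMatrix (Matrix.single i j x)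

section MatrixUnit

variable {A : Type*} [CStarAlgebra A]

theorem matrixUnit_mul_same (i j k : Fin 2) (x y : A) :
    matrixUnit i j x * matrixUnit j k y = matrixUnit i k (x * y) :=
  Matrix.single_mul_single_same (i := i) (j := j) (k := k) (c := x) (d := y)

theorem matrixUnit_mul_of_ne (i k : Fin 2) {j l : Fin 2} (h : j ≠ l) (x y : A) :
    matrixUnit i j x * matrixUnit l k y = 0 :=
  Matrix.single_mul_single_of_ne (h := h) ..

theorem star_matrixUnit (i j : Fin 2) (x : A) :
    star (matrixUnit i j x) = matrixUnit j i (star x) :=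
  Matrix.conjTranspose_single i j x

theorem matrixUnit_add (i j : Fin 2) (x y : A) :
    matrixUnit i j (x + y) = matrixUnit i j x + matrixUnit i j y :=
  Matrix.single_add i j x y

theorem matrixUnit_zero (i j : Fin 2) : matrixUnit i j (0 : A) = 0 :=
  Matrix.single_zero i j

theorem isSelfAdjoint_matrixUnit (i : Fin 2) {x : A} (hx : IsSelfAdjoint x) :
    IsSelfAdjoint (matrixUnit i i x) := by
  rw [IsSelfAdjoint, star_matrixUnit, hx.star_eq]

theorem eq_sum_matrixUnit (X : CStarMatrix (Fin 2) (Fin 2) A) :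
    X = (matrixUnit 0 0 (X 0 0) + matrixUnit 1 0 (X 1 0))
      + (matrixUnit 0 1 (X 0 1) + matrixUnit 1 1 (X 1 1)) := by
  ext i j
  fin_cases i <;> fin_cases j <;>
    simp [matrixUnit, CStarMatrix.ofMatrix_apply, Matrix.single, Matrix.of_apply]

theorem matrixUnit_apply_eq_mul (X : CStarMatrix (Fin 2) (Fin 2) A) (i j : Fin 2) :
    matrixUnit i j (X i j) = matrixUnit i i 1 * X * matrixUnit j j 1 := by
  conv_rhs => rw [eq_sum_matrixUnit X]
  fin_cases i <;> fin_cases j <;>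
    simp [mul_add, add_mul, matrixUnit_mul_same, matrixUnit_mul_of_ne]

end MatrixUnit

section MatrixMap

variable {A B : Type*} [CStarAlgebra A] [CStarAlgebra B]

/-- The entrywise application of a `*`-homomorphism to `2 × 2` matrices. -/
def matrixMap (f : A →⋆ₐ[ℂ] B) :
    CStarMatrix (Fin 2) (Fin 2) A →⋆ₐ[ℂ] CStarMatrix (Fin 2) (Fin 2) B where
  toFun X := X.map f
  map_one' := by
    ext i j
    rw [CStarMatrix.map_apply, CStarMatrix.one_apply, CStarMatrix.one_apply]
    split_ifs <;> simp
  map_zero' := by ext i j; simp [CStarMatrix.map_apply]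
  map_add' X Y := by ext i j; simp [CStarMatrix.map_apply]
  map_mul' X Y := by ext i j; simp [CStarMatrix.map_apply, CStarMatrix.mul_apply]
  commutes' c := by
    ext i j
    rw [CStarMatrix.map_apply, CStarMatrix.algebraMap_apply, CStarMatrix.algebraMap_apply]
    split_ifs
    · exact AlgHomClass.commutes f c
    · exact map_zero f
  map_star' X := by ext i j; simp [CStarMatrix.map_apply, CStarMatrix.star_apply, map_star]

theorem matrixMap_apply (f : A →⋆ₐ[ℂ] B) (X : CStarMatrix (Fin 2) (Fin 2) A) (i j : Fin 2) :
    matrixMap f X i j = f (X i j) := rfl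

theorem matrixMap_matrixUnit (f : A →⋆ₐ[ℂ] B) (i j : Fin 2) (x : A) :
    matrixMap f (matrixUnit i j x) = matrixUnit i j (f x) := by
  ext k l
  simp only [matrixMap_apply, matrixUnit, CStarMatrix.ofMatrix_apply, Matrix.single, Matrix.of_apply]
  split_ifs <;> simp

end MatrixMap

/-- The hypothesis makes `x* x` and `y* y` commute, so the parallelogram bound `(x + y)* (x + y) ≤ 2
(x* x + y* y)` can be evaluated without a matrix extension. -/
theorem IsRealQuasitrace.sqNorm_add_le_of_mul_star_eq_zero {L : Type*} [CStarAlgebra L] {t : L → ℝ}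
    (ht : IsRealQuasitrace t) {x y : L} (h : x * star y = 0) :
    sqNorm t (x + y) ≤ 2 * (sqNorm t x + sqNorm t y) := by
  let _ := CStarAlgebra.spectralOrder L
  have := CStarAlgebra.spectralOrderedRing L
  have hc : Commute (star x * x) (star y * y) := by
    have h' : y * star x = 0 := by simpa using congrArg star h
    rw [Commute, SemiconjBy, mul_assoc, ← mul_assoc x, h, mul_assoc, ← mul_assoc y, h']
    simp
  have hx := IsSelfAdjoint.star_mul_self x
  have hy := IsSelfAdjoint.star_mul_self y
  rw [sqNorm, sqNorm, sqNorm, ← ht.add _ _ hx hy hc, ← ht.smul 2 _ (hx.add hy)]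
  refine ht.mono (.star_mul_self _) ((IsSelfAdjoint.all _).smul (hx.add hy)) ?_
  rw [← sub_nonneg]
  have e : (2 : ℝ) • (star x * x + star y * y) - star (x + y) * (x + y)
      = star (x - y) * (x - y) := by
    rw [star_add, star_sub, two_smul]; noncomm_ring
  rw [e]
  exact star_mul_self_nonneg _

theorem IsRealQuasitrace.sqNorm_add_le_of_star_mul_eq_zero {L : Type*} [CStarAlgebra L] {t : L → ℝ}
    (ht : IsRealQuasitrace t) {x y : L} (h : star x * y = 0) :
    sqNorm t (x + y) ≤ 2 * (sqNorm t x + sqNorm t y) := by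
  have := ht.sqNorm_add_le_of_mul_star_eq_zero (x := star x) (y := star y) (by rwa [star_star])
  rwa [← star_add, ht.sqNorm_star, ht.sqNorm_star, ht.sqNorm_star] at this

/-- `T` extends `t` to the `2 × 2` matrices. -/
structure IsMatrixExtension {A : Type*} [CStarAlgebra A] [PartialOrder A] [StarOrderedRing A]
    (t : A → ℝ) (T : CStarMatrix (Fin 2) (Fin 2) A → ℝ) : Prop where
  quasitrace : IsRealQuasitrace t
  quasitrace_matrix : IsRealQuasitrace T
  map_matrixUnit : ∀ x, IsSelfAdjoint x → T (matrixUnit 0 0 x) = t x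

namespace IsMatrixExtension

variable {A : Type*} [CStarAlgebra A] [PartialOrder A] [StarOrderedRing A]
    {t : A → ℝ} {T : CStarMatrix (Fin 2) (Fin 2) A → ℝ} (h : IsMatrixExtension t T)

include h

theorem map_matrixUnit_star_mul_self (i : Fin 2) (x : A) :
    T (matrixUnit i i (star x * x)) = t (star x * x) := by
  fin_cases i
  · exact h.map_matrixUnit _ (.star_mul_self x)
  · have h1 := h.quasitrace_matrix.tracial (matrixUnit 0 1 x)
    rw [star_matrixUnit, matrixUnit_mul_same, matrixUnit_mul_same,
      h.map_matrixUnit _ (.mul_star_self x), ← h.quasitrace.tracial] at h1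
    exact h1

theorem sqNorm_matrixUnit (i j : Fin 2) (x : A) : sqNorm T (matrixUnit i j x) = sqNorm t x := by
  rw [sqNorm, star_matrixUnit, matrixUnit_mul_same, h.map_matrixUnit_star_mul_self, sqNorm]

/-- For the column `X = (x, y)`, `X* X` is `x* x + y* y` in one corner, while `X X*` has the
off-diagonal entries `x y*` and `y x*`. The column `V = (r x, -r⁻¹ y)` has the opposite ones, so `X
X* ≤ X X* + V V*`, which is diagonal and is evaluated entry by entry. -/
theorem map_star_mul_self_add_le (x y : A) {r : ℝ} (hr : 0 < r) :
    t (star x * x + star y * y) ≤ (1 + r ^ 2) * sqNorm t x + (1 + (r⁻¹) ^ 2) * sqNorm t y := by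
  have hT := h.quasitrace_matrix
  set X := matrixUnit 0 0 x + matrixUnit 1 0 y with hX
  have e1 : star X * X = matrixUnit 0 0 (star x * x + star y * y) := by
    rw [hX, star_add, star_matrixUnit, star_matrixUnit, add_mul, mul_add, mul_add]
    simp [matrixUnit_mul_same, matrixUnit_mul_of_ne, matrixUnit_add]
  set V := matrixUnit 0 0 (r • x) + matrixUnit 1 0 (-(r⁻¹ • y)) with hV
  set D := matrixUnit 0 0 ((1 + r ^ 2) • (x * star x))
    + matrixUnit 1 1 ((1 + (r⁻¹) ^ 2) • (y * star y)) with hD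
  have e2 : X * star X + V * star V = D := by
    rw [hX, hV, star_add, star_add]
    simp only [star_matrixUnit, add_mul, mul_add, matrixUnit_mul_same, star_smul, star_neg,
      star_trivial, mul_neg, neg_mul, smul_mul_smul_comm, mul_inv_cancel₀ hr.ne',
      inv_mul_cancel₀ hr.ne', one_smul, neg_neg]
    ext i j
    fin_cases i <;> fin_cases j <;>
      simp [hD, matrixUnit, CStarMatrix.ofMatrix_apply, Matrix.single, Matrix.of_apply, sq, add_smul]
  have hxx : IsSelfAdjoint (x * star x) := .mul_star_self x
  have hyy : IsSelfAdjoint (y * star y) := .mul_star_self y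
  have hsx : IsSelfAdjoint ((1 + r ^ 2) • (x * star x)) := (IsSelfAdjoint.all _).smul hxx
  have hsy : IsSelfAdjoint ((1 + (r⁻¹) ^ 2) • (y * star y)) := (IsSelfAdjoint.all _).smul hyy
  have hDsa : IsSelfAdjoint D := (isSelfAdjoint_matrixUnit 0 hsx).add (isSelfAdjoint_matrixUnit 1 hsy)
  have e3 : T D = (1 + r ^ 2) * sqNorm t x + (1 + (r⁻¹) ^ 2) * sqNorm t y := by
    have hs : ∀ (i : Fin 2) (c : ℝ), 0 ≤ c → ∀ z : A,
        T (matrixUnit i i (c • (z * star z))) = c * sqNorm t z := by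
      intro i c hc z
      have : c • (z * star z) = star (√c • star z) * (√c • star z) := by
        rw [star_smul, star_star, star_trivial (√c), smul_mul_smul_comm, Real.mul_self_sqrt hc]
      rw [this, h.map_matrixUnit_star_mul_self, ← this, h.quasitrace.smul _ _ (.mul_star_self z),
        ← h.quasitrace.tracial, sqNorm]
    rw [hD, hT.add _ _ (isSelfAdjoint_matrixUnit 0 hsx) (isSelfAdjoint_matrixUnit 1 hsy),
      hs _ _ (by positivity), hs _ _ (by positivity)]
    rw [Commute, SemiconjBy, matrixUnit_mul_of_ne _ _ (by decide), matrixUnit_mul_of_ne _ _ (by decide)]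
  rw [← e3, ← h.map_matrixUnit _ ((IsSelfAdjoint.star_mul_self x).add (.star_mul_self y)), ← e1,
    hT.tracial]
  refine hT.mono (.mul_star_self X) hDsa ?_
  rw [← e2]
  exact le_add_of_nonneg_right (mul_star_self_nonneg V)

/-- The weighted parallelogram bound, with defect `|r x - r⁻¹ y|²`, costs one factor `1 + r²`, and
separating the two terms costs another. Optimizing over `r` would give the triangle inequality for
the cube root of `sqNorm`, the exponent in `d_τ`; below, `r = 1` or `r → 0` is what is needed. -/
theorem sqNorm_add_le (x y : A) {r : ℝ} (hr : 0 < r) :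
    sqNorm t (x + y) ≤ (1 + r ^ 2) ^ 2 * sqNorm t x + (1 + (r⁻¹) ^ 2) ^ 2 * sqNorm t y := by
  have ht := h.quasitrace
  set u := √(1 + r ^ 2) with hu
  set v := √(1 + (r⁻¹) ^ 2) with hv
  have hu2 : u * u = 1 + r ^ 2 := Real.mul_self_sqrt (by positivity)
  have hv2 : v * v = 1 + (r⁻¹) ^ 2 := Real.mul_self_sqrt (by positivity)
  have h1 := h.map_star_mul_self_add_le (u • x) (v • y) hr
  rw [ht.sqNorm_smul, ht.sqNorm_smul, sq u, sq v, hu2, hv2] at h1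
  refine le_trans (ht.mono (.star_mul_self _)
    ((IsSelfAdjoint.star_mul_self _).add (.star_mul_self _)) ?_) (h1.trans (le_of_eq (by ring)))
  rw [← sub_nonneg]
  have e : star (u • x) * (u • x) + star (v • y) * (v • y) - star (x + y) * (x + y)
      = star (r • x - r⁻¹ • y) * (r • x - r⁻¹ • y) := by
    simp only [star_add, star_sub, star_smul, star_trivial, add_mul, mul_add, sub_mul, mul_sub,
      smul_mul_smul_comm, hu2, hv2, mul_inv_cancel₀ hr.ne', inv_mul_cancel₀ hr.ne']
    module
  rw [e]
  exact star_mul_self_nonneg _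

theorem sqNorm_add_le_four (x y : A) : sqNorm t (x + y) ≤ 4 * (sqNorm t x + sqNorm t y) := by
  refine (h.sqNorm_add_le x y one_pos).trans (le_of_eq ?_)
  norm_num
  ring

theorem sqNorm_matrix_le (X : CStarMatrix (Fin 2) (Fin 2) A) :
    sqNorm T X ≤ 4 * ((sqNorm t (X 0 0) + sqNorm t (X 1 0))
      + (sqNorm t (X 0 1) + sqNorm t (X 1 1))) := by
  have hT := h.quasitrace_matrix
  have hcol : ∀ (j : Fin 2) (x y : A), sqNorm T (matrixUnit 0 j x + matrixUnit 1 j y)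
      ≤ 2 * (sqNorm t x + sqNorm t y) := by
    intro j x y
    have := hT.sqNorm_add_le_of_star_mul_eq_zero (x := matrixUnit 0 j x) (y := matrixUnit 1 j y)
      (by rw [star_matrixUnit, matrixUnit_mul_of_ne _ _ (by decide)])
    rwa [h.sqNorm_matrixUnit, h.sqNorm_matrixUnit] at this
  conv_lhs => rw [eq_sum_matrixUnit X]
  refine (hT.sqNorm_add_le_of_mul_star_eq_zero ?_).trans ?_
  · simp [star_matrixUnit, add_mul, mul_add, matrixUnit_mul_of_ne]
  · have h0 := hcol 0 (X 0 0) (X 1 0)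
    have h1 := hcol 1 (X 0 1) (X 1 1)
    linarith

theorem exists_sqNorm_entry_le : ∃ K : ℝ, 0 ≤ K ∧
    ∀ (X : CStarMatrix (Fin 2) (Fin 2) A) (i j : Fin 2), sqNorm t (X i j) ≤ K * sqNorm T X := by
  have hT := h.quasitrace_matrix
  set k : Fin 2 → ℝ := fun i => ‖(matrixUnit i i 1 : CStarMatrix (Fin 2) (Fin 2) A)‖ ^ 2 with hk
  have hk0 : ∀ i, 0 ≤ k i := fun i => by positivity
  refine ⟨∑ i, ∑ j, k j * k i, Finset.sum_nonneg fun i _ => Finset.sum_nonneg fun j _ =>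
    mul_nonneg (hk0 j) (hk0 i), fun X i j => ?_⟩
  have h0 := hT.sqNorm_nonneg X
  have h1 : sqNorm t (X i j) ≤ k j * k i * sqNorm T X := by
    rw [← h.sqNorm_matrixUnit i j, matrixUnit_apply_eq_mul, mul_assoc (k j)]
    refine (hT.sqNorm_mul_le_right _ _).trans ?_
    exact mul_le_mul_of_nonneg_left (hT.sqNorm_mul_le_left _ _) (hk0 j)
  refine h1.trans (mul_le_mul_of_nonneg_right ?_ h0)
  refine le_trans ?_ (Finset.single_le_sum (f := fun i => ∑ j, k j * k i)
    (fun i _ => Finset.sum_nonneg fun j _ => mul_nonneg (hk0 j) (hk0 i)) (Finset.mem_univ i))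
  exact Finset.single_le_sum (f := fun j => k j * k i)
    (fun j _ => mul_nonneg (hk0 j) (hk0 i)) (Finset.mem_univ j)

variable {B : Type*} [CStarAlgebra B] [PartialOrder B] [StarOrderedRing B] {π : A →⋆ₐ[ℂ] B}

/-- The matrix seminorm is equivalent to the sum of the seminorms of the entries, so kernel and
completeness can be checked entrywise. -/
theorem isCompleteQuotient (hπ : IsCompleteQuotient t π) : IsCompleteQuotient T (matrixMap π) where
  quasitrace := h.quasitrace_matrix
  surjective Y := by
    choose f hf using hπ.surjective
    exact ⟨Y.map f, by ext i j; rw [matrixMap_apply, CStarMatrix.map_apply, hf]⟩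
  map_eq_zero_iff X := by
    have e1 : matrixMap π X = 0 ↔ ∀ i j, π (X i j) = 0 :=
      ⟨fun hX i j => by rw [← matrixMap_apply, hX]; rfl, fun hX => by ext i j; exact hX i j⟩
    rw [e1]
    simp only [hπ.map_eq_zero_iff]
    constructor
    · intro hX
      have := h.sqNorm_matrix_le X
      simp only [hX] at this
      exact le_antisymm (this.trans (by norm_num)) (h.quasitrace_matrix.sqNorm_nonneg X)
    · intro hX i j
      obtain ⟨K, -, hK⟩ := h.exists_sqNorm_entry_le
      have := hK X i j
      rw [hX, mul_zero] at this
      exact le_antisymm this (h.quasitrace.sqNorm_nonneg _)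
  exists_add_le := by
    obtain ⟨K, -, hK⟩ := h.exists_sqNorm_entry_le
    refine ⟨64 * K, fun X Y => ?_⟩
    have h1 := h.sqNorm_matrix_le (X + Y)
    have h2 : ∀ i j, sqNorm t ((X + Y) i j) ≤ 4 * (K * sqNorm T X + K * sqNorm T Y) := by
      intro i j
      have := h.sqNorm_add_le_four (X i j) (Y i j)
      rw [CStarMatrix.add_apply]
      linarith [hK X i j, hK Y i j]
    linarith [h2 0 0, h2 1 0, h2 0 1, h2 1 1]
  complete X hX hcau := by
    obtain ⟨K, hK0, hK⟩ := h.exists_sqNorm_entry_le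
    have hlim : ∀ i j, ∃ y, Filter.Tendsto (fun n => sqNorm t (X n i j - y)) Filter.atTop (𝓝 0) := by
      intro i j
      refine hπ.complete (fun n => X n i j) (fun n => ?_) fun ε hε => ?_
      · exact CStarMatrix.norm_entry_le_norm.trans (hX n)
      · obtain ⟨N, hN⟩ := hcau (ε / (K + 1)) (by positivity)
        refine ⟨N, fun m hm n hn => ?_⟩
        have h1 := hN m hm n hn
        have h2 := hK (X m - X n) i j
        rw [CStarMatrix.sub_apply] at h2
        rw [lt_div_iff₀ (by positivity)] at h1
        have h3 := h.quasitrace_matrix.sqNorm_nonneg (X m - X n)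
        nlinarith
    choose Y hY using hlim
    refine ⟨CStarMatrix.ofMatrix (Matrix.of Y), ?_⟩
    refine squeeze_zero (fun n => h.quasitrace_matrix.sqNorm_nonneg _)
      (fun n => h.sqNorm_matrix_le _) ?_
    have := (((hY 0 0).add (hY 1 0)).add ((hY 0 1).add (hY 1 1))).const_mul 4
    simpa using this

theorem quotientTrace (hπ : IsCompleteQuotient t π) :
    IsMatrixExtension (quotientTrace t π) (quotientTrace T (matrixMap π)) where
  quasitrace := hπ.isRealQuasitrace_quotientTrace
  quasitrace_matrix := (h.isCompleteQuotient hπ).isRealQuasitrace_quotientTrace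
  map_matrixUnit x hx := by
    obtain ⟨a, ha, rfl⟩ := hπ.exists_isSelfAdjoint hx
    rw [← matrixMap_matrixUnit, (h.isCompleteQuotient hπ).quotientTrace_map
      (isSelfAdjoint_matrixUnit 0 ha), hπ.quotientTrace_map ha, h.map_matrixUnit a ha]

end IsMatrixExtension

/-! ### Passage between complex quasitraces and their real parts -/

/-- The complex-valued functional determined by the values of `t` on self-adjoint elements. -/
def complexify {L : Type*} [CStarAlgebra L] (t : L → ℝ) (x : L) : ℂ :=
  t (realPart x : L) + Complex.I * t (imaginaryPart x : L)

theorem complexify_of_isSelfAdjoint {L : Type*} [CStarAlgebra L] {t : L → ℝ} (h0 : t 0 = 0) {a : L}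
    (ha : IsSelfAdjoint a) : complexify t a = t a := by
  rw [complexify, ha.coe_realPart, ha.imaginaryPart]
  simp [h0]

section OneQuasitrace

variable {L : Type*} [CStarAlgebra L]

/-- The bicommutant of `{a, b}` is a closed abelian `*`-subalgebra containing both elements. -/
theorem IsOneQuasitrace.add_of_commute {τ : L → ℂ} (h : IsOneQuasitrace τ) {a b : L}
    (ha : IsSelfAdjoint a) (hb : IsSelfAdjoint b) (hab : Commute a b) : τ (a + b) = τ a + τ b := by
  let s : Set L := {a, b}
  have hs : ∀ x ∈ s, star x = x := by rintro x (rfl | rfl) <;> [exact ha.star_eq; exact hb.star_eq]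
  have hcomm : ∀ x ∈ s, ∀ y ∈ s, x * y = y * x := by
    rintro x (rfl | rfl) y (rfl | rfl)
    exacts [rfl, hab.eq, hab.eq.symm, rfl]
  let S := NonUnitalStarSubalgebra.centralizer ℂ s
  let S' := NonUnitalStarSubalgebra.centralizer ℂ (S : Set L)
  have hsS : s ⊆ S := fun x hx => (NonUnitalStarSubalgebra.mem_centralizer_iff ℂ).2 fun g hg =>
    ⟨hcomm g hg x hx, by rw [hs g hg]; exact hcomm g hg x hx⟩
  have hsS' : s ⊆ S' := fun x hx => (NonUnitalStarSubalgebra.mem_centralizer_iff ℂ).2 fun g hg =>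
    ⟨(((NonUnitalStarSubalgebra.mem_centralizer_iff ℂ).1 hg x hx).1).symm,
      (((NonUnitalStarSubalgebra.mem_centralizer_iff ℂ).1 (star_mem hg) x hx).1).symm⟩
  have hS'S : (S' : Set L) ⊆ S := NonUnitalStarSubalgebra.centralizer_le ℂ _ _ hsS
  refine h.add_of_abelian S' ?_ (fun x hx y hy => ?_) a (hsS' (by simp [s])) b (hsS' (by simp [s]))
  · rw [NonUnitalStarSubalgebra.coe_centralizer]
    exact Set.isClosed_centralizer _
  · exact ((NonUnitalStarSubalgebra.mem_centralizer_iff ℂ).1 hy x (hS'S hx)).1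

theorem IsOneQuasitrace.smul_of_isSelfAdjoint {τ : L → ℂ} (h : IsOneQuasitrace τ) {a : L}
    (ha : IsSelfAdjoint a) (c : ℂ) : τ (c • a) = c * τ a := by
  let s : Set L := {a}
  let S := NonUnitalStarSubalgebra.centralizer ℂ s
  let S' := NonUnitalStarSubalgebra.centralizer ℂ (S : Set L)
  have hsS : s ⊆ S := by
    intro x hx
    refine (NonUnitalStarSubalgebra.mem_centralizer_iff ℂ).2 fun g hg => ?_
    rw [Set.mem_singleton_iff.1 hx, Set.mem_singleton_iff.1 hg, ha.star_eq]
    exact ⟨rfl, rfl⟩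
  have hsS' : s ⊆ S' := fun x hx => (NonUnitalStarSubalgebra.mem_centralizer_iff ℂ).2 fun g hg =>
    ⟨(((NonUnitalStarSubalgebra.mem_centralizer_iff ℂ).1 hg x hx).1).symm,
      (((NonUnitalStarSubalgebra.mem_centralizer_iff ℂ).1 (star_mem hg) x hx).1).symm⟩
  have hS'S : (S' : Set L) ⊆ S := NonUnitalStarSubalgebra.centralizer_le ℂ _ _ hsS
  refine h.smul_of_abelian S' ?_ (fun x hx y hy => ?_) c a (hsS' (by simp [s]))
  · rw [NonUnitalStarSubalgebra.coe_centralizer]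
    exact Set.isClosed_centralizer _
  · exact ((NonUnitalStarSubalgebra.mem_centralizer_iff ℂ).1 hy x (hS'S hx)).1

theorem IsOneQuasitrace.isRealQuasitrace {τ : L → ℂ} (h : IsOneQuasitrace τ) :
    IsRealQuasitrace fun x => (τ x).re where
  tracial x := by rw [h.tracial]
  nonneg x := (h.nonneg x).1
  add a b ha hb hab := by rw [h.add_of_commute ha hb hab, Complex.add_re]
  smul r a ha := by
    rw [← Complex.coe_smul, h.smul_of_isSelfAdjoint ha, Complex.re_ofReal_mul]

/-- Positivity makes `τ` real on positive elements, and `a` is the difference of the commuting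
positive elements `a + ‖a‖` and `‖a‖`. -/
theorem IsOneQuasitrace.im_eq_zero {τ : L → ℂ} (h : IsOneQuasitrace τ) {a : L}
    (ha : IsSelfAdjoint a) : (τ a).im = 0 := by
  let _ := CStarAlgebra.spectralOrder L
  have := CStarAlgebra.spectralOrderedRing L
  have hpos : ∀ b : L, 0 ≤ b → (τ b).im = 0 := fun b hb => by
    obtain ⟨x, rfl⟩ := CStarAlgebra.nonneg_iff_eq_star_mul_self.1 hb
    exact (h.nonneg x).2
  have h1 : 0 ≤ a + algebraMap ℝ L ‖a‖ := by
    have := ha.neg_algebraMap_norm_le_self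
    rwa [neg_le_iff_add_nonneg] at this
  have h2 : (0 : L) ≤ algebraMap ℝ L ‖a‖ := algebraMap_nonneg L (norm_nonneg a)
  have h3 := h.add_of_commute ha (.of_nonneg h2) (Algebra.commutes _ _).symm
  have h4 := congrArg Complex.im h3
  rwa [Complex.add_im, hpos _ h1, hpos _ h2, add_zero, eq_comm] at h4

theorem IsOneQuasitrace.complexify_re {τ : L → ℂ} (h : IsOneQuasitrace τ) :
    complexify (fun x => (τ x).re) = τ := by
  funext x
  have hre : ∀ {a : L}, IsSelfAdjoint a → (((τ a).re : ℝ) : ℂ) = τ a := fun {a} ha =>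
    Complex.ext rfl (by simp [h.im_eq_zero ha])
  have h1 := h.add_I_smul (realPart x : L) (imaginaryPart x : L) (realPart x).2 (imaginaryPart x).2
  rw [realPart_add_I_smul_imaginaryPart] at h1
  rw [complexify, hre (realPart x).2, hre (imaginaryPart x).2, h1]

theorem IsRealQuasitrace.isOneQuasitrace {t : L → ℝ} (h : IsRealQuasitrace t) :
    IsOneQuasitrace (complexify t) where
  tracial x := by
    rw [complexify_of_isSelfAdjoint h.map_zero (.star_mul_self x),
      complexify_of_isSelfAdjoint h.map_zero (.mul_star_self x), h.tracial]
  nonneg x := by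
    rw [complexify_of_isSelfAdjoint h.map_zero (.star_mul_self x)]
    exact ⟨h.nonneg x, rfl⟩
  add_I_smul a b ha hb := by
    rw [complexify_of_isSelfAdjoint h.map_zero ha, complexify_of_isSelfAdjoint h.map_zero hb,
      complexify, map_add, map_add, realPart_I_smul, imaginaryPart_I_smul, ha.imaginaryPart,
      hb.imaginaryPart]
    simp [ha.coe_realPart, hb.coe_realPart]
  add_of_abelian B _ hcomm x hx y hy := by
    have hre : ∀ z ∈ B, (realPart z : L) ∈ B := fun z hz => by
      rw [realPart_apply_coe, ← Complex.coe_smul]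
      exact SMulMemClass.smul_mem _ (add_mem hz (star_mem hz))
    have him : ∀ z ∈ B, (imaginaryPart z : L) ∈ B := fun z hz => by
      rw [imaginaryPart_apply_coe, ← Complex.coe_smul]
      exact SMulMemClass.smul_mem _ (SMulMemClass.smul_mem _ (sub_mem hz (star_mem hz)))
    simp only [complexify, map_add, AddSubgroup.coe_add]
    rw [h.add _ _ (realPart x).2 (realPart y).2 (hcomm _ (hre x hx) _ (hre y hy)),
      h.add _ _ (imaginaryPart x).2 (imaginaryPart y).2 (hcomm _ (him x hx) _ (him y hy))]
    push_cast
    ring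
  smul_of_abelian B _ hcomm c x hx := by
    have hre : (realPart x : L) ∈ B := by
      rw [realPart_apply_coe, ← Complex.coe_smul]
      exact SMulMemClass.smul_mem _ (add_mem hx (star_mem hx))
    have him : (imaginaryPart x : L) ∈ B := by
      rw [imaginaryPart_apply_coe, ← Complex.coe_smul]
      exact SMulMemClass.smul_mem _ (SMulMemClass.smul_mem _ (sub_mem hx (star_mem hx)))
    have hc : Commute (realPart x : L) (imaginaryPart x : L) := hcomm _ hre _ him
    have hs : ∀ (r : ℝ) {a : L}, IsSelfAdjoint a → IsSelfAdjoint (r • a) := fun r {a} ha =>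
      (IsSelfAdjoint.all r).smul ha
    have hr := (realPart x).2
    have hi := (imaginaryPart x).2
    simp only [complexify, realPart_smul, imaginaryPart_smul, AddSubgroup.coe_add,
      AddSubgroup.coe_sub, selfAdjoint.val_smul]
    rw [h.map_sub (hs _ hr) (hs _ hi) ((hc.smul_left _).smul_right _),
      h.add _ _ (hs _ hi) (hs _ hr) ((hc.symm.smul_left _).smul_right _),
      h.smul _ _ hr, h.smul _ _ hr, h.smul _ _ hi, h.smul _ _ hi]
    apply Complex.ext <;> simp

end OneQuasitrace

theorem matrixUnit_smul {A : Type*} [CStarAlgebra A] (i j : Fin 2) (c : ℂ) (x : A) :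
    matrixUnit i j (c • x) = c • matrixUnit i j x :=
  (Matrix.smul_single c i j x).symm

theorem IsMatrixExtension.isQuasitrace {A : Type*} [CStarAlgebra A] [PartialOrder A]
    [StarOrderedRing A] {t : A → ℝ} {T : CStarMatrix (Fin 2) (Fin 2) A → ℝ}
    (h : IsMatrixExtension t T) : IsQuasitrace (complexify t) where
  toIsOneQuasitrace := h.quasitrace.isOneQuasitrace
  exists_matrix := by
    refine ⟨complexify T, h.quasitrace_matrix.isOneQuasitrace, fun x => ?_⟩
    change complexify t x = complexify T (matrixUnit 0 0 x)
    have h1 : (realPart (matrixUnit 0 0 x : CStarMatrix (Fin 2) (Fin 2) A) :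
        CStarMatrix (Fin 2) (Fin 2) A) = matrixUnit 0 0 (realPart x : A) := by
      rw [realPart_apply_coe, realPart_apply_coe, ← Complex.coe_smul, ← Complex.coe_smul,
        star_matrixUnit, ← matrixUnit_add, matrixUnit_smul]
    have h2 : (imaginaryPart (matrixUnit 0 0 x : CStarMatrix (Fin 2) (Fin 2) A) :
        CStarMatrix (Fin 2) (Fin 2) A) = matrixUnit 0 0 (imaginaryPart x : A) := by
      rw [imaginaryPart_apply_coe, imaginaryPart_apply_coe, ← Complex.coe_smul,
        ← Complex.coe_smul, star_matrixUnit, sub_eq_add_neg, sub_eq_add_neg, matrixUnit_smul,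
        matrixUnit_smul, matrixUnit_add, ← neg_one_smul ℂ (star x), matrixUnit_smul, neg_one_smul]
    rw [complexify, complexify, h1, h2, h.map_matrixUnit _ (realPart x).2,
      h.map_matrixUnit _ (imaginaryPart x).2]

theorem IsQuasitrace.exists_isMatrixExtension {A : Type*} [CStarAlgebra A] [PartialOrder A]
    [StarOrderedRing A] {τ : A → ℂ} (h : IsQuasitrace τ) :
    ∃ T : CStarMatrix (Fin 2) (Fin 2) A → ℝ, IsMatrixExtension (fun x => (τ x).re) T := by
  obtain ⟨τ₂, h2, heq⟩ := h.exists_matrix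
  exact ⟨fun X => (τ₂ X).re, h.isRealQuasitrace, h2.isRealQuasitrace,
    fun x _ => congrArg Complex.re (heq x).symm⟩

/-! ### Compression by central elements, extremality and the centre -/

section Compress

variable {L Q : Type*} [CStarAlgebra L] [CStarAlgebra Q] {t : Q → ℝ}

theorem IsRealQuasitrace.const_mul {t : L → ℝ} (ht : IsRealQuasitrace t) {r : ℝ} (hr : 0 ≤ r) :
    IsRealQuasitrace fun x => r * t x where
  tracial x := by rw [ht.tracial]
  nonneg x := mul_nonneg hr (ht.nonneg x)
  add a b ha hb hab := by rw [ht.add a b ha hb hab, mul_add]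
  smul s a ha := by rw [ht.smul s a ha]; ring

/-- Centrality of `c` gives `c φ(x* x) c = (φ(x) c)* (φ(x) c)` and `c φ(x x*) c = (φ(x) c) (φ(x)
c)*`, and keeps commuting elements commuting. -/
theorem IsRealQuasitrace.compress (ht : IsRealQuasitrace t) (φ : L →⋆ₐ[ℂ] Q) {c : Q}
    (hc : IsSelfAdjoint c) (hcc : ∀ y, Commute c y) :
    IsRealQuasitrace fun x => t (c * φ x * c) where
  tracial x := by
    have e1 : c * φ (star x * x) * c = star (φ x * c) * (φ x * c) := by
      rw [star_mul, hc.star_eq, map_mul, map_star]; noncomm_ring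
    have e2 : c * φ (x * star x) * c = (φ x * c) * star (φ x * c) := by
      rw [star_mul, hc.star_eq, map_mul, map_star, (hcc (φ x * star (φ x))).eq,
        mul_assoc (φ x * star (φ x)), mul_assoc (φ x), mul_assoc (φ x),
        ((hcc (star (φ x))).mul_left (hcc _)).eq.symm, mul_assoc c]
    rw [e1, e2, ht.tracial]
  nonneg x := by
    have e1 : c * φ (star x * x) * c = star (φ x * c) * (φ x * c) := by
      rw [star_mul, hc.star_eq, map_mul, map_star]; noncomm_ring
    rw [e1]
    exact ht.nonneg _
  add a b ha hb hab := by
    have h1 : Commute (φ a) (c * φ b * c) :=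
      ((hcc _).symm.mul_right (hab.map φ)).mul_right (hcc _).symm
    have h : Commute (c * φ a * c) (c * φ b * c) := ((hcc _).mul_left h1).mul_left (hcc _)
    rw [map_add, mul_add, add_mul]
    exact ht.add _ _ ((ha.map φ).conjugate_self hc) ((hb.map φ).conjugate_self hc) h
  smul r a ha := by
    have : φ (r • a) = r • φ a := map_real_smul φ (map_continuous φ) r a
    rw [this, mul_smul_comm, smul_mul_assoc]
    exact ht.smul r _ ((ha.map φ).conjugate_self hc)

theorem IsRealQuasitrace.sub_compress (ht : IsRealQuasitrace t) (φ : L →⋆ₐ[ℂ] Q) {c : Q}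
    (hc : IsSelfAdjoint c) (hcc : ∀ y, Commute c y) (hc1 : ‖c‖ ≤ 1) :
    IsRealQuasitrace fun x => t (φ x) - t (c * φ x * c) where
  tracial x := by
    rw [(ht.compress φ hc hcc).tracial, map_mul, map_mul, map_star, ht.tracial]
  nonneg x := by
    have e1 : c * φ (star x * x) * c = star (φ x * c) * (φ x * c) := by
      rw [star_mul, hc.star_eq, map_mul, map_star]; noncomm_ring
    rw [e1, sub_nonneg, map_mul, map_star]
    refine (ht.map_mul_le_right _ _).trans (mul_le_of_le_one_left (ht.nonneg _) ?_)
    exact pow_le_one₀ (norm_nonneg c) hc1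
  add a b ha hb hab := by
    rw [(ht.compress φ hc hcc).add a b ha hb hab, map_add,
      ht.add _ _ (ha.map φ) (hb.map φ) (hab.map φ)]
    ring
  smul r a ha := by
    have : φ (r • a) = r • φ a := map_real_smul φ (map_continuous φ) r a
    rw [(ht.compress φ hc hcc).smul r a ha, this, ht.smul _ _ (ha.map φ)]
    ring

end Compress

/-- The diagonal embedding of `A` into the `2 × 2` matrices over `A`. -/
def diagonalHom (A : Type*) [CStarAlgebra A] : A →⋆ₐ[ℂ] CStarMatrix (Fin 2) (Fin 2) A where
  toFun x := matrixUnit 0 0 x + matrixUnit 1 1 x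
  map_one' := by
    ext i j
    fin_cases i <;> fin_cases j <;>
      simp [matrixUnit, CStarMatrix.ofMatrix_apply, Matrix.single, Matrix.of_apply]
  map_zero' := by simp [matrixUnit_zero]
  map_add' x y := by rw [matrixUnit_add, matrixUnit_add]; abel
  map_mul' x y := by
    simp [add_mul, mul_add, matrixUnit_mul_same, matrixUnit_mul_of_ne]
  commutes' c := by
    ext i j
    fin_cases i <;> fin_cases j <;>
      simp [matrixUnit, CStarMatrix.ofMatrix_apply, Matrix.single, Matrix.of_apply,
        CStarMatrix.algebraMap_apply]
  map_star' x := by rw [star_add, star_matrixUnit, star_matrixUnit]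

theorem diagonalHom_apply {A : Type*} [CStarAlgebra A] (x : A) :
    diagonalHom A x = matrixUnit 0 0 x + matrixUnit 1 1 x := rfl

theorem diagonalHom_commute {A : Type*} [CStarAlgebra A] {c : A} (hc : ∀ y, Commute c y)
    (X : CStarMatrix (Fin 2) (Fin 2) A) : Commute (diagonalHom A c) X := by
  rw [eq_sum_matrixUnit X, Commute, SemiconjBy, diagonalHom_apply]
  simp [add_mul, mul_add, matrixUnit_mul_same, matrixUnit_mul_of_ne, (hc _).eq]

theorem diagonalHom_mul_matrixUnit_mul {A : Type*} [CStarAlgebra A] (c x : A) :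
    diagonalHom A c * matrixUnit 0 0 x * diagonalHom A c = matrixUnit 0 0 (c * x * c) := by
  simp [diagonalHom_apply, add_mul, mul_add, matrixUnit_mul_same, matrixUnit_mul_of_ne]

section Factor

variable {A B : Type*} [CStarAlgebra A] [CStarAlgebra B] [PartialOrder B] [StarOrderedRing B]
  {t : B → ℝ} {T : CStarMatrix (Fin 2) (Fin 2) B → ℝ}

/-- On the image of `φ` the hypothesis reads `sqNorm t (x c) = l * sqNorm t x`. Approximating `c` by
such `x` gives `t (c⁴) ≤ l · t (c²) = l²`, up to the constants of the quasi-triangle inequality. -/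
theorem sqNorm_mul_self_le_of_map_conj_eq (h : IsMatrixExtension t T)
    (φ : A →⋆ₐ[ℂ] B) {c : B} (hc : IsSelfAdjoint c) (hc1 : ‖c‖ ≤ 1)
    (hconj : ∀ a, IsSelfAdjoint a → t (c * φ a * c) = t (c * c) * t (φ a))
    {a : ℕ → A} (ha : Filter.Tendsto (fun n => sqNorm t (φ (a n) - c)) Filter.atTop (𝓝 0)) :
    sqNorm t (c * c) ≤ t (c * c) ^ 2 := by
  have ht := h.quasitrace
  set l := t (c * c) with hl
  have hl0 : 0 ≤ l := by
    have := ht.nonneg c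
    rwa [hc.star_eq] at this
  have hsq : sqNorm t c = l := by rw [sqNorm, hc.star_eq]
  have hmul : ∀ x, sqNorm t (φ x * c) = l * sqNorm t (φ x) := fun x => by
    have : star (φ x * c) * (φ x * c) = c * φ (star x * x) * c := by
      rw [star_mul, hc.star_eq, map_mul, map_star]; noncomm_ring
    rw [sqNorm, this, hconj _ (.star_mul_self x), sqNorm, map_mul, map_star]
  have hbound : ∀ r : ℝ, 0 < r → sqNorm t (c * c) ≤ ((1 + r ^ 2) ^ 2) ^ 2 * l ^ 2 := by
    intro r hr
    set p := (1 + r ^ 2) ^ 2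
    set q := (1 + (r⁻¹) ^ 2) ^ 2
    have hp : 0 ≤ p := by positivity
    have hq : 0 ≤ q := by positivity
    have hn : ∀ n, sqNorm t (c * c) ≤ p * (l * (p * l + q * sqNorm t (φ (a n) - c)))
        + q * sqNorm t (φ (a n) - c) := by
      intro n
      have h1 := h.sqNorm_add_le (φ (a n) * c) ((c - φ (a n)) * c) hr
      have h2 : φ (a n) * c + (c - φ (a n)) * c = c * c := by noncomm_ring
      rw [h2, hmul] at h1
      have h3 := h.sqNorm_add_le c (φ (a n) - c) hr
      rw [add_sub_cancel, hsq] at h3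
      have h4 := ht.sqNorm_mul_le_right (c - φ (a n)) c
      rw [sqNorm_sub_comm] at h4
      have h5 : sqNorm t ((c - φ (a n)) * c) ≤ sqNorm t (φ (a n) - c) :=
        h4.trans (mul_le_of_le_one_left (ht.sqNorm_nonneg _) (pow_le_one₀ (norm_nonneg c) hc1))
      calc sqNorm t (c * c) ≤ _ := h1
        _ ≤ _ := by gcongr
    -- The constant `q` blows up as `r → 0`, so `n → ∞` is taken first, at fixed `r`; the error
    -- terms carrying `q` then vanish and `p → 1` afterwards.
    have hlim := ((((ha.const_mul q).const_add (p * l)).const_mul l).const_mul p).add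
      (ha.const_mul q)
    have := ge_of_tendsto' hlim hn
    simp only [mul_zero, add_zero] at this
    linarith
  have hcont : Continuous fun r : ℝ => ((1 + r ^ 2) ^ 2) ^ 2 * l ^ 2 := by fun_prop
  have hlim := (hcont.tendsto 0).mono_left (nhdsWithin_le_nhds (s := Set.Ioi 0))
  have := ge_of_tendsto hlim (by filter_upwards [self_mem_nhdsWithin] with r hr using hbound r hr)
  simpa using this

variable [PartialOrder A] [StarOrderedRing A]

theorem IsMatrixExtension.compress (h : IsMatrixExtension t T) (φ : A →⋆ₐ[ℂ] B) {c : B}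
    (hc : IsSelfAdjoint c) (hcc : ∀ y, Commute c y) {r : ℝ} (hr : 0 ≤ r) :
    IsMatrixExtension (fun x => r * t (c * φ x * c))
      (fun X => r * T (diagonalHom B c * matrixMap φ X * diagonalHom B c)) where
  quasitrace := (h.quasitrace.compress φ hc hcc).const_mul hr
  quasitrace_matrix := (h.quasitrace_matrix.compress (matrixMap φ) (hc.map _)
    (diagonalHom_commute hcc)).const_mul hr
  map_matrixUnit x hx := by
    rw [matrixMap_matrixUnit, diagonalHom_mul_matrixUnit_mul,
      h.map_matrixUnit _ ((hx.map φ).conjugate_self hc)]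

theorem IsMatrixExtension.sub_compress (h : IsMatrixExtension t T) (φ : A →⋆ₐ[ℂ] B) {c : B}
    (hc : IsSelfAdjoint c) (hcc : ∀ y, Commute c y) (hc1 : ‖c‖ ≤ 1) {r : ℝ} (hr : 0 ≤ r) :
    IsMatrixExtension (fun x => r * (t (φ x) - t (c * φ x * c)))
      (fun X => r * (T (matrixMap φ X)
        - T (diagonalHom B c * matrixMap φ X * diagonalHom B c))) where
  quasitrace := (h.quasitrace.sub_compress φ hc hcc hc1).const_mul hr
  quasitrace_matrix := (h.quasitrace_matrix.sub_compress (matrixMap φ) (hc.map _)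
    (diagonalHom_commute hcc)
    ((NonUnitalStarAlgHom.norm_apply_le (diagonalHom B) c).trans hc1)).const_mul hr
  map_matrixUnit x hx := by
    rw [matrixMap_matrixUnit, diagonalHom_mul_matrixUnit_mul,
      h.map_matrixUnit _ ((hx.map φ).conjugate_self hc), h.map_matrixUnit _ (hx.map φ)]

/-- The compression of an extreme quasitrace by a central element is a multiple of it. -/
theorem map_conj_eq_of_mem_extremePoints (h : IsMatrixExtension t T) (ht1 : t 1 = 1)
    (φ : A →⋆ₐ[ℂ] B) {τ : A → ℂ} (hφ : ∀ a, IsSelfAdjoint a → t (φ a) = (τ a).re)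
    (hτ : τ ∈ Set.extremePoints ℝ (normalizedQuasitraces A))
    {c : B} (hc : IsSelfAdjoint c) (hcc : ∀ y, Commute c y) (hc1 : ‖c‖ ≤ 1 / 2)
    (hpos : 0 < t (c * c)) {a : A} (ha : IsSelfAdjoint a) :
    t (c * φ a * c) = t (c * c) * t (φ a) := by
  set l := t (c * c) with hl
  -- The bound `‖c‖ ≤ 1/2` gives `l ≤ 1/4`, so both weights `l` and `1 - l` are strictly positive,
  -- as an open segment requires.
  have hl1 : l < 1 := by
    have h1 := h.quasitrace.map_star_mul_self_le c
    rw [hc.star_eq, ht1, mul_one] at h1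
    nlinarith [norm_nonneg c]
  have h1 := h.compress φ hc hcc (inv_nonneg.2 hpos.le)
  have h2 := h.sub_compress φ hc hcc (by linarith) (inv_nonneg.2 (sub_nonneg.2 hl1.le))
  set t₁ : A → ℝ := fun x => l⁻¹ * t (c * φ x * c) with ht₁
  set t₂ : A → ℝ := fun x => (1 - l)⁻¹ * (t (φ x) - t (c * φ x * c)) with ht₂
  have hm1 : complexify t₁ ∈ normalizedQuasitraces A := by
    refine ⟨h1.isQuasitrace, ?_⟩
    rw [complexify_of_isSelfAdjoint h1.quasitrace.map_zero (.one A), ht₁]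
    simp [← hl, hpos.ne']
  have hm2 : complexify t₂ ∈ normalizedQuasitraces A := by
    refine ⟨h2.isQuasitrace, ?_⟩
    rw [complexify_of_isSelfAdjoint h2.quasitrace.map_zero (.one A), ht₂]
    have : (1 - l) ≠ 0 := (sub_pos.2 hl1).ne'
    simp only [map_one, mul_one, ht1, ← hl]
    rw [inv_mul_cancel₀ this, Complex.ofReal_one]
  have hconv : ∀ b, IsSelfAdjoint b → (τ b).re = l * t₁ b + (1 - l) * t₂ b := fun b hb => by
    have : (1 - l) ≠ 0 := (sub_pos.2 hl1).ne'
    simp only [ht₁, ht₂, ← hφ b hb]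
    field_simp
    ring
  have hseg : τ ∈ openSegment ℝ (complexify t₁) (complexify t₂) := by
    refine ⟨l, 1 - l, hpos, sub_pos.2 hl1, by ring, ?_⟩
    conv_rhs => rw [← hτ.1.1.toIsOneQuasitrace.complexify_re]
    funext x
    simp only [complexify, Pi.add_apply, Pi.smul_apply, Complex.real_smul,
      hconv _ (realPart x).2, hconv _ (imaginaryPart x).2]
    push_cast
    ring
  have heq := hτ.2 hm1 hm2 hseg
  have h3 := congrArg Complex.re (congrFun heq a)
  rw [complexify_of_isSelfAdjoint h1.quasitrace.map_zero ha, Complex.ofReal_re, ← hφ a ha] at h3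
  rw [← h3, ht₁]
  field_simp

variable (h : IsMatrixExtension t T) (ht1 : t 1 = 1) (hfaith : ∀ x, sqNorm t x = 0 → x = 0)
  (φ : A →⋆ₐ[ℂ] B) {τ : A → ℂ} (hφ : ∀ a, IsSelfAdjoint a → t (φ a) = (τ a).re)
  (hdense : ∀ b, ∃ a : ℕ → A,
    Filter.Tendsto (fun n => sqNorm t (φ (a n) - b)) Filter.atTop (𝓝 0))
  (hτ : τ ∈ Set.extremePoints ℝ (normalizedQuasitraces A))

include h ht1 hfaith φ hφ hdense hτ

/-- With `l = t (c²)`, expanding gives `t ((c² - l)²) = t (c⁴) - l²`, which is nonpositive;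
faithfulness of the seminorm forces `c² = l`. -/
theorem mul_self_eq_algebraMap_of_central {c : B} (hc : IsSelfAdjoint c) (hcc : ∀ y, Commute c y)
    (hc1 : ‖c‖ ≤ 1 / 2) : ∃ r : ℝ, c * c = algebraMap ℝ B r := by
  have hsq : t (c * c) = sqNorm t c := by rw [sqNorm, hc.star_eq]
  have h0 : 0 ≤ t (c * c) := hsq ▸ h.quasitrace.sqNorm_nonneg c
  rcases h0.eq_or_lt with h0 | h0
  · exact ⟨0, by rw [hfaith c (hsq ▸ h0.symm), mul_zero, map_zero]⟩
  obtain ⟨a, ha⟩ := hdense c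
  have hle := sqNorm_mul_self_le_of_map_conj_eq h φ hc (by linarith)
    (fun _ => map_conj_eq_of_mem_extremePoints h ht1 φ hφ hτ hc hcc hc1 h0) ha
  have hcsa : IsSelfAdjoint (c * c) := by
    simpa [hc.star_eq] using IsSelfAdjoint.star_mul_self c
  have hexp := h.quasitrace.map_star_sub_mul_sub_algebraMap hcsa (t (c * c))
  rw [sqNorm, hcsa.star_eq] at hle
  refine ⟨t (c * c), sub_eq_zero.1 (hfaith _ (le_antisymm ?_ (h.quasitrace.sqNorm_nonneg _)))⟩
  rw [sqNorm, hexp, ht1]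
  linarith

/-- Polarization: if the squares of `c` and `c + 1/4` are scalars, so is `c`. Scaling `c` to norm at
most `1/4` keeps `c + 1/4` within the norm bound `1/2`. -/
theorem eq_algebraMap_of_central_of_isSelfAdjoint {c : B} (hc : IsSelfAdjoint c)
    (hcc : ∀ y, Commute c y) : ∃ r : ℝ, c = algebraMap ℝ B r := by
  obtain ⟨s, hs, hsc⟩ : ∃ s : ℝ, 0 < s ∧ ‖s • c‖ ≤ 1 / 4 := by
    refine ⟨(4 * (‖c‖ + 1))⁻¹, by positivity, ?_⟩
    rw [norm_smul, Real.norm_of_nonneg (by positivity), inv_mul_le_iff₀ (by positivity)]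
    linarith
  have hsa : IsSelfAdjoint (s • c) := (IsSelfAdjoint.all s).smul hc
  have hcc' : ∀ y, Commute (s • c) y := fun y => (hcc y).smul_left s
  set q : B := algebraMap ℝ B (1 / 4) with hq
  have hqsa : IsSelfAdjoint q := .algebraMap B (.all _)
  have hqn : ‖q‖ ≤ 1 / 4 := by
    rw [hq, norm_algebraMap, Real.norm_of_nonneg (by norm_num)]
    refine mul_le_of_le_one_right (by norm_num) ?_
    rcases subsingleton_or_nontrivial B with _ | _
    · simp [Subsingleton.elim (1 : B) 0]
    · exact CStarRing.norm_one.le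
  obtain ⟨u, hu⟩ := mul_self_eq_algebraMap_of_central h ht1 hfaith φ hφ hdense hτ hsa hcc'
    (by linarith)
  obtain ⟨v, hv⟩ := mul_self_eq_algebraMap_of_central h ht1 hfaith φ hφ hdense hτ (hsa.add hqsa)
    (fun y => (hcc' y).add_left (Algebra.commutes _ _)) ((norm_add_le _ _).trans (by linarith))
  refine ⟨s⁻¹ * (2 * (v - u - 1 / 16)), ?_⟩
  have hqq : q * q = algebraMap ℝ B (1 / 16) := by rw [hq, ← map_mul]; norm_num
  have e : (s • c + q) * (s • c + q) = (s • c) * (s • c) + (1 / 2 : ℝ) • (s • c) + q * q := by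
    have h1 : q * (s • c) = (1 / 4 : ℝ) • (s • c) := by rw [hq, ← Algebra.smul_def]
    have h2 : (s • c) * q = (1 / 4 : ℝ) • (s • c) := by rw [(hcc' q).eq, h1]
    rw [add_mul, mul_add, mul_add, h1, h2]
    module
  rw [hv, hu, hqq] at e
  have e2 : s • c = algebraMap ℝ B (2 * (v - u - 1 / 16)) := by
    have : (1 / 2 : ℝ) • (s • c) = algebraMap ℝ B (v - u - 1 / 16) := by
      rw [map_sub, map_sub, e]; abel
    rw [map_mul, ← this, ← Algebra.smul_def, smul_smul]
    norm_num
  rw [map_mul, ← e2, ← Algebra.smul_def, inv_smul_smul₀ hs.ne']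

theorem eq_algebraMap_of_mem_center {z : B} (hz : z ∈ Subalgebra.center ℂ B) :
    ∃ c : ℂ, z = algebraMap ℂ B c := by
  rw [Subalgebra.mem_center_iff] at hz
  have hz1 : ∀ y, Commute z y := fun y => (hz y).symm
  have hz2 : ∀ y, Commute (star z) y := fun y => by
    simpa using (hz1 (star y)).star_star
  obtain ⟨r, hr⟩ := eq_algebraMap_of_central_of_isSelfAdjoint h ht1 hfaith φ hφ hdense hτ
    (realPart z).2 fun y => by
      rw [realPart_apply_coe]
      exact ((hz1 y).add_left (hz2 y)).smul_left _
  obtain ⟨s, hs⟩ := eq_algebraMap_of_central_of_isSelfAdjoint h ht1 hfaith φ hφ hdense hτ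
    (imaginaryPart z).2 fun y => by
      rw [imaginaryPart_apply_coe]
      exact (((hz1 y).sub_left (hz2 y)).smul_left _).smul_left _
  refine ⟨r + Complex.I * s, ?_⟩
  rw [← realPart_add_I_smul_imaginaryPart z, hr, hs, map_add, map_mul, ← Algebra.smul_def]
  rfl

end Factor

/-! ### The distance `d_τ` and null families -/

section QuasiDist

variable {A : Type*} [CStarAlgebra A] {τ : A → ℂ}

theorem quasiDist_eq (h : IsOneQuasitrace τ) (x y : A) :
    quasiDist τ x y = sqNorm (fun a => (τ a).re) (x - y) ^ (1 / 3 : ℝ) := by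
  rw [quasiDist, twoNorm, ← Real.rpow_mul (h.nonneg _).1, sqNorm]
  norm_num

theorem tendsto_quasiDist_iff (h : IsOneQuasitrace τ) {ι : Type*} {l : Filter ι} {x y : ι → A} :
    Filter.Tendsto (fun i => quasiDist τ (x i) (y i)) l (𝓝 0) ↔
      Filter.Tendsto (fun i => sqNorm (fun a => (τ a).re) (x i - y i)) l (𝓝 0) := by
  simp only [quasiDist_eq h]
  have h0 : ∀ i, 0 ≤ sqNorm (fun a => (τ a).re) (x i - y i) := fun i => (h.nonneg _).1
  constructor
  · intro hl
    have := hl.rpow_const (p := 3) (Or.inr (by norm_num))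
    rw [Real.zero_rpow (by norm_num)] at this
    refine this.congr fun i => ?_
    rw [← Real.rpow_mul (h0 i)]
    norm_num
  · intro hl
    have := hl.rpow_const (p := 1 / 3) (Or.inr (by norm_num))
    rwa [Real.zero_rpow (by norm_num)] at this

theorem tendsto_atTop_prod_iff_of_nonneg {f : ℕ × ℕ → ℝ} (hf : ∀ p, 0 ≤ f p) :
    Filter.Tendsto f Filter.atTop (𝓝 0) ↔
      ∀ ε : ℝ, 0 < ε → ∃ N : ℕ, ∀ m ≥ N, ∀ n ≥ N, f (m, n) < ε := by
  rw [Metric.tendsto_nhds]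
  refine forall₂_congr fun ε _ => ?_
  simp only [Real.dist_eq, sub_zero, abs_of_nonneg (hf _)]
  exact Filter.eventually_atTop_prod_self'

end QuasiDist

section NullFamilies

variable {A : Type*} [CStarAlgebra A] {t : A → ℝ} {ι : Type*} {l : Filter ι}

theorem IsRealQuasitrace.tendsto_sqNorm_mul_left (ht : IsRealQuasitrace t) {x y : ι → A} {C : ℝ}
    (hx : ∀ i, ‖x i‖ ≤ C) (hy : Filter.Tendsto (fun i => sqNorm t (y i)) l (𝓝 0)) :
    Filter.Tendsto (fun i => sqNorm t (x i * y i)) l (𝓝 0) := by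
  have h1 := hy.const_mul (C ^ 2)
  rw [mul_zero] at h1
  refine squeeze_zero (fun i => ht.sqNorm_nonneg _) (fun i => ?_) h1
  have := ht.sqNorm_nonneg (y i)
  refine (ht.sqNorm_mul_le_left (x i) (y i)).trans ?_
  gcongr
  exact hx i

theorem IsRealQuasitrace.tendsto_sqNorm_mul_right (ht : IsRealQuasitrace t) {x y : ι → A} {C : ℝ}
    (hx : Filter.Tendsto (fun i => sqNorm t (x i)) l (𝓝 0)) (hy : ∀ i, ‖y i‖ ≤ C) :
    Filter.Tendsto (fun i => sqNorm t (x i * y i)) l (𝓝 0) := by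
  have h1 := ht.tendsto_sqNorm_mul_left (x := fun i => star (y i)) (y := fun i => star (x i))
    (C := C) (fun i => (norm_star (y i)).trans_le (hy i)) (by simpa only [ht.sqNorm_star] using hx)
  simpa only [← star_mul, ht.sqNorm_star] using h1

variable [PartialOrder A] [StarOrderedRing A] {T : CStarMatrix (Fin 2) (Fin 2) A → ℝ}

theorem IsMatrixExtension.tendsto_sqNorm_add (h : IsMatrixExtension t T) {x y : ι → A}
    (hx : Filter.Tendsto (fun i => sqNorm t (x i)) l (𝓝 0))
    (hy : Filter.Tendsto (fun i => sqNorm t (y i)) l (𝓝 0)) :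
    Filter.Tendsto (fun i => sqNorm t (x i + y i)) l (𝓝 0) := by
  have h1 := (hx.add hy).const_mul 4
  rw [add_zero, mul_zero] at h1
  exact squeeze_zero (fun i => h.quasitrace.sqNorm_nonneg _)
    (fun i => h.sqNorm_add_le_four (x i) (y i)) h1

/-- The seminorm is dominated by the norm, so a uniform approximation changes `sqNorm` by a
controlled amount. The general index type covers both null sequences and, with pairs of indices and
differences of evaluations, Cauchy sequences. -/
theorem IsMatrixExtension.isClosed_setOf_tendsto_sqNorm (h : IsMatrixExtension t T) {D : Type*}
    [NormedAddCommGroup D] (f : ι → D →+ A) {C : ℝ} (hf : ∀ i x, ‖f i x‖ ≤ C * ‖x‖) :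
    IsClosed {x : D | Filter.Tendsto (fun i => sqNorm t (f i x)) l (𝓝 0)} := by
  have ht := h.quasitrace
  refine isClosed_of_closure_subset fun x hx => ?_
  rw [Set.mem_ofPred_eq, Metric.tendsto_nhds]
  intro ε hε
  have hcont : Filter.Tendsto (fun δ : ℝ => 4 * ((C * δ) ^ 2 * t 1)) (𝓝[>] 0) (𝓝 0) := by
    have : Continuous fun δ : ℝ => 4 * ((C * δ) ^ 2 * t 1) := by fun_prop
    simpa using (this.tendsto 0).mono_left (nhdsWithin_le_nhds (s := Set.Ioi 0))
  obtain ⟨δ, hδε, hδ⟩ := ((hcont.eventually_lt_const (half_pos hε)).and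
    self_mem_nhdsWithin).exists
  obtain ⟨y, hy, hxy⟩ := Metric.mem_closure_iff.1 hx δ hδ
  rw [dist_eq_norm] at hxy
  filter_upwards [(hy.const_mul 4).eventually_lt_const (show 4 * 0 < ε / 2 by linarith)] with i hi
  rw [Real.dist_eq, sub_zero, abs_of_nonneg (ht.sqNorm_nonneg _)]
  have h1 := h.sqNorm_add_le_four (f i (x - y)) (f i y)
  rw [← map_add, sub_add_cancel] at h1
  have h2 : sqNorm t (f i (x - y)) ≤ (C * δ) ^ 2 * t 1 := by
    refine (ht.sqNorm_le _).trans (mul_le_mul_of_nonneg_right ?_ ht.map_one_nonneg)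
    have hC : ‖f i (x - y)‖ ≤ C * ‖x - y‖ := hf i _
    rcases le_or_gt 0 C with h0 | h0
    · exact pow_le_pow_left₀ (norm_nonneg _) (hC.trans (by gcongr)) 2
    · have : ‖f i (x - y)‖ ≤ 0 := hC.trans (mul_nonpos_of_nonpos_of_nonneg h0.le (norm_nonneg _))
      rw [le_antisymm this (norm_nonneg _), zero_pow two_ne_zero]
      positivity
  linarith

end NullFamilies

/-! ### Limits of quasitraces along a free ultrafilter -/

section Ultralimit

variable {L D : Type*} [CStarAlgebra L] [CStarAlgebra D]

/-- By compactness of `[-C, C]` boundedness suffices for a limit along an ultrafilter. Continuity of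
the quasitrace for `d_τ` is therefore not needed to define a trace on Cauchy sequences. -/
theorem tendsto_limUnder_hyperfilter {f : ℕ → ℝ} {C : ℝ} (hf : ∀ n, |f n| ≤ C) :
    Filter.Tendsto f (Filter.hyperfilter ℕ) (𝓝 (Filter.limUnder (Filter.hyperfilter ℕ : Filter ℕ) f)) := by
  refine tendsto_nhds_limUnder ?_
  obtain ⟨x, -, hx⟩ := (isCompact_Icc (a := -C) (b := C)).ultrafilter_le_nhds
    ((Filter.hyperfilter ℕ).map f) (Filter.le_principal_iff.2
      (Filter.mem_map.2 (Filter.univ_mem' fun n => abs_le.1 (hf n))))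
  exact ⟨x, hx⟩

/-- The limit of `t` along a sequence of `*`-homomorphisms and a fixed free ultrafilter. -/
def ultraTrace (t : D → ℝ) (e : ℕ → L →⋆ₐ[ℂ] D) (x : L) : ℝ :=
  Filter.limUnder (Filter.hyperfilter ℕ : Filter ℕ) fun n => t (e n x)

variable {t : D → ℝ}

theorem IsRealQuasitrace.tendsto_ultraTrace (ht : IsRealQuasitrace t) (e : ℕ → L →⋆ₐ[ℂ] D)
    {a : L} (ha : IsSelfAdjoint a) :
    Filter.Tendsto (fun n => t (e n a)) (Filter.hyperfilter ℕ) (𝓝 (ultraTrace t e a)) :=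
  tendsto_limUnder_hyperfilter (C := ‖a‖ * t 1) fun n =>
    (ht.abs_le (ha.map (e n))).trans (mul_le_mul_of_nonneg_right
      (NonUnitalStarAlgHom.norm_apply_le (e n) a) ht.map_one_nonneg)

theorem IsRealQuasitrace.tendsto_sqNorm_ultraTrace (ht : IsRealQuasitrace t) (e : ℕ → L →⋆ₐ[ℂ] D)
    (x : L) :
    Filter.Tendsto (fun n => sqNorm t (e n x)) (Filter.hyperfilter ℕ)
      (𝓝 (sqNorm (ultraTrace t e) x)) := by
  simpa only [sqNorm, map_mul, map_star] using ht.tendsto_ultraTrace e (.star_mul_self x)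

theorem IsRealQuasitrace.isRealQuasitrace_ultraTrace (ht : IsRealQuasitrace t)
    (e : ℕ → L →⋆ₐ[ℂ] D) : IsRealQuasitrace (ultraTrace t e) where
  tracial x := by
    simp only [ultraTrace, map_mul, map_star, ht.tracial]
  nonneg x := ge_of_tendsto' (ht.tendsto_sqNorm_ultraTrace e x) fun n => ht.sqNorm_nonneg _
  add a b ha hb hab := by
    refine tendsto_nhds_unique (ht.tendsto_ultraTrace e (ha.add hb)) ?_
    refine ((ht.tendsto_ultraTrace e ha).add (ht.tendsto_ultraTrace e hb)).congr fun n => ?_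
    rw [map_add, ht.add _ _ (ha.map _) (hb.map _) (hab.map _)]
  smul r a ha := by
    refine tendsto_nhds_unique (ht.tendsto_ultraTrace e ((IsSelfAdjoint.all r).smul ha)) ?_
    refine ((ht.tendsto_ultraTrace e ha).const_mul r).congr fun n => ?_
    rw [map_real_smul (e n) (map_continuous (e n)), ht.smul _ _ (ha.map _)]

theorem IsMatrixExtension.ultraTrace [PartialOrder L] [StarOrderedRing L] [PartialOrder D]
    [StarOrderedRing D]
    {T : CStarMatrix (Fin 2) (Fin 2) D → ℝ} (h : IsMatrixExtension t T) (e : ℕ → L →⋆ₐ[ℂ] D) :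
    IsMatrixExtension (ultraTrace t e) (ultraTrace T fun n => matrixMap (e n)) where
  quasitrace := h.quasitrace.isRealQuasitrace_ultraTrace e
  quasitrace_matrix := h.quasitrace_matrix.isRealQuasitrace_ultraTrace _
  map_matrixUnit x hx := by
    simp only [_root_.ultraTrace, matrixMap_matrixUnit, h.map_matrixUnit _ (hx.map _)]

end Ultralimit

/-! ### The algebra of Cauchy sequences and its null ideal -/

section CauchyAlgebra

variable {A : Type*} [CStarAlgebra A]

/-- The bounded sequences which are Cauchy for the quasi-norm `sqNorm t`. -/
def sqCauchySubalgebra [PartialOrder A] [StarOrderedRing A] {t : A → ℝ}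
    {T : CStarMatrix (Fin 2) (Fin 2) A → ℝ} (h : IsMatrixExtension t T) :
    StarSubalgebra ℂ (ℕ →ᵇ A) where
  carrier := {x | Filter.Tendsto (fun p : ℕ × ℕ => sqNorm t (x p.1 - x p.2)) Filter.atTop (𝓝 0)}
  mul_mem' {x y} hx hy := by
    have h1 := h.quasitrace.tendsto_sqNorm_mul_left (x := fun p : ℕ × ℕ => x p.1)
      (fun p => x.norm_coe_le_norm p.1) hy
    have h2 := h.quasitrace.tendsto_sqNorm_mul_right hx (y := fun p : ℕ × ℕ => y p.2)
      (fun p => y.norm_coe_le_norm p.2)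
    refine (h.tendsto_sqNorm_add h1 h2).congr fun p => congrArg _ ?_
    simp only [BoundedContinuousFunction.mul_apply]
    noncomm_ring
  add_mem' {x y} hx hy := by
    refine (h.tendsto_sqNorm_add hx hy).congr fun p => congrArg _ ?_
    simp only [BoundedContinuousFunction.add_apply]
    abel
  algebraMap_mem' c := by
    refine tendsto_const_nhds.congr fun p => ?_
    change 0 = sqNorm t (algebraMap ℂ A c - algebraMap ℂ A c)
    rw [sub_self, h.quasitrace.sqNorm_zero]
  star_mem' {x} hx := by
    refine hx.congr fun p => ?_
    rw [BoundedContinuousFunction.star_apply, BoundedContinuousFunction.star_apply, ← star_sub,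
      h.quasitrace.sqNorm_star]

variable {τ : A → ℂ}

theorem mem_cauchySequences_iff (hτ : IsOneQuasitrace τ) {x : ℕ →ᵇ A} :
    x ∈ cauchySequences τ ↔ Filter.Tendsto
      (fun p : ℕ × ℕ => sqNorm (fun a => (τ a).re) (x p.1 - x p.2)) Filter.atTop (𝓝 0) := by
  rw [← tendsto_quasiDist_iff hτ, tendsto_atTop_prod_iff_of_nonneg]
  · rfl
  · intro p
    exact Real.rpow_nonneg (Real.rpow_nonneg (hτ.nonneg _).1 _) _

theorem mem_nullSequences_iff (hτ : IsOneQuasitrace τ) {x : ℕ →ᵇ A} :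
    x ∈ nullSequences τ ↔ Filter.Tendsto
      (fun n => sqNorm (fun a => (τ a).re) (x n)) Filter.atTop (𝓝 0) := by
  have := tendsto_quasiDist_iff hτ (l := Filter.atTop) (x := x) (y := fun _ => 0)
  simp only [sub_zero] at this
  exact this

/-- Evaluation of bounded sequences at `n`. -/
def sequenceEval (A : Type*) [CStarAlgebra A] (n : ℕ) : (ℕ →ᵇ A) →⋆ₐ[ℂ] A where
  toFun x := x n
  map_one' := rfl
  map_mul' _ _ := rfl
  map_zero' := rfl
  map_add' _ _ := rfl
  commutes' _ := rfl
  map_star' _ := rfl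

/-- The Cauchy sequences already form a norm-closed `*`-subalgebra, so generating and closing add
nothing. -/
theorem coe_cauchyAlgebra (hτ : IsQuasitrace τ) :
    (cauchyAlgebra τ : Set (ℕ →ᵇ A)) = cauchySequences τ := by
  let _ := CStarAlgebra.spectralOrder A
  have := CStarAlgebra.spectralOrderedRing A
  obtain ⟨T, h⟩ := hτ.exists_isMatrixExtension
  have hS : (sqCauchySubalgebra h : Set (ℕ →ᵇ A)) = cauchySequences τ :=
    Set.ext fun x => (mem_cauchySequences_iff hτ.toIsOneQuasitrace).symm
  have hclosed : IsClosed (sqCauchySubalgebra h : Set (ℕ →ᵇ A)) := by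
    refine h.isClosed_setOf_tendsto_sqNorm (C := 2) (fun p : ℕ × ℕ =>
      ((sequenceEval A p.1 : (ℕ →ᵇ A) →+ A) - (sequenceEval A p.2 : (ℕ →ᵇ A) →+ A))) fun p x => ?_
    calc ‖x p.1 - x p.2‖ ≤ ‖x p.1‖ + ‖x p.2‖ := norm_sub_le _ _
      _ ≤ ‖x‖ + ‖x‖ := add_le_add (x.norm_coe_le_norm _) (x.norm_coe_le_norm _)
      _ = 2 * ‖x‖ := by ring
  rw [← hS]
  refine congrArg _ (le_antisymm ?_ ?_)
  · exact StarSubalgebra.topologicalClosure_minimal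
      (StarAlgebra.adjoin_le hS.ge) hclosed
  · refine le_trans ?_ (StarSubalgebra.le_topologicalClosure _)
    intro x hx
    exact StarAlgebra.subset_adjoin ℂ _ (hS.le hx)

theorem tendsto_of_mem_cauchyAlgebra (hτ : IsQuasitrace τ) (x : cauchyAlgebra τ) :
    Filter.Tendsto (fun p : ℕ × ℕ => sqNorm (fun a => (τ a).re)
      ((x : ℕ →ᵇ A) p.1 - (x : ℕ →ᵇ A) p.2)) Filter.atTop (𝓝 0) := by
  rw [← mem_cauchySequences_iff hτ.toIsOneQuasitrace, ← coe_cauchyAlgebra hτ]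
  exact x.2

/-- The null sequences form a closed two-sided `*`-ideal `J`, which is therefore the smallest one in
the infimum. -/
theorem mem_nullIdeal_iff (hτ : IsQuasitrace τ) (x : cauchyAlgebra τ) :
    x ∈ nullIdeal τ ↔ (x : ℕ →ᵇ A) ∈ nullSequences τ := by
  let _ := CStarAlgebra.spectralOrder A
  have := CStarAlgebra.spectralOrderedRing A
  obtain ⟨T, h⟩ := hτ.exists_isMatrixExtension
  let J : Ideal (cauchyAlgebra τ) :=
    { carrier := {x | Filter.Tendsto (fun n => sqNorm (fun a => (τ a).re) ((x : ℕ →ᵇ A) n))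
        Filter.atTop (𝓝 0)}
      add_mem' := fun hx hy => h.tendsto_sqNorm_add hx hy
      zero_mem' := tendsto_const_nhds.congr fun _ => h.quasitrace.sqNorm_zero.symm
      smul_mem' := fun c y hy => h.quasitrace.tendsto_sqNorm_mul_left
        (fun n => (c : ℕ →ᵇ A).norm_coe_le_norm n) hy }
  have hJ : CStarQuotient.IsClosedStarIdeal J :=
    { twoSided := ⟨fun {a} b ha => h.quasitrace.tendsto_sqNorm_mul_right ha
        (fun n => (b : ℕ →ᵇ A).norm_coe_le_norm n)⟩
      isClosed := by
        refine IsClosed.preimage continuous_subtype_val (h.isClosed_setOf_tendsto_sqNorm (C := 1)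
          (fun n => (sequenceEval A n : (ℕ →ᵇ A) →+ A)) fun n x => ?_)
        rw [one_mul]
        exact x.norm_coe_le_norm n
      star_mem := fun x hx => hx.congr fun n => (h.quasitrace.sqNorm_star _).symm }
  have hJmem : ∀ x : cauchyAlgebra τ, x ∈ J ↔ (x : ℕ →ᵇ A) ∈ nullSequences τ := fun x =>
    (mem_nullSequences_iff hτ.toIsOneQuasitrace).symm
  refine ⟨fun hx => (hJmem x).1 ?_, fun hx => ?_⟩
  · exact Submodule.mem_sInf.1 hx J ⟨hJ, fun y hy => (hJmem y).2 hy⟩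
  · exact Submodule.mem_sInf.2 fun K hK => hK.2 x hx

/-- The embedding of `A` as the constant sequences. -/
def constantSequence (hτ : IsQuasitrace τ) : A →⋆ₐ[ℂ] cauchyAlgebra τ where
  toFun a := ⟨BoundedContinuousFunction.const ℕ a, by
    rw [← SetLike.mem_coe, coe_cauchyAlgebra hτ, mem_cauchySequences_iff hτ.toIsOneQuasitrace]
    refine tendsto_const_nhds.congr fun p => ?_
    simp only [BoundedContinuousFunction.const_apply, sub_self]
    exact hτ.isRealQuasitrace.sqNorm_zero.symm⟩
  map_one' := rfl
  map_mul' _ _ := rfl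
  map_zero' := rfl
  map_add' _ _ := rfl
  commutes' _ := rfl
  map_star' _ := rfl

/-- Evaluation of `d_τ`-Cauchy sequences at `n`. -/
def cauchyEval (τ : A → ℂ) (n : ℕ) : cauchyAlgebra τ →⋆ₐ[ℂ] A :=
  (sequenceEval A n).comp (cauchyAlgebra τ).subtype

/-- The quotient map onto the `AW*`-completion. -/
def completionMap (τ : A → ℂ) : cauchyAlgebra τ →⋆ₐ[ℂ] AWStarCompletion τ :=
  letI := (isClosedStarIdeal_nullIdeal τ).twoSided
  { toFun := Submodule.Quotient.mk
    map_one' := rfl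
    map_mul' := fun _ _ => rfl
    map_zero' := rfl
    map_add' := fun _ _ => rfl
    commutes' := fun _ => rfl
    map_star' := fun _ => rfl }

theorem completionMap_surjective (τ : A → ℂ) : Function.Surjective (completionMap τ) :=
  Submodule.Quotient.mk_surjective _

theorem completionMap_eq_zero_iff (x : cauchyAlgebra τ) :
    completionMap τ x = 0 ↔ x ∈ nullIdeal τ :=
  Submodule.Quotient.mk_eq_zero _

end CauchyAlgebra

/-! ### The completion as a complete quotient, and the conclusion -/

theorem IsCompleteQuotient.isFiniteAWStarFactor {A L Q : Type*} [CStarAlgebra A] [CStarAlgebra L]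
    [CStarAlgebra Q] [PartialOrder L] [StarOrderedRing L] {t : L → ℝ} {π : L →⋆ₐ[ℂ] Q}
    (hπ : IsCompleteQuotient t π) {T : CStarMatrix (Fin 2) (Fin 2) L → ℝ}
    (h : IsMatrixExtension t T) (φ : A →⋆ₐ[ℂ] L) {τ : A → ℂ}
    (hφ : ∀ a, IsSelfAdjoint a → t (φ a) = (τ a).re)
    (hdense : ∀ x, ∃ a : ℕ → A,
      Filter.Tendsto (fun n => sqNorm t (φ (a n) - x)) Filter.atTop (𝓝 0))
    (hτ : τ ∈ Set.extremePoints ℝ (normalizedQuasitraces A)) : IsFiniteAWStarFactor Q := by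
  let _ := CStarAlgebra.spectralOrder A
  have := CStarAlgebra.spectralOrderedRing A
  let _ := CStarAlgebra.spectralOrder Q
  have := CStarAlgebra.spectralOrderedRing Q
  have h' := h.quotientTrace hπ
  have hφ' : ∀ a, IsSelfAdjoint a → quotientTrace t π (π.comp φ a) = (τ a).re := fun a ha => by
    rw [StarAlgHom.comp_apply, hπ.quotientTrace_map (ha.map _), hφ a ha]
  have h1 : quotientTrace t π 1 = 1 := by
    have := hφ' 1 (.one A)
    rwa [map_one, hτ.1.2, Complex.one_re] at this
  refine ⟨⟨1, 0, fun h10 => ?_⟩, hπ.isAWStarAlgebra, fun v => hπ.mul_star_self_eq_one, fun z hz =>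
    eq_algebraMap_of_mem_center h' h1 (fun x => (hπ.sqNorm_eq_zero_iff x).1)
      (π.comp φ) hφ' (fun b => ?_) hτ hz⟩
  · rw [h10, h'.quasitrace.map_zero] at h1
    exact zero_ne_one h1
  · obtain ⟨x, rfl⟩ := hπ.surjective b
    obtain ⟨a, ha⟩ := hdense x
    refine ⟨a, ha.congr fun m => ?_⟩
    rw [StarAlgHom.comp_apply, ← map_sub, hπ.sqNorm_quotientTrace_map]

section Completion

variable {A : Type*} [CStarAlgebra A] {τ : A → ℂ}

theorem IsMatrixExtension.sqNorm_add_le_sixteen [PartialOrder A] [StarOrderedRing A] {t : A → ℝ}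
    {T : CStarMatrix (Fin 2) (Fin 2) A → ℝ} (h : IsMatrixExtension t T) (x y z : A) :
    sqNorm t (x + y + z) ≤ 16 * (sqNorm t x + sqNorm t y + sqNorm t z) := by
  have h1 := h.sqNorm_add_le_four (x + y) z
  have h2 := h.sqNorm_add_le_four x y
  have h3 := h.quasitrace.sqNorm_nonneg z
  linarith

/-- The trace on the algebra of `d_τ`-Cauchy sequences. -/
def cauchyTrace (τ : A → ℂ) : cauchyAlgebra τ → ℝ :=
  ultraTrace (fun a => (τ a).re) (cauchyEval τ)

theorem frequently_of_eventually_hyperfilter {p : ℕ → Prop}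
    (h : ∀ᶠ n in (Filter.hyperfilter ℕ : Filter ℕ), p n) : ∃ᶠ n in Filter.atTop, p n :=
  h.frequently.filter_mono Nat.hyperfilter_le_atTop

theorem exists_sqNorm_sub_lt (hτ : IsQuasitrace τ) (x : cauchyAlgebra τ) {ε : ℝ} (hε : 0 < ε) :
    ∃ N : ℕ, ∀ m ≥ N, ∀ n ≥ N,
      sqNorm (fun a => (τ a).re) (cauchyEval τ m x - cauchyEval τ n x) < ε :=
  (tendsto_atTop_prod_iff_of_nonneg fun _ => (hτ.nonneg _).1).1
    (tendsto_of_mem_cauchyAlgebra hτ x) ε hε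

theorem tendsto_sqNorm_cauchyTrace (hτ : IsQuasitrace τ) (x : cauchyAlgebra τ) :
    Filter.Tendsto (fun n => sqNorm (fun a => (τ a).re) (cauchyEval τ n x))
      (Filter.hyperfilter ℕ) (𝓝 (sqNorm (cauchyTrace τ) x)) :=
  hτ.isRealQuasitrace.tendsto_sqNorm_ultraTrace (cauchyEval τ) x

/-- A vanishing ultralimit makes the entries small at arbitrarily large indices; for a Cauchy
sequence this spreads to all large indices. -/
theorem sqNorm_cauchyTrace_eq_zero_iff (hτ : IsQuasitrace τ) (x : cauchyAlgebra τ) :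
    sqNorm (cauchyTrace τ) x = 0 ↔ x ∈ nullIdeal τ := by
  let _ := CStarAlgebra.spectralOrder A
  have := CStarAlgebra.spectralOrderedRing A
  obtain ⟨T, h⟩ := hτ.exists_isMatrixExtension
  have hlim := tendsto_sqNorm_cauchyTrace hτ x
  rw [mem_nullIdeal_iff hτ, mem_nullSequences_iff hτ.toIsOneQuasitrace]
  constructor
  · intro h0
    rw [h0] at hlim
    rw [Metric.tendsto_nhds]
    intro ε hε
    obtain ⟨N, hN⟩ := exists_sqNorm_sub_lt hτ x (show 0 < ε / 8 by positivity)
    obtain ⟨m, hm, hmN⟩ := ((frequently_of_eventually_hyperfilter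
      (hlim.eventually_lt_const (show 0 < ε / 8 by positivity))).and_eventually
      (Filter.eventually_ge_atTop N)).exists
    filter_upwards [Filter.eventually_ge_atTop N] with n hn
    rw [Real.dist_eq, sub_zero, abs_of_nonneg (h.quasitrace.sqNorm_nonneg _)]
    have h1 := h.sqNorm_add_le_four (cauchyEval τ n x - cauchyEval τ m x) (cauchyEval τ m x)
    have h2 := hN n hn m hmN
    rw [sub_add_cancel] at h1
    change sqNorm _ (cauchyEval τ n x) < ε
    linarith
  · intro h0
    exact tendsto_nhds_unique hlim (h0.mono_left Nat.hyperfilter_le_atTop)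

/-- Diagonal argument: `k j` is an index beyond which the `x m` are `1/(j+1)`-close, `N j` one
beyond which the entries of `x (k j)` are, and the limit has entry `N j` of `x (k j)` in position
`j`. -/
theorem exists_tendsto_cauchyTrace (hτ : IsQuasitrace τ) (x : ℕ → cauchyAlgebra τ)
    (hx1 : ∀ n, ‖x n‖ ≤ 1)
    (hx : ∀ ε > 0, ∃ N, ∀ m ≥ N, ∀ n ≥ N, sqNorm (cauchyTrace τ) (x m - x n) < ε) :
    ∃ y, Filter.Tendsto (fun n => sqNorm (cauchyTrace τ) (x n - y)) Filter.atTop (𝓝 0) := by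
  let _ := CStarAlgebra.spectralOrder A
  have := CStarAlgebra.spectralOrderedRing A
  obtain ⟨T, h⟩ := hτ.exists_isMatrixExtension
  set t : A → ℝ := fun a => (τ a).re with ht
  have hpos : ∀ j : ℕ, (0 : ℝ) < 1 / (j + 1) := fun j => Nat.one_div_pos_of_nat
  choose k hk using fun j : ℕ => hx (1 / (j + 1)) (hpos j)
  choose N hN using fun j : ℕ => exists_sqNorm_sub_lt hτ (x (k j)) (hpos j)
  set y : ℕ → A := fun j => cauchyEval τ (N j) (x (k j)) with hy
  have hy1 : ∀ j, ‖y j‖ ≤ 1 := fun j =>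
    ((x (k j) : ℕ →ᵇ A).norm_coe_le_norm _).trans (hx1 (k j))
  have hyb : ∀ i j, sqNorm t (y i - y j) ≤ 32 * (1 / (i + 1) + 1 / (j + 1)) := by
    intro i j
    have hij : sqNorm (cauchyTrace τ) (x (k i) - x (k j)) < 1 / (i + 1) + 1 / (j + 1) := by
      rcases le_total (k i) (k j) with hle | hle
      · exact (hk i _ le_rfl _ hle).trans (lt_add_of_pos_right _ (hpos j))
      · exact (hk j _ hle _ le_rfl).trans (lt_add_of_pos_left _ (hpos i))
    obtain ⟨n, hn, hni, hnj⟩ := ((frequently_of_eventually_hyperfilter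
      ((tendsto_sqNorm_cauchyTrace hτ _).eventually_lt_const hij)).and_eventually
      ((Filter.eventually_ge_atTop (N i)).and (Filter.eventually_ge_atTop (N j)))).exists
    have h1 := h.sqNorm_add_le_sixteen (y i - cauchyEval τ n (x (k i)))
      (cauchyEval τ n (x (k i) - x (k j))) (cauchyEval τ n (x (k j)) - y j)
    have h2 : y i - cauchyEval τ n (x (k i)) + cauchyEval τ n (x (k i) - x (k j))
        + (cauchyEval τ n (x (k j)) - y j) = y i - y j := by
      rw [map_sub]; abel
    rw [h2] at h1
    have h3 := hN i (N i) le_rfl n hni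
    have h4 := hN j n hnj (N j) le_rfl
    change sqNorm t (y i - _) < _ at h3
    change sqNorm t (_ - y j) < _ at h4
    linarith
  let Y : ℕ →ᵇ A := BoundedContinuousFunction.ofNormedAddCommGroupDiscrete y 1 hy1
  have hYmem : Y ∈ cauchyAlgebra τ := by
    rw [← SetLike.mem_coe, coe_cauchyAlgebra hτ, mem_cauchySequences_iff hτ.toIsOneQuasitrace]
    have h0 := tendsto_one_div_add_atTop_nhds_zero_nat (𝕜 := ℝ)
    have h1 := ((h0.comp Filter.tendsto_fst).add (h0.comp Filter.tendsto_snd)).const_mul 32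
    rw [add_zero, mul_zero, Filter.prod_atTop_atTop_eq] at h1
    exact squeeze_zero (fun p => h.quasitrace.sqNorm_nonneg _) (fun p => hyb p.1 p.2) h1
  refine ⟨⟨Y, hYmem⟩, ?_⟩
  have hYe : ∀ n, cauchyEval τ n ⟨Y, hYmem⟩ = y n := fun n => rfl
  rw [Metric.tendsto_nhds]
  intro ε hε
  -- For `n ≥ j` the three-term estimate totals at most `16 (1 + 1 + 64) / (j + 1) = 1056 / (j +
  -- 1)`, so `4000` leaves it below `ε / 2`.
  obtain ⟨j, hj⟩ := exists_nat_one_div_lt (show 0 < ε / 4000 by positivity)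
  filter_upwards [Filter.eventually_ge_atTop (k j)] with m hm
  have hnonneg : 0 ≤ sqNorm (cauchyTrace τ) (x m - ⟨Y, hYmem⟩) :=
    ge_of_tendsto' (tendsto_sqNorm_cauchyTrace hτ _) fun n => h.quasitrace.sqNorm_nonneg _
  rw [Real.dist_eq, sub_zero, abs_of_nonneg hnonneg]
  refine lt_of_le_of_lt (le_of_tendsto (tendsto_sqNorm_cauchyTrace hτ _) (b := ε / 2) ?_)
    (half_lt_self hε)
  filter_upwards [(tendsto_sqNorm_cauchyTrace hτ _).eventually_lt_const (hk j m hm (k j) le_rfl),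
    Nat.hyperfilter_le_atTop (Filter.eventually_ge_atTop (N j)),
    Nat.hyperfilter_le_atTop (Filter.eventually_ge_atTop j)] with n hn1 hn2 hn3
  have h1 := h.sqNorm_add_le_sixteen (cauchyEval τ n (x m - x (k j)))
    (cauchyEval τ n (x (k j)) - y j) (y j - y n)
  have h2 : cauchyEval τ n (x m - x (k j)) + (cauchyEval τ n (x (k j)) - y j) + (y j - y n)
      = cauchyEval τ n (x m - ⟨Y, hYmem⟩) := by
    rw [map_sub, map_sub, hYe]; abel
  rw [h2] at h1
  have h3 := hN j n hn2 (N j) le_rfl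
  change sqNorm t (_ - y j) < _ at h3
  change sqNorm t _ < _ at hn1
  have h4 := hyb j n
  have h5 : (1 : ℝ) / (n + 1) ≤ 1 / (j + 1) := Nat.one_div_le_one_div hn3
  change sqNorm t _ ≤ _
  linarith

theorem isCompleteQuotient_completionMap (hτ : IsQuasitrace τ) :
    IsCompleteQuotient (cauchyTrace τ) (completionMap τ) where
  quasitrace := hτ.isRealQuasitrace.isRealQuasitrace_ultraTrace _
  surjective := completionMap_surjective τ
  map_eq_zero_iff x := by
    rw [completionMap_eq_zero_iff, sqNorm_cauchyTrace_eq_zero_iff hτ]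
  exists_add_le := by
    let _ := CStarAlgebra.spectralOrder A
    have := CStarAlgebra.spectralOrderedRing A
    obtain ⟨T, h⟩ := hτ.exists_isMatrixExtension
    refine ⟨4, fun x y => le_of_tendsto_of_tendsto' (tendsto_sqNorm_cauchyTrace hτ (x + y))
      (((tendsto_sqNorm_cauchyTrace hτ x).add (tendsto_sqNorm_cauchyTrace hτ y)).const_mul 4)
      fun n => ?_⟩
    rw [map_add]
    exact h.sqNorm_add_le_four _ _
  complete := exists_tendsto_cauchyTrace hτ

theorem cauchyTrace_constantSequence (hτ : IsQuasitrace τ) (a : A) :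
    cauchyTrace τ (constantSequence hτ a) = (τ a).re :=
  Filter.Tendsto.limUnder_eq tendsto_const_nhds

/-- Density of `A`: a Cauchy sequence is the limit of the constant sequences formed from its own
entries. -/
theorem tendsto_sqNorm_constantSequence_sub (hτ : IsQuasitrace τ) (x : cauchyAlgebra τ) :
    Filter.Tendsto (fun m => sqNorm (cauchyTrace τ) (constantSequence hτ (cauchyEval τ m x) - x))
      Filter.atTop (𝓝 0) := by
  rw [Metric.tendsto_atTop]
  intro ε hε
  obtain ⟨N, hN⟩ := exists_sqNorm_sub_lt hτ x (half_pos hε)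
  refine ⟨N, fun m hm => ?_⟩
  have hlim := tendsto_sqNorm_cauchyTrace hτ (constantSequence hτ (cauchyEval τ m x) - x)
  rw [Real.dist_eq, sub_zero, abs_of_nonneg
    (ge_of_tendsto' hlim fun n => (hτ.nonneg _).1)]
  refine lt_of_le_of_lt (le_of_tendsto hlim ?_) (half_lt_self hε)
  filter_upwards [Nat.hyperfilter_le_atTop (Filter.eventually_ge_atTop N)] with n hn
  exact (hN m hm n hn).le

theorem isFiniteAWStarFactor_of_mem_extremePoints
    (hτ : τ ∈ Set.extremePoints ℝ (normalizedQuasitraces A)) :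
    IsFiniteAWStarFactor (AWStarCompletion τ) := by
  have hq : IsQuasitrace τ := hτ.1.1
  let _ := CStarAlgebra.spectralOrder A
  have := CStarAlgebra.spectralOrderedRing A
  let _ := CStarAlgebra.spectralOrder (cauchyAlgebra τ)
  have := CStarAlgebra.spectralOrderedRing (cauchyAlgebra τ)
  obtain ⟨T, h⟩ := hq.exists_isMatrixExtension
  exact (isCompleteQuotient_completionMap hq).isFiniteAWStarFactor (h.ultraTrace (cauchyEval τ))
    (constantSequence hq) (fun a _ => cauchyTrace_constantSequence hq a)
    (fun x => ⟨fun m => cauchyEval τ m x, tendsto_sqNorm_constantSequence_sub hq x⟩) hτ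

end Completion

end

theorem proposition4p6 {A : Type*} [CStarAlgebra A] (τ : A → ℂ)
    (hfaithful : IsFaithful τ)
    (hextreme : τ ∈ Set.extremePoints ℝ (normalizedQuasitraces A)) :
    (cauchyAlgebra τ : Set (ℕ →ᵇ A)) = cauchySequences τ ∧
    (∀ x : cauchyAlgebra τ, x ∈ nullIdeal τ ↔ (x : ℕ →ᵇ A) ∈ nullSequences τ) ∧
    IsFiniteAWStarFactor (AWStarCompletion τ) :=
  ⟨coe_cauchyAlgebra hextreme.1.1, mem_nullIdeal_iff hextreme.1.1,
    isFiniteAWStarFactor_of_mem_extremePoints hextreme⟩
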